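/- Let $(r,\theta,z)$ be cylindrical coordinates in $\mathbb R^3$. Let $\Omega\subset\mathbb R^3$ be an axisymmetric toroidal domain with analytic boundary: $\Omega$ is open and invariant under rotations about the $x_3$-axis, $\overline\Omega$ does not meet the $x_3$-axis, $\partial\Omega$ is real analytic (with $\Omega$ lying locally on one side of it), and the closed section $\Sigma:=\overline\Omega\cap\{\theta=0\}$, parametrized by $(r,z)$, is diffeomorphic to the closed unit disk. Let $\mathcal B(\overline\Omega)$ be the space of braided fields, that is, of $C^\infty$ vector fields $B$ on $\overline\Omega$ with $\operatorname{div}B=0$ in $\Omega$, $B\cdot N=0$ on $\partial\Omega$ ($N$ being the unit outer normal) and $B^\theta>0$ on $\overline\Omega$, where $B=B^r\partial_r+B^\theta\partial_\theta+B^z\partial_z$. For $B\in\mathcal B(\overline\Omega)$ let $\Pi_B:\Sigma\to\Sigma$ be its Poincaré (first return) map and put $\mu:=r\,dr\,dz$ and $\mu_B:=B^\theta(r,0,z)\,r\,dr\,dz$, which are measures on $\Sigma$. Let $\operatorname{Diff}(\Sigma)$ be the set of $C^\infty$ diffeomorphisms of $\Sigma$, and let $\operatorname{Diff}^+_\mu(\Sigma)$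 be the set of those that preserve $\mu$ and are isotopic to the identity. All these spaces carry the $C^\infty$ topology. **Lemma 2.2.** There exists a continuous map $\mathcal J:\mathcal B(\overline\Omega)\to\operatorname{Diff}^+_\mu(\Sigma)$ such that, for each $B\in\mathcal B(\overline\Omega)$, there is a $C^\infty$ diffeomorphism $Y_B$ of $\Sigma$ with $$\mathcal J(B)=Y_B\circ\Pi_B\circ Y_B^{-1}.$$ Moreover, the diffeomorphisms $Y_B$ can be chosen so that the map $B\mapsto Y_B\in\operatorname{Diff}(\Sigma)$ is continuous and $Y_B^*\mu=\frac{\mu(\Sigma)}{\mu_B(\Sigma)}\,\mu_B$ for every $B$. -/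

import Mathlib

open MeasureTheory Set Topology
open scoped ContDiff UniformConvergence ENNReal

noncomputable section

/-- Euclidean 3-space; the coordinates `x 0`, `x 1`, `x 2` are the Cartesian coordinates
`x₁`, `x₂`, `x₃`. The axis of symmetry is `{x 0 = x 1 = 0}`. -/
abbrev E3 := EuclideanSpace ℝ (Fin 3)

/-- The plane of the cylindrical coordinates `(r, z)`, with `q 0 = r` and `q 1 = z`. -/
abbrev E2 := EuclideanSpace ℝ (Fin 2)

/-! ### Smooth functions on closed sets and the smooth topology -/

section Smooth

variable {E F : Type*} [NormedAddCommGroup E] [NormedSpace ℝ E]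
  [NormedAddCommGroup F] [NormedSpace ℝ F]

/-- A function on a subset `K` of a normed space is smooth if it is the restriction to `K` of
a `C^∞` function on the whole space. (All sets `K` below are compact.) -/
def IsSmoothOnSet {K : Set E} (f : K → F) : Prop :=
  ∃ g : E → F, ContDiff ℝ ∞ g ∧ ∀ x : K, g x = f x

/-- Extension by zero. It only serves to feed a function on `K` to Mathlib's derivatives
(within `K`, or at interior points of `K`), which do not see the values off `K`. -/
def extendByZero {K : Set E} (f : K → F) : E → F :=
  Function.extend Subtype.val f 0

/-- All the derivatives of `f : K → F` along `K`, each seen as an element of the space of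
functions on `K` with the topology of uniform convergence. -/
def allDerivs {K : Set E} (f : K → F) (k : ℕ) : K →ᵤ (E [×k]→L[ℝ] F) :=
  UniformFun.ofFun fun x : K => iteratedFDerivWithin ℝ k (extendByZero f) K x

end Smooth

/-- A `C^∞` diffeomorphism between two subsets of the plane: a bijection which is smooth,
with smooth inverse. -/
structure SmoothDiffeo (K L : Set E2) where
  toEquiv : K ≃ L
  smooth_toFun : IsSmoothOnSet fun x : K => (toEquiv x : E2)
  smooth_invFun : IsSmoothOnSet fun y : L => (toEquiv.symm y : E2)

/-- The `C^∞` topology on diffeomorphisms: uniform convergence on `K` of the maps and of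
all their derivatives. -/
instance (K L : Set E2) : TopologicalSpace (SmoothDiffeo K L) :=
  TopologicalSpace.induced (fun Φ => allDerivs fun x : K => (Φ.toEquiv x : E2)) inferInstance

/-- `Φ` is isotopic to the identity: there is a smooth family `H t`, `t ∈ [0,1]`, of
diffeomorphisms of `K` with `H 0 = id` and `H 1 = Φ`. -/
def IsIsotopicToId {K : Set E2} (Φ : SmoothDiffeo K K) : Prop :=
  ∃ H : Icc (0 : ℝ) 1 → SmoothDiffeo K K,
    (∃ G : ℝ × E2 → E2, ContDiff ℝ ∞ G ∧
      ∀ (t : Icc (0 : ℝ) 1) (x : K), G (t, x) = (H t).toEquiv x) ∧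
    (∀ x : K, (H 0).toEquiv x = x) ∧ (∀ x : K, (H 1).toEquiv x = Φ.toEquiv x)

/-! ### Axisymmetric toroidal domains -/

/-- The point of the half-plane `{θ = 0}` with cylindrical coordinates `(r, 0, z)`. -/
def halfPlanePoint (q : E2) : E3 := !₂[q 0, 0, q 1]

/-- The closed section `Σ = closure Ω ∩ {θ = 0} = closure Ω ∩ {x₁ > 0, x₂ = 0}`,
parametrized by the coordinates `(r, z)`. -/
def closedSection (Ω : Set E3) : Set E2 :=
  {q | 0 < q 0 ∧ halfPlanePoint q ∈ closure Ω}

/-- Near `p`, the set `Ω` is `{ρ < 0}`, where `ρ` has nonzero gradient at `p`. -/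
def IsLocalDefiningFunction (Ω : Set E3) (p : E3) (ρ : E3 → ℝ) : Prop :=
  ContDiffAt ℝ ∞ ρ p ∧ gradient ρ p ≠ 0 ∧ ∀ᶠ x in 𝓝 p, (x ∈ Ω ↔ ρ x < 0)

/-- `ν` is the unit outer normal vector to `∂Ω` at `p`. -/
def IsUnitOuterNormal (Ω : Set E3) (p ν : E3) : Prop :=
  ∃ ρ, IsLocalDefiningFunction Ω p ρ ∧ ν = ‖gradient ρ p‖⁻¹ • gradient ρ p

/-- An axisymmetric toroidal domain with analytic boundary: its closure is the body of
revolution generated by a closed section which is diffeomorphic to the closed unit disk and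
does not meet the axis. -/
structure IsAxisymmetricToroidalDomain (Ω : Set E3) : Prop where
  isOpen : IsOpen Ω
  axisymmetric : ∀ x y : E3,
    x 0 ^ 2 + x 1 ^ 2 = y 0 ^ 2 + y 1 ^ 2 → x 2 = y 2 → x ∈ Ω → y ∈ Ω
  off_axis : ∀ x ∈ closure Ω, 0 < x 0 ^ 2 + x 1 ^ 2
  section_disk :
    Nonempty (SmoothDiffeo (Metric.closedBall (0 : E2) 1) (closedSection Ω))
  analytic_boundary : ∀ p ∈ frontier Ω,
    ∃ ρ, AnalyticAt ℝ ρ p ∧ IsLocalDefiningFunction Ω p ρ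

/-! ### Braided fields -/

/-- The `θ`-component of a vector `v` at the point `x` in the holonomic cylindrical basis
`∂_r, ∂_θ, ∂_z`; here `∂_θ = (-x₂, x₁, 0)` has length `r`. -/
def swirl (x v : E3) : ℝ := (x 0 * v 1 - x 1 * v 0) / (x 0 ^ 2 + x 1 ^ 2)

/-- Braided fields: smooth divergence-free vector fields on `closure Ω`, tangent to the
boundary, with positive swirl. -/
structure BraidedField (Ω : Set E3) where
  toFun : closure Ω → E3
  smooth : IsSmoothOnSet toFun
  div_eq_zero : ∀ x ∈ Ω,
    ∑ i, fderiv ℝ (extendByZero toFun) x (EuclideanSpace.single i 1) i = 0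
  tangent : ∀ x : closure Ω, (x : E3) ∈ frontier Ω →
    ∀ ν, IsUnitOuterNormal Ω x ν → inner ℝ (toFun x) ν = 0
  swirl_pos : ∀ x : closure Ω, 0 < swirl x (toFun x)

/-- The `C^∞` topology on braided fields. -/
instance (Ω : Set E3) : TopologicalSpace (BraidedField Ω) :=
  TopologicalSpace.induced (fun B => allDerivs B.toFun) inferInstance

/-! ### Poincaré maps -/

/-- The trajectory of `B` that starts at the point `q` of the section returns to the section
for the first time, at some time `τ > 0`, at the point `q'`. -/
def IsFirstReturn {Ω : Set E3} (B : BraidedField Ω) (q q' : closedSection Ω) : Prop :=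
  ∃ τ : ℝ, 0 < τ ∧ ∃ γ : ℝ → E3,
    (∀ t ∈ Icc 0 τ, ∃ h : γ t ∈ closure Ω,
      HasDerivWithinAt γ (B.toFun ⟨γ t, h⟩) (Icc 0 τ) t) ∧
    γ 0 = halfPlanePoint q ∧ γ τ = halfPlanePoint q' ∧
    ∀ t ∈ Ioo 0 τ, ¬ (0 < γ t 0 ∧ γ t 1 = 0)

/-- `P` is the Poincaré map (first return map) of `B` on the closed section. As integral
curves are unique, there is at most one such `P`. -/
def IsPoincareMap {Ω : Set E3} (B : BraidedField Ω)
    (P : closedSection Ω → closedSection Ω) : Prop :=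
  ∀ q, IsFirstReturn B q (P q)

/-! ### Measures on the section and area-preserving diffeomorphisms -/

/-- The area measure `μ = r dr dz` on the section. -/
def areaMeasure (Ω : Set E3) : Measure (closedSection Ω) :=
  (Measure.comap Subtype.val volume).withDensity fun q => ENNReal.ofReal ((q : E2) 0)

/-- The measure `μ_B = B^θ(r,0,z) r dr dz` on the section. -/
def fieldMeasure {Ω : Set E3} (B : BraidedField Ω) : Measure (closedSection Ω) :=
  (Measure.comap Subtype.val volume).withDensity fun q =>
    ENNReal.ofReal
      (swirl (halfPlanePoint q) (B.toFun ⟨halfPlanePoint q, q.2.2⟩) * (q : E2) 0)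

/-- `Diff⁺_μ(Σ)`: the diffeomorphisms of the section that preserve `μ` and are isotopic to
the identity, with the `C^∞` topology (the subspace topology). -/
def AreaPreservingDiffeo (Ω : Set E3) : Type :=
  {Φ : SmoothDiffeo (closedSection Ω) (closedSection Ω) //
    MeasurePreserving Φ.toEquiv (areaMeasure Ω) (areaMeasure Ω) ∧ IsIsotopicToId Φ}

instance (Ω : Set E3) : TopologicalSpace (AreaPreservingDiffeo Ω) :=
  inferInstanceAs (TopologicalSpace (Subtype _))

end

set_option linter.unusedSectionVars false

/-! The lines of a braided field can be followed with the angle θ as time: they are the graphs of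
the solutions of dq/dθ = X(θ, q) on the section, X being the meridional part of B divided by B^θ
(`sectionField`). Multiplied by r, the equation div B = 0 becomes the continuity equation ∂_θ(rB^θ)
+ div(rB^θ X) = 0. The Poincaré map is the flow of X from θ = 0 to θ = 2π. By Liouville's formula
(`det_mul_density_eq`) it preserves μ_B, because rB^θ returns to its initial value after a full turn
(`BraidedField.det_fderiv_flow`).

The conjugation Y_B comes from Moser's argument. To carry a density a to a density b of the same
mass, solve div Z = a - b with Z tangent to the boundary and flow for unit time along Z/ρ_t, where
ρ_t = (1 - t)a + tb (`exists_moser`). As Z has to depend continuously on the data, it is given by a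
formula on the unit disk (`divInverse`): a radial field with divergence a - b, corrected by a
rotated gradient that makes its normal component on the circle constant, the constant being zero
when the masses agree. The conjugated Poincaré map then preserves μ, and letting the final angle run
from 0 to 2π gives its isotopy to the identity.

Continuity in B rests on `FamilyOn`. Fields and charts are extended off their closed domains by
arbitrary choices, so joint continuity in the parameter can be asked only of derivatives at points
of the domain; these do not depend on the extension (`allDerivs_apply`). Such families are stable
under products, compositions, integrals over [0, 1] and, by Gronwall's inequality and the
variational equation, flows (`FamilyOn.flow`). A chart moves everything to the unit disk, where a
field tangent to the circle has a flow that preserves the disk (`exists_disk_flow`). -/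

/-! ### Superposition operators on spaces of continuous maps -/

section Superposition

variable {I E F G : Type} [TopologicalSpace I] [CompactSpace I]
  [NormedAddCommGroup E] [NormedSpace ℝ E] [NormedAddCommGroup F] [NormedSpace ℝ F]

/-- Pointwise application, as a bounded bilinear map. -/
noncomputable def pointwiseApply (I E F : Type) [TopologicalSpace I] [CompactSpace I]
    [NormedAddCommGroup E] [NormedSpace ℝ E] [NormedAddCommGroup F] [NormedSpace ℝ F] :
    C(I, E →L[ℝ] F) →L[ℝ] C(I, E) →L[ℝ] C(I, F) :=
  LinearMap.mkContinuous₂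
    (LinearMap.mk₂ ℝ (fun (A : C(I, E →L[ℝ] F)) (γ : C(I, E)) =>
        (⟨fun s => A s (γ s), by fun_prop⟩ : C(I, F)))
      (fun A B γ => by ext s; simp) (fun c A γ => by ext s; simp)
      (fun A γ η => by ext s; simp) (fun c A γ => by ext s; simp)) 1
    (fun A γ => by
      rw [one_mul, ContinuousMap.norm_le _ (by positivity)]
      intro s
      exact (A s).le_opNorm_of_le (γ.norm_coe_le_norm s) |>.trans
        (mul_le_mul_of_nonneg_right (A.norm_coe_le_norm s) (norm_nonneg _)))

@[simp] lemma pointwiseApply_apply (A : C(I, E →L[ℝ] F)) (γ : C(I, E)) (s : I) :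
    pointwiseApply I E F A γ s = A s (γ s) := rfl

lemma norm_pointwiseApply_le (A : C(I, E →L[ℝ] F)) {L : ℝ} (hL : 0 ≤ L) (h : ∀ s, ‖A s‖ ≤ L) :
    ‖pointwiseApply I E F A‖ ≤ L := by
  refine ContinuousLinearMap.opNorm_le_bound _ hL fun γ => ?_
  rw [ContinuousMap.norm_le _ (by positivity)]
  intro s
  exact (A s).le_of_opNorm_le_of_le (h s) (γ.norm_coe_le_norm s)

/-- The superposition operator `γ ↦ V ∘ γ`. -/
def superposition (I : Type) [TopologicalSpace I] (V : E → F) (hV : Continuous V) (γ : C(I, E)) :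
    C(I, F) := ⟨fun s => V (γ s), hV.comp γ.continuous⟩

@[simp] lemma superposition_apply (V : E → F) (hV : Continuous V) (γ : C(I, E)) (s : I) :
    superposition I V hV γ s = V (γ s) := rfl

/-- `fderiv ℝ V` is uniformly continuous at the compact range of `γ`, so the mean value inequality
bounds the remainder by `ε * ‖η s‖` for all `s` at once. -/
lemma hasFDerivAt_superposition {V : E → F} (hV : ContDiff ℝ 1 V) (γ : C(I, E)) :
    HasFDerivAt (superposition I V hV.continuous)
      (pointwiseApply I E F (superposition I (fderiv ℝ V) (hV.continuous_fderiv one_ne_zero) γ))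
      γ := by
  rw [hasFDerivAt_iff_isLittleO_nhds_zero, Asymptotics.isLittleO_iff]
  intro ε hε
  have hc : IsCompact (range γ) := isCompact_range γ.continuous
  have hu := hc.uniformContinuousAt_of_continuousAt (fderiv ℝ V)
    (fun a _ => (hV.continuous_fderiv one_ne_zero).continuousAt) (Metric.dist_mem_uniformity hε)
  obtain ⟨δ, hδ, h⟩ := Metric.mem_uniformity_dist.1 hu
  filter_upwards [Metric.ball_mem_nhds (0 : C(I, E)) hδ] with η hη
  rw [ContinuousMap.norm_le _ (by positivity)]
  intro s
  have hs : ‖η s‖ < δ := (η.norm_coe_le_norm s).trans_lt (by simpa using hη)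
  have key : ‖V (γ s + η s) - V (γ s) - fderiv ℝ V (γ s) (γ s + η s - γ s)‖
      ≤ ε * ‖γ s + η s - γ s‖ := by
    refine (convex_ball (γ s) δ).norm_image_sub_le_of_norm_hasFDerivWithin_le'
      (f' := fderiv ℝ V) (fun x _ =>
        (hV.differentiable one_ne_zero x).hasFDerivAt.hasFDerivWithinAt)
      (fun x hx => ?_) (Metric.mem_ball_self hδ) (by simpa [dist_eq_norm] using hs)
    have := h (a := γ s) (b := x) (by rwa [dist_comm]) ⟨s, rfl⟩
    simp only [mem_ofPred_eq] at this
    rw [← dist_eq_norm, dist_comm]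
    exact this.le
  simp only [add_sub_cancel_left] at key
  refine key.trans ?_
  gcongr
  exact η.norm_coe_le_norm s

/-- The derivative is again a superposition operator, that of `fderiv ℝ V`, followed by a bounded
linear map; hence an induction over all target spaces simultaneously. -/
lemma contDiff_superposition {V : E → F} (hV : ContDiff ℝ ∞ V) :
    ContDiff ℝ ∞ (superposition I V hV.continuous) := by
  rw [contDiff_infty]
  intro n
  induction n generalizing F with
  | zero =>
    exact contDiff_zero.2 (continuous_iff_continuousAt.2 fun γ =>
      (hasFDerivAt_superposition (hV.of_le (by simp)) γ).continuousAt)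
  | succ n ih =>
    refine contDiff_succ_iff_hasFDerivAt.2 ⟨_, ?_, hasFDerivAt_superposition (hV.of_le (by simp))⟩
    exact (pointwiseApply I E F).contDiff.comp (ih (hV.fderiv_right (m := ∞) (by simp)))

end Superposition

/-! ### Integrals over [0, 1] that depend smoothly on a parameter -/

section ParametricIntegral

variable {E F : Type} [NormedAddCommGroup E] [NormedSpace ℝ E]
  [NormedAddCommGroup F] [NormedSpace ℝ F]

/-- Integration over `[0, s]` of a continuous map on `[0, 1]`. -/
noncomputable def primitiveFun (γ : C(Icc (0 : ℝ) 1, F)) (s : ℝ) : F :=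
  ∫ u in (0 : ℝ)..s, IccExtend zero_le_one γ u

lemma continuous_primitiveFun (γ : C(Icc (0 : ℝ) 1, F)) : Continuous (primitiveFun γ) :=
  intervalIntegral.continuous_primitive
    (fun _ _ => (γ.continuous.Icc_extend').intervalIntegrable _ _) 0

/-- The Volterra operator on `C([0, 1])`. -/
noncomputable def volterra (F : Type) [NormedAddCommGroup F] [NormedSpace ℝ F] :
    C(Icc (0 : ℝ) 1, F) →L[ℝ] C(Icc (0 : ℝ) 1, F) :=
  LinearMap.mkContinuous
    { toFun := fun γ => ⟨fun s => primitiveFun γ s, (continuous_primitiveFun γ).comp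
        continuous_subtype_val⟩
      map_add' := fun γ η => by
        ext s
        exact intervalIntegral.integral_add ((γ.continuous.Icc_extend').intervalIntegrable _ _)
          ((η.continuous.Icc_extend').intervalIntegrable _ _)
      map_smul' := fun c γ => by
        ext s
        exact intervalIntegral.integral_smul c _ } 1
    (fun γ => by
      rw [one_mul, ContinuousMap.norm_le _ (norm_nonneg _)]
      intro s
      refine (intervalIntegral.norm_integral_le_of_norm_le_const (C := ‖γ‖)
        (fun u _ => γ.norm_coe_le_norm _)).trans ?_
      rw [sub_zero, abs_of_nonneg s.2.1]
      exact mul_le_of_le_one_right (norm_nonneg _) s.2.2)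

lemma volterra_apply (γ : C(Icc (0 : ℝ) 1, F)) (s : Icc (0 : ℝ) 1) :
    volterra F γ s = ∫ u in (0 : ℝ)..s, IccExtend zero_le_one γ u := rfl

lemma norm_volterra_le : ‖volterra F‖ ≤ 1 := LinearMap.mkContinuous_norm_le _ zero_le_one _

end ParametricIntegral

section ParametricIntegral

variable {E F : Type} [NormedAddCommGroup E] [NormedSpace ℝ E]
  [NormedAddCommGroup F] [NormedSpace ℝ F]

/-- The slice `s ↦ (s, x)` over `[0, 1]`. -/
def sliceMap (x : E) : C(Icc (0 : ℝ) 1, ℝ × E) := ⟨fun s => (s, x), by fun_prop⟩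

/-- The linear part of `sliceMap`. -/
noncomputable def sliceCLM (E : Type) [NormedAddCommGroup E] [NormedSpace ℝ E] :
    E →L[ℝ] C(Icc (0 : ℝ) 1, ℝ × E) :=
  (ContinuousLinearMap.compLeftContinuous ℝ (Icc (0 : ℝ) 1) (ContinuousLinearMap.inr ℝ ℝ E)).comp
      (ContinuousLinearMap.const ℝ (Icc (0 : ℝ) 1))

lemma sliceMap_eq : sliceMap (E := E) = fun x => sliceMap 0 + sliceCLM E x := by
  ext x s <;> simp [sliceMap, sliceCLM]

lemma hasFDerivAt_sliceMap (x : E) : HasFDerivAt (sliceMap (E := E)) (sliceCLM E) x := by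
  rw [sliceMap_eq]
  exact (sliceCLM E).hasFDerivAt.const_add _

lemma contDiff_sliceMap : ContDiff ℝ ∞ (sliceMap (E := E)) := by
  rw [sliceMap_eq]
  exact contDiff_const.add (sliceCLM E).contDiff

/-- The integral over `[0, 1]` of a continuous map, as a continuous linear map. -/
noncomputable def integralCLM (F : Type) [NormedAddCommGroup F] [NormedSpace ℝ F] :
    C(Icc (0 : ℝ) 1, F) →L[ℝ] F :=
  (ContinuousMap.evalCLM ℝ (1 : Icc (0 : ℝ) 1)).comp (volterra F)

lemma integralCLM_apply (γ : C(Icc (0 : ℝ) 1, F)) :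
    integralCLM F γ = ∫ u in (0 : ℝ)..1, IccExtend zero_le_one γ u := by
  simp [integralCLM, volterra_apply]

lemma integralCLM_superposition {V : ℝ × E → F} (hV : Continuous V) (x : E) :
    integralCLM F (superposition _ V hV (sliceMap x)) = ∫ u in (0 : ℝ)..1, V (u, x) := by
  rw [integralCLM_apply]
  refine intervalIntegral.integral_congr fun u hu => ?_
  rw [uIcc_of_le zero_le_one] at hu
  simp [IccExtend_of_mem _ _ hu, sliceMap]

/-- The integral is the composite of the affine map `sliceMap`, a smooth superposition operator and
a continuous linear map. -/
lemma contDiff_parametric_integral {V : ℝ × E → F} (hV : ContDiff ℝ ∞ V) :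
    ContDiff ℝ ∞ fun x => ∫ u in (0 : ℝ)..1, V (u, x) := by
  have : (fun x => ∫ u in (0 : ℝ)..1, V (u, x)) =
      fun x => integralCLM F (superposition _ V hV.continuous (sliceMap x)) := by
    ext x; rw [integralCLM_superposition]
  rw [this]
  exact (integralCLM F).contDiff.comp ((contDiff_superposition hV).comp contDiff_sliceMap)

lemma fderiv_slice {V : ℝ × E → F} (hV : ContDiff ℝ ∞ V) (u : ℝ) (x : E) :
    fderiv ℝ (fun y => V (u, y)) x = (fderiv ℝ V (u, x)).comp (ContinuousLinearMap.inr ℝ ℝ E) :=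
  ((hV.differentiable (by simp) (u, x)).hasFDerivAt.comp x (hasFDerivAt_prodMk_right u x)).fderiv

lemma contDiff_fderiv_slice {V : ℝ × E → F} (hV : ContDiff ℝ ∞ V) :
    ContDiff ℝ ∞ fun z : ℝ × E => fderiv ℝ (fun y => V (z.1, y)) z.2 := by
  simp_rw [fderiv_slice hV]
  exact (hV.fderiv_right (m := ∞) (by simp)).clm_comp contDiff_const

lemma fderiv_parametric_integral [CompleteSpace F] {V : ℝ × E → F} (hV : ContDiff ℝ ∞ V) (x : E) :
    fderiv ℝ (fun x => ∫ u in (0 : ℝ)..1, V (u, x)) x =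
      ∫ u in (0 : ℝ)..1, fderiv ℝ (fun y => V (u, y)) x := by
  have h : HasFDerivAt (fun x => integralCLM F (superposition _ V hV.continuous (sliceMap x))) _ x :=
    (integralCLM F).hasFDerivAt.comp x
      (HasFDerivAt.comp (g := superposition (Icc (0 : ℝ) 1) V hV.continuous) x
        (hasFDerivAt_superposition (hV.of_le (by simp)) _) (hasFDerivAt_sliceMap x))
  simp_rw [integralCLM_superposition] at h
  rw [h.fderiv]
  ext v
  have hc : Continuous fun u : ℝ => fderiv ℝ (fun y => V (u, y)) x :=
    (contDiff_fderiv_slice hV).continuous.comp (by fun_prop : Continuous fun u : ℝ => (u, x))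
  rw [ContinuousLinearMap.intervalIntegral_apply (hc.intervalIntegrable _ _)]
  simp only [ContinuousLinearMap.comp_apply, integralCLM_apply]
  refine intervalIntegral.integral_congr fun u hu => ?_
  rw [uIcc_of_le zero_le_one] at hu
  simp [IccExtend_of_mem _ _ hu, sliceMap, sliceCLM, fderiv_slice hV]

end ParametricIntegral

/-! ### Global flows and their smoothness -/

section Flow

variable {E : Type} [NormedAddCommGroup E] [NormedSpace ℝ E] [CompleteSpace E]

lemma exists_integralCurve_Ioo {V : E → E} {K C : NNReal} (hK : LipschitzWith K V)
    (hC : ∀ x, ‖V x‖ ≤ C) (x : E) (T : ℝ) :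
    ∃ α : ℝ → E, α 0 = x ∧ ∀ t ∈ Ioo (-T) T, HasDerivAt α (V (α t)) t := by
  rcases le_or_gt T 0 with hT | hT
  · exact ⟨fun _ => x, rfl, fun t ht => by grind⟩
  have hP : IsPicardLindelof (fun _ => V) (tmin := -T) (tmax := T) ⟨0, by grind⟩ x
      (C * T.toNNReal) 0 C K :=
    { lipschitzOnWith := fun t _ => hK.lipschitzOnWith
      continuousOn := fun y _ => continuousOn_const
      norm_le := fun t _ y _ => hC y
      mul_max_le := by simp [hT.le] }
  obtain ⟨α, h0, h⟩ := hP.exists_eq_forall_mem_Icc_hasDerivWithinAt₀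
  exact ⟨α, h0, fun t ht => (h t (Ioo_subset_Icc_self ht)).hasDerivAt (Icc_mem_nhds ht.1 ht.2)⟩

/-- A bounded Lipschitz vector field has a global flow. -/
lemma exists_flow {V : E → E} {K C : NNReal} (hK : LipschitzWith K V) (hC : ∀ x, ‖V x‖ ≤ C) :
    ∃ Φ : ℝ → E → E, (∀ x, Φ 0 x = x) ∧ ∀ t x, HasDerivAt (fun s => Φ s x) (V (Φ t x)) t := by
  choose α h0 hα using fun x (n : ℕ) => exists_integralCurve_Ioo hK hC x n
  have key : ∀ x (m n : ℕ) (t : ℝ), |t| < m → |t| < n → α x m t = α x n t := by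
    intro x m n t hm hn
    wlog hmn : m ≤ n generalizing m n
    · exact (this n m hn hm (le_of_not_ge hmn)).symm
    have hmn' : (m : ℝ) ≤ n := mod_cast hmn
    refine ODE_solution_unique_of_mem_Ioo (v := fun _ => V) (s := fun _ => univ) (K := K)
      (a := -m) (b := m) (t₀ := 0) (fun _ _ => hK.lipschitzOnWith) ?_
      (fun t ht => ⟨hα x m t ht, trivial⟩) (fun t ht => ⟨hα x n t ⟨?_, ?_⟩, trivial⟩) ?_ (abs_lt.1 hm)
    · have := (abs_nonneg t).trans_lt hm
      exact ⟨by linarith, this⟩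
    · linarith [ht.1]
    · linarith [ht.2]
    · rw [h0, h0]
  -- The index exceeds `|t|` strictly, so `t` lies in the open interval where the chosen curve
  -- solves the equation. Near a given time, `key` replaces the varying index by a fixed `N`.
  refine ⟨fun t x => α x (⌊|t|⌋₊ + 1) t, fun x => h0 _ _, fun t x => ?_⟩
  obtain ⟨N, hN⟩ := exists_nat_gt |t|
  have ht : α x (⌊|t|⌋₊ + 1) t = α x N t :=
    key _ _ _ _ (by push_cast; exact Nat.lt_floor_add_one _) hN
  change HasDerivAt (fun s => α x (⌊|s|⌋₊ + 1) s) (V (α x (⌊|t|⌋₊ + 1) t)) t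
  rw [ht]
  refine (hα x N t (abs_lt.1 hN)).congr_of_eventuallyEq ?_
  filter_upwards [continuous_abs.continuousAt.eventually_lt continuousAt_const hN] with s hs
  exact key _ _ _ _ (by push_cast; exact Nat.lt_floor_add_one _) hs

variable {V : E → E} {K : NNReal} {Φ : ℝ → E → E}

lemma flow_unique (hK : LipschitzWith K V)
    {α β : ℝ → E} (hα : ∀ t, HasDerivAt α (V (α t)) t) (hβ : ∀ t, HasDerivAt β (V (β t)) t)
    (h : α 0 = β 0) : α = β :=
  ODE_solution_unique_univ (v := fun _ => V) (s := fun _ => univ) (t₀ := 0)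
    (fun _ => hK.lipschitzOnWith) (fun t => ⟨hα t, trivial⟩) (fun t => ⟨hβ t, trivial⟩) h

lemma flow_add (hK : LipschitzWith K V) (h0 : ∀ x, Φ 0 x = x)
    (h : ∀ t x, HasDerivAt (fun s => Φ s x) (V (Φ t x)) t) (s t : ℝ) (x : E) :
    Φ (s + t) x = Φ s (Φ t x) := by
  refine congrFun (flow_unique hK (α := fun s => Φ (s + t) x) (β := fun s => Φ s (Φ t x))
    (fun s => ?_) (fun s => h s _) (by simp [h0])) s
  exact (h (s + t) x).comp_add_const s t

/-- The local smoothness of a flow, from the implicit function theorem in `C([0, 1], E)`. -/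
lemma contDiffAt_flow_of_small (hV : ContDiff ℝ ∞ V) (hK : LipschitzWith K V)
    (h0 : ∀ x, Φ 0 x = x) (h : ∀ t x, HasDerivAt (fun s => Φ s x) (V (Φ t x)) t)
    {τ : ℝ} (hτ : |τ| * K < 1) (x : E) :
    ContDiffAt ℝ ∞ (fun z : ℝ × E => Φ z.1 z.2) (τ, x) := by
  let N : C(Icc (0 : ℝ) 1, E) → C(Icc (0 : ℝ) 1, E) := superposition (Icc (0 : ℝ) 1) V hV.continuous
  -- The zeros of `f ((t, x), ·)` are the curves with `η s = x + t ∫₀ˢ V(η)`. Rescaling time to [0,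
  -- 1] puts the trajectories of all durations in one Banach space and makes the duration `t` a
  -- smooth parameter.
  let f : (ℝ × E) × C(Icc (0 : ℝ) 1, E) → C(Icc (0 : ℝ) 1, E) := fun z =>
    z.2 - ContinuousLinearMap.const ℝ (Icc (0 : ℝ) 1) z.1.2 - z.1.1 • volterra E (N z.2)
  let γ : ℝ × E → C(Icc (0 : ℝ) 1, E) := fun z => ⟨fun s => Φ (s * z.1) z.2,
    (continuous_iff_continuousAt.2 fun t => (h t z.2).continuousAt).comp (by fun_prop)⟩
  have hN : ContDiff ℝ ∞ N := contDiff_superposition hV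
  have hf : ContDiff ℝ ∞ f := by
    have h1 : ContDiff ℝ ∞ fun z : (ℝ × E) × C(Icc (0 : ℝ) 1, E) =>
        ContinuousLinearMap.const ℝ (Icc (0 : ℝ) 1) z.1.2 :=
      ContDiff.comp (g := fun y : E => ContinuousLinearMap.const ℝ (Icc (0 : ℝ) 1) y)
        (ContinuousLinearMap.contDiff _) contDiff_fst.snd
    have h2 : ContDiff ℝ ∞ fun z : (ℝ × E) × C(Icc (0 : ℝ) 1, E) => volterra E (N z.2) :=
      (volterra E).contDiff.comp (hN.comp contDiff_snd)
    exact (contDiff_snd.sub h1).sub (contDiff_fst.fst.smul h2)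
  have hγ : ∀ z, f (z, γ z) = 0 := by
    intro z
    ext s
    have h1 : ∫ u in (0 : ℝ)..s, z.1 • V (Φ (u * z.1) z.2) = Φ (s * z.1) z.2 - z.2 := by
      have hd : ∀ u ∈ uIcc (0 : ℝ) s, HasDerivAt (fun u => Φ (u * z.1) z.2)
          (z.1 • V (Φ (u * z.1) z.2)) u := fun u _ => by
        have := (h (u * z.1) z.2).scomp u ((hasDerivAt_id u).mul_const z.1)
        simpa [Function.comp_def] using this
      rw [intervalIntegral.integral_eq_sub_of_hasDerivAt hd]
      · simp [h0]
      · refine Continuous.intervalIntegrable ?_ _ _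
        have : Continuous fun u => Φ u z.2 :=
          continuous_iff_continuousAt.2 fun t => (h t z.2).continuousAt
        exact continuous_const.smul (hV.continuous.comp (this.comp (by fun_prop)))
    have h2 : volterra E (N (γ z)) s = ∫ u in (0 : ℝ)..s, V (Φ (u * z.1) z.2) := by
      rw [volterra_apply]
      refine intervalIntegral.integral_congr fun u hu => ?_
      rw [uIcc_of_le s.2.1] at hu
      rw [IccExtend_of_mem _ _ (⟨hu.1, hu.2.trans s.2.2⟩ : u ∈ Icc (0 : ℝ) 1)]
      rfl
    simp only [f, ContinuousMap.sub_apply, ContinuousMap.smul_apply, h2, ContinuousMap.zero_apply]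
    rw [← intervalIntegral.integral_smul, h1]
    simp [γ]
  -- For short durations the integral equation is a contraction, so its solution is unique among all
  -- curves. This identifies the implicit function with the flow.
  have huniq : ∀ z : ℝ × E, |z.1| * K < 1 → ∀ η, f (z, η) = 0 → η = γ z := by
    intro z hz η hη
    have e : η - γ z = z.1 • volterra E (N η - N (γ z)) := by
      have h1 := hγ z
      simp only [f] at h1 hη
      rw [map_sub, smul_sub]
      rw [sub_eq_zero] at h1 hη
      rw [← hη, ← h1]
      abel
    have hNl : ‖N η - N (γ z)‖ ≤ K * ‖η - γ z‖ := by
      rw [ContinuousMap.norm_le _ (by positivity)]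
      intro s
      calc ‖V (η s) - V (γ z s)‖ ≤ K * ‖η s - γ z s‖ := by
            simpa [dist_eq_norm] using hK.dist_le_mul (η s) (γ z s)
        _ ≤ K * ‖η - γ z‖ := by
            gcongr; exact (η - γ z).norm_coe_le_norm s
    have hle : ‖η - γ z‖ ≤ |z.1| * K * ‖η - γ z‖ := by
      calc ‖η - γ z‖ = |z.1| * ‖volterra E (N η - N (γ z))‖ := by
            conv_lhs => rw [e]
            rw [norm_smul, Real.norm_eq_abs]
        _ ≤ |z.1| * (1 * (K * ‖η - γ z‖)) := by
            gcongr
            exact (volterra E).le_of_opNorm_le_of_le norm_volterra_le hNl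
        _ = _ := by ring
    have : ‖η - γ z‖ = 0 := by
      by_contra hne
      have hpos : 0 < ‖η - γ z‖ := lt_of_le_of_ne (norm_nonneg _) (Ne.symm hne)
      nlinarith
    exact sub_eq_zero.1 (norm_eq_zero.1 this)
  let A := pointwiseApply (Icc (0 : ℝ) 1) E E
    (superposition (Icc (0 : ℝ) 1) (fderiv ℝ V) (hV.continuous_fderiv (by simp)) (γ (τ, x)))
  have hA : ‖A‖ ≤ K := norm_pointwiseApply_le _ K.2 fun s => norm_fderiv_le_of_lipschitz ℝ hK
  have hpart : (fderiv ℝ f ((τ, x), γ (τ, x))).comp (.inr ℝ (ℝ × E) C(Icc (0 : ℝ) 1, E)) =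
      ContinuousLinearMap.id ℝ _ - τ • (volterra E).comp A := by
    have h1 : HasFDerivAt (fun η => f ((τ, x), η))
        ((fderiv ℝ f ((τ, x), γ (τ, x))).comp (.inr ℝ (ℝ × E) C(Icc (0 : ℝ) 1, E))) (γ (τ, x)) :=
      (hf.differentiable (by simp) _).hasFDerivAt.comp _ (hasFDerivAt_prodMk_right _ _)
    refine h1.unique ?_
    have h2 := HasFDerivAt.comp (γ (τ, x)) (volterra E).hasFDerivAt
      (hasFDerivAt_superposition (hV.of_le (by simp)) (γ (τ, x)))
    exact ((hasFDerivAt_id (γ (τ, x))).sub_const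
      (ContinuousLinearMap.const ℝ (Icc (0 : ℝ) 1) x)).sub (h2.const_smul τ)
  have hinv : ((fderiv ℝ f ((τ, x), γ (τ, x))).comp
      (.inr ℝ (ℝ × E) C(Icc (0 : ℝ) 1, E))).IsInvertible := by
    rw [hpart]
    -- The partial derivative is the identity minus an operator of norm less than one, hence
    -- invertible by the Neumann series.
    have hlt : ‖τ • (volterra E).comp A‖ < 1 := by
      refine lt_of_le_of_lt ((ContinuousLinearMap.opNorm_smul_le _ _).trans ?_) hτ
      rw [Real.norm_eq_abs]
      gcongr
      calc _ ≤ ‖volterra E‖ * ‖A‖ := ContinuousLinearMap.opNorm_comp_le _ _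
        _ ≤ 1 * K := by gcongr; exact norm_volterra_le
        _ = K := one_mul _
    exact ⟨ContinuousLinearEquiv.unitsEquiv ℝ _ (Units.oneSub (τ • (volterra E).comp A) hlt), rfl⟩
  have himp := hf.contDiffAt.contDiffAt_implicitFunction (u := ((τ, x), γ (τ, x))) (by simp) hinv
  have heq : ∀ᶠ z in 𝓝 (τ, x),
      hf.contDiffAt.implicitFunction (u := ((τ, x), γ (τ, x))) (by simp) hinv z = γ z := by
    have hs : ∀ᶠ z : ℝ × E in 𝓝 (τ, x), |z.1| * K < 1 :=
      ContinuousAt.eventually_lt (by fun_prop) continuousAt_const hτ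
    filter_upwards [hs, hf.contDiffAt.eventually_apply_implicitFunction
      (u := ((τ, x), γ (τ, x))) (by simp) hinv] with z hz h1
    exact huniq z hz _ (h1.trans (hγ _))
  have : (fun z : ℝ × E => Φ z.1 z.2) = fun z => ContinuousMap.evalCLM ℝ (1 : Icc (0 : ℝ) 1) (γ z) := by
    ext z; simp [γ]
  rw [this]
  exact (ContinuousMap.evalCLM ℝ (1 : Icc (0 : ℝ) 1)).contDiff.contDiffAt.comp _
    (himp.congr_of_eventuallyEq (heq.mono fun _ hz => hz.symm))

/-- The time-`t` map is the square of the time-`t / 2` map, so smoothness for short times propagates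
by doubling. -/
lemma contDiff_flow (hV : ContDiff ℝ ∞ V) (hK : LipschitzWith K V)
    (h0 : ∀ x, Φ 0 x = x) (h : ∀ t x, HasDerivAt (fun s => Φ s x) (V (Φ t x)) t) :
    ContDiff ℝ ∞ fun z : ℝ × E => Φ z.1 z.2 := by
  have key : ∀ n : ℕ, ∀ (τ : ℝ) (x : E), |τ| * K < 2 ^ n →
      ContDiffAt ℝ ∞ (fun z : ℝ × E => Φ z.1 z.2) (τ, x) := by
    intro n
    induction n with
    | zero => exact fun τ x hτ => contDiffAt_flow_of_small hV hK h0 h (by simpa using hτ) x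
    | succ n ih =>
      intro τ x hτ
      have hτ' : |τ / 2| * K < 2 ^ n := by
        rw [abs_div, abs_two]; rw [pow_succ] at hτ; linarith
      have e : (fun z : ℝ × E => Φ z.1 z.2) =
          (fun z : ℝ × E => Φ z.1 z.2) ∘ fun z => (z.1 / 2, Φ (z.1 / 2) z.2) := by
        ext z
        simp only [Function.comp]
        rw [← flow_add hK h0 h, add_halves]
      rw [e]
      refine ContDiffAt.comp (τ, x) (ih _ _ hτ') (ContDiffAt.prodMk (by fun_prop) ?_)
      exact ContDiffAt.comp (g := fun z : ℝ × E => Φ z.1 z.2) (f := fun z : ℝ × E => (z.1 / 2, z.2))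
        (τ, x) (ih _ _ hτ') (by fun_prop)
  refine contDiff_iff_contDiffAt.2 fun z => ?_
  obtain ⟨n, hn⟩ := pow_unbounded_of_one_lt (|z.1| * K) one_lt_two
  exact key n z.1 z.2 hn

end Flow

/-! ### Smooth functions near a point -/

section SmoothNear

variable {E F G H : Type} [NormedAddCommGroup E] [NormedSpace ℝ E]
  [NormedAddCommGroup F] [NormedSpace ℝ F] [NormedAddCommGroup G] [NormedSpace ℝ G]
  [NormedAddCommGroup H] [NormedSpace ℝ H]

/-- `f` is smooth on a neighbourhood of `x`. -/
def SmoothNear (f : E → F) (x : E) : Prop := ∀ᶠ y in 𝓝 x, ContDiffAt ℝ ∞ f y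

lemma SmoothNear.contDiffAt {f : E → F} {x : E} (h : SmoothNear f x) : ContDiffAt ℝ ∞ f x :=
  h.self_of_nhds

lemma SmoothNear.eventually {f : E → F} {x : E} (h : SmoothNear f x) :
    ∀ᶠ y in 𝓝 x, SmoothNear f y := eventually_eventually_nhds.2 h

lemma SmoothNear.differentiableAt {f : E → F} {x : E} (h : SmoothNear f x) :
    DifferentiableAt ℝ f x := h.contDiffAt.differentiableAt (by simp)

lemma ContDiff.smoothNear {f : E → F} (h : ContDiff ℝ ∞ f) (x : E) : SmoothNear f x :=
  Filter.Eventually.of_forall fun _ => h.contDiffAt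

lemma SmoothNear.comp {g : F → G} {f : E → F} {x : E} (hg : SmoothNear g (f x))
    (hf : SmoothNear f x) : SmoothNear (fun y => g (f y)) x := by
  filter_upwards [hf, hf.differentiableAt.continuousAt.eventually hg] with y h1 h2
  exact ContDiffAt.comp y h2 h1

lemma SmoothNear.prodMk {f : E → F} {g : E → G} {x : E} (hf : SmoothNear f x)
    (hg : SmoothNear g x) : SmoothNear (fun y => (f y, g y)) x := by
  filter_upwards [hf, hg] with y h1 h2 using h1.prodMk h2

lemma SmoothNear.fderiv {f : E → F} {x : E} (hf : SmoothNear f x) :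
    SmoothNear (fderiv ℝ f) x := by
  filter_upwards [hf] with y h using h.fderiv_right (m := ∞) (by simp)

lemma SmoothNear.congr {f g : E → F} {x : E} (hf : SmoothNear f x) (h : f =ᶠ[𝓝 x] g) :
    SmoothNear g x := by
  filter_upwards [hf, h.eventuallyEq_nhds] with y h1 h2 using h1.congr_of_eventuallyEq h2.symm

lemma SmoothNear.clm (L : F →L[ℝ] G) {f : E → F} {x : E} (hf : SmoothNear f x) :
    SmoothNear (fun y => L (f y)) x := (L.contDiff.smoothNear _).comp hf

lemma SmoothNear.add {f g : E → F} {x : E} (hf : SmoothNear f x)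
    (hg : SmoothNear g x) : SmoothNear (fun y => f y + g y) x := by
  filter_upwards [hf, hg] with y h1 h2 using h1.add h2

lemma SmoothNear.bilin (B : F →L[ℝ] G →L[ℝ] H) {f : E → F} {g : E → G} {x : E}
    (hf : SmoothNear f x) (hg : SmoothNear g x) : SmoothNear (fun y => B (f y) (g y)) x :=
  (B.isBoundedBilinearMap.contDiff.smoothNear _).comp (hf.prodMk hg)

end SmoothNear

/-! ### Families of smooth functions whose derivatives are jointly continuous -/

section Families

variable {P Q : Type} [TopologicalSpace P] [TopologicalSpace Q]
variable {E F G H : Type} [NormedAddCommGroup E] [NormedSpace ℝ E]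
  [NormedAddCommGroup F] [NormedSpace ℝ F] [NormedAddCommGroup G] [NormedSpace ℝ G]
  [NormedAddCommGroup H] [NormedSpace ℝ H]

/-- `f p`, `p ∈ P`, are functions, smooth near `K`, whose derivatives of order at most `k` are
jointly continuous on `P × K`. -/
def FamilyOn (K : Set E) : ℕ → ∀ {F : Type} [NormedAddCommGroup F] [NormedSpace ℝ F],
    (P → E → F) → Prop
  | 0, _, _, _, f => (∀ p, ∀ x ∈ K, SmoothNear (f p) x) ∧
      ContinuousOn (fun z : P × E => f z.1 z.2) (univ ×ˢ K)
  | k + 1, _, _, _, f => ((∀ p, ∀ x ∈ K, SmoothNear (f p) x) ∧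
      ContinuousOn (fun z : P × E => f z.1 z.2) (univ ×ˢ K)) ∧
      FamilyOn K k fun p => fderiv ℝ (f p)

variable {K : Set E} {k : ℕ}

namespace FamilyOn

lemma zero_of {f : P → E → F} (h : FamilyOn K k f) : FamilyOn K 0 f := by
  cases k with
  | zero => exact h
  | succ k => exact h.1

lemma smooth {f : P → E → F} (h : FamilyOn K k f) : ∀ p, ∀ x ∈ K, SmoothNear (f p) x :=
  h.zero_of.1

lemma continuousOn {f : P → E → F} (h : FamilyOn K k f) :
    ContinuousOn (fun z : P × E => f z.1 z.2) (univ ×ˢ K) := h.zero_of.2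

lemma succ {f : P → E → F} (h : FamilyOn K 0 f) (h' : FamilyOn K k fun p => fderiv ℝ (f p)) :
    FamilyOn K (k + 1) f := ⟨h, h'⟩

lemma fderiv {f : P → E → F} (h : FamilyOn K (k + 1) f) :
    FamilyOn K k fun p => fderiv ℝ (f p) := h.2

lemma of_succ {f : P → E → F} (h : FamilyOn K (k + 1) f) : FamilyOn K k f := by
  induction k generalizing F with
  | zero => exact h.1
  | succ k ih => exact ⟨h.1, ih h.2⟩

/-- Agreement is required near the points of `K` and not just on `K`, since the members are
differentiated as functions on the whole space. -/
lemma congr {f g : P → E → F} (hf : FamilyOn K k f) (h : ∀ p, ∀ x ∈ K, f p =ᶠ[𝓝 x] g p) :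
    FamilyOn K k g := by
  have h0 : ∀ {F : Type} [NormedAddCommGroup F] [NormedSpace ℝ F] {f g : P → E → F},
      FamilyOn K 0 f → (∀ p, ∀ x ∈ K, f p =ᶠ[𝓝 x] g p) → FamilyOn K 0 g := by
    intro F _ _ f g hf h
    exact ⟨fun p x hx => (hf.1 p x hx).congr (h p x hx),
      hf.2.congr fun z hz => (h z.1 z.2 hz.2).self_of_nhds.symm⟩
  induction k generalizing F with
  | zero => exact h0 hf h
  | succ k ih => exact ⟨h0 hf.1 h, ih hf.2 fun p x hx => (h p x hx).fderiv⟩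

lemma reparam {f : P → E → F} (hf : FamilyOn K k f) {π : Q → P} (hπ : Continuous π) :
    FamilyOn K k fun q => f (π q) := by
  have hc : Continuous fun z : Q × E => (π z.1, z.2) := by fun_prop
  have hm : MapsTo (fun z : Q × E => (π z.1, z.2)) (univ ×ˢ K) (univ ×ˢ K) :=
    fun z hz => ⟨trivial, hz.2⟩
  induction k generalizing F with
  | zero => exact ⟨fun q => hf.1 (π q), hf.2.comp hc.continuousOn hm⟩
  | succ k ih => exact ⟨⟨fun q => hf.1.1 (π q), hf.1.2.comp hc.continuousOn hm⟩, ih hf.2⟩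

lemma clm (L : F →L[ℝ] G) {f : P → E → F} (hf : FamilyOn K k f) :
    FamilyOn K k fun p x => L (f p x) := by
  have h0 : ∀ {F G : Type} [NormedAddCommGroup F] [NormedSpace ℝ F] [NormedAddCommGroup G]
      [NormedSpace ℝ G] (L : F →L[ℝ] G) {f : P → E → F},
      FamilyOn K 0 f → FamilyOn K 0 fun p x => L (f p x) := fun L f hf =>
    ⟨fun p x hx => (hf.1 p x hx).clm L, L.continuous.comp_continuousOn hf.2⟩
  induction k generalizing F G with
  | zero => exact h0 L hf
  | succ k ih =>
    refine ⟨h0 L hf.1, (ih (ContinuousLinearMap.compL ℝ E F G L) hf.2).congr fun p x hx => ?_⟩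
    filter_upwards [(hf.1.1 p x hx).eventually] with y hy
    exact (L.hasFDerivAt.comp y hy.differentiableAt.hasFDerivAt).fderiv.symm

lemma add {f g : P → E → F} (hf : FamilyOn K k f) (hg : FamilyOn K k g) :
    FamilyOn K k fun p x => f p x + g p x := by
  have h0 : ∀ {F : Type} [NormedAddCommGroup F] [NormedSpace ℝ F] {f g : P → E → F},
      FamilyOn K 0 f → FamilyOn K 0 g → FamilyOn K 0 fun p x => f p x + g p x := fun hf hg =>
    ⟨fun p x hx => (hf.1 p x hx).add (hg.1 p x hx), hf.2.add hg.2⟩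
  induction k generalizing F with
  | zero => exact h0 hf hg
  | succ k ih =>
    refine ⟨h0 hf.1 hg.1, (ih hf.2 hg.2).congr fun p x hx => ?_⟩
    filter_upwards [(hf.1.1 p x hx).eventually, (hg.1.1 p x hx).eventually] with y hy hy'
    exact (hy.differentiableAt.hasFDerivAt.add hy'.differentiableAt.hasFDerivAt).fderiv.symm

/-- By the product rule the derivative is a sum of two terms of the same kind, with the bilinear
maps `B.precompR E` and `B.precompL E`; the induction therefore runs over all spaces. -/
lemma bilin (B : F →L[ℝ] G →L[ℝ] H) {f : P → E → F} {g : P → E → G} (hf : FamilyOn K k f)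
    (hg : FamilyOn K k g) : FamilyOn K k fun p x => B (f p x) (g p x) := by
  have h0 : ∀ {F G H : Type} [NormedAddCommGroup F] [NormedSpace ℝ F] [NormedAddCommGroup G]
      [NormedSpace ℝ G] [NormedAddCommGroup H] [NormedSpace ℝ H] (B : F →L[ℝ] G →L[ℝ] H)
      {f : P → E → F} {g : P → E → G}, FamilyOn K 0 f → FamilyOn K 0 g →
      FamilyOn K 0 fun p x => B (f p x) (g p x) := fun B f g hf hg =>
    ⟨fun p x hx => (hf.1 p x hx).bilin B (hg.1 p x hx),
      B.isBoundedBilinearMap.continuous.comp_continuousOn (hf.2.prodMk hg.2)⟩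
  induction k generalizing F G H with
  | zero => exact h0 B hf hg
  | succ k ih =>
    refine ⟨h0 B hf.1 hg.1, ((ih (B.precompR E) hf.of_succ hg.2).add
      (ih (B.precompL E) hf.2 hg.of_succ)).congr fun p x hx => ?_⟩
    filter_upwards [(hf.1.1 p x hx).eventually, (hg.1.1 p x hx).eventually] with y hy hy'
    exact (B.fderiv_of_bilinear hy.differentiableAt hy'.differentiableAt).symm

/-- Chain rule and `bilin`. Both maps may vary with the parameter, and the inner one need map only
`K`, not a neighbourhood, into `L`. -/
lemma comp {g : P → F → G} {f : P → E → F} {L : Set F} (hg : FamilyOn L k g)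
    (hf : FamilyOn K k f) (hm : ∀ p, ∀ x ∈ K, f p x ∈ L) :
    FamilyOn K k fun p x => g p (f p x) := by
  have h0 : ∀ {G : Type} [NormedAddCommGroup G] [NormedSpace ℝ G] {g : P → F → G},
      FamilyOn L 0 g → FamilyOn K 0 fun p x => g p (f p x) := fun hg =>
    ⟨fun p x hx => (hg.1 p _ (hm p x hx)).comp (hf.smooth p x hx),
      hg.2.comp (continuous_fst.continuousOn.prodMk hf.continuousOn)
        fun z hz => ⟨trivial, hm _ _ hz.2⟩⟩
  induction k generalizing G with
  | zero => exact h0 hg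
  | succ k ih =>
    refine ⟨h0 hg.1, ((ih hg.2 hf.of_succ).bilin (ContinuousLinearMap.compL ℝ E F G) hf.2).congr
      fun p x hx => ?_⟩
    have hs := hf.1.1 p x hx
    filter_upwards [hs.eventually, hs.differentiableAt.continuousAt.eventually
      (hg.1.1 p _ (hm p x hx)).eventually] with y hy hy'
    exact (hy'.differentiableAt.hasFDerivAt.comp y hy.differentiableAt.hasFDerivAt).fderiv.symm

lemma of_joint {V : Type} [NormedAddCommGroup V] [NormedSpace ℝ V] {f : V × E → F}
    (hf : ContDiff ℝ ∞ f) (K : Set E) (k : ℕ) : FamilyOn K k fun (v : V) x => f (v, x) := by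
  have h0 : ∀ {F : Type} [NormedAddCommGroup F] [NormedSpace ℝ F] {f : V × E → F},
      ContDiff ℝ ∞ f → FamilyOn K 0 fun (v : V) x => f (v, x) := fun hf =>
    ⟨fun v x _ => ContDiff.smoothNear (hf.comp (by fun_prop)) x, hf.continuous.continuousOn⟩
  induction k generalizing F with
  | zero => exact h0 hf
  | succ k ih =>
    refine ⟨h0 hf, ?_⟩
    have e : (fun v : V => _root_.fderiv ℝ fun x => f (v, x)) =
        fun v x => (_root_.fderiv ℝ f (v, x)).comp (ContinuousLinearMap.inr ℝ V E) := by
      ext1 v; ext1 x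
      exact ((hf.differentiable (by simp) (v, x)).hasFDerivAt.comp x
        (hasFDerivAt_prodMk_right v x)).fderiv
    rw [e]
    exact ih (f := fun z => (_root_.fderiv ℝ f z).comp (ContinuousLinearMap.inr ℝ V E))
      ((hf.fderiv_right (m := ∞) (by simp)).clm_comp contDiff_const)

lemma of_smoothNear {f : E → F} (hf : ∀ x ∈ K, SmoothNear f x) (k : ℕ) :
    FamilyOn K k fun _ : P => f := by
  have h0 : ∀ {F : Type} [NormedAddCommGroup F] [NormedSpace ℝ F] {f : E → F},
      (∀ x ∈ K, SmoothNear f x) → FamilyOn K 0 fun _ : P => f := fun hf =>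
    ⟨fun _ => hf, fun z hz => ((hf z.2 hz.2).differentiableAt.continuousAt.comp
      continuous_snd.continuousAt).continuousWithinAt⟩
  induction k generalizing F with
  | zero => exact h0 hf
  | succ k ih => exact ⟨h0 hf, ih fun x hx => (hf x hx).fderiv⟩

lemma of_continuous {c : P → F} (hc : Continuous c) (k : ℕ) :
    FamilyOn K k fun p (_ : E) => c p := by
  have h0 : ∀ {F : Type} [NormedAddCommGroup F] [NormedSpace ℝ F] {c : P → F},
      Continuous c → FamilyOn K 0 fun p (_ : E) => c p := fun hc =>
    ⟨fun _ _ _ => contDiff_const.smoothNear _, (hc.comp continuous_fst).continuousOn⟩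
  cases k with
  | zero => exact h0 hc
  | succ k =>
    refine ⟨h0 hc, ?_⟩
    simp only [fderiv_fun_const]
    exact of_smoothNear (fun x _ => contDiff_const.smoothNear x) k

lemma comp_smooth {g : F → G} {f : P → E → F} {L : Set F} (hg : ∀ y ∈ L, SmoothNear g y)
    (hf : FamilyOn K k f) (hm : ∀ p, ∀ x ∈ K, f p x ∈ L) :
    FamilyOn K k fun p x => g (f p x) :=
  (of_smoothNear hg k).comp hf hm

lemma continuousOn_iteratedFDeriv_zero_iff {f : P → E → F} :
    ContinuousOn (fun z : P × E => iteratedFDeriv ℝ 0 (f z.1) z.2) (univ ×ˢ K) ↔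
      ContinuousOn (fun z : P × E => f z.1 z.2) (univ ×ˢ K) := by
  simp only [iteratedFDeriv_zero_eq_comp, Function.comp_apply]
  exact (continuousMultilinearCurryFin0 ℝ E F).symm.toHomeomorph.comp_continuousOn_iff _ _

lemma continuousOn_iteratedFDeriv_succ_iff {f : P → E → F} (j : ℕ) :
    ContinuousOn (fun z : P × E => iteratedFDeriv ℝ (j + 1) (f z.1) z.2) (univ ×ˢ K) ↔
      ContinuousOn (fun z : P × E => iteratedFDeriv ℝ j (_root_.fderiv ℝ (f z.1)) z.2)
        (univ ×ˢ K) := by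
  simp only [iteratedFDeriv_succ_eq_comp_right, Function.comp_apply]
  exact (continuousMultilinearCurryRightEquiv' ℝ j E F).symm.toHomeomorph.comp_continuousOn_iff _ _

/-- The recursive form suits inductions on the order; this one matches the derivatives in
`allDerivs`. Currying isometries translate between them. -/
lemma iff_iteratedFDeriv {f : P → E → F} :
    FamilyOn K k f ↔ (∀ p, ∀ x ∈ K, SmoothNear (f p) x) ∧ ∀ j ≤ k,
      ContinuousOn (fun z : P × E => iteratedFDeriv ℝ j (f z.1) z.2) (univ ×ˢ K) := by
  induction k generalizing F with
  | zero =>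
    simp only [Nat.le_zero, forall_eq, continuousOn_iteratedFDeriv_zero_iff]
    rfl
  | succ k ih =>
    constructor
    · rintro ⟨h0, h1⟩
      refine ⟨h0.1, fun j hj => ?_⟩
      cases j with
      | zero => exact continuousOn_iteratedFDeriv_zero_iff.2 h0.2
      | succ j =>
        exact (continuousOn_iteratedFDeriv_succ_iff j).2 ((ih.1 h1).2 j (by omega))
    · rintro ⟨h0, h1⟩
      exact ⟨⟨h0, continuousOn_iteratedFDeriv_zero_iff.1 (h1 0 (by omega))⟩,
        ih.2 ⟨fun p x hx => (h0 p x hx).fderiv, fun j hj =>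
          (continuousOn_iteratedFDeriv_succ_iff j).1 (h1 _ (by omega))⟩⟩

end FamilyOn

end Families

/-! ### Uniformity over compact factors -/

section Tube

variable {P I : Type} [TopologicalSpace P] [TopologicalSpace I] [CompactSpace I]
variable {E F : Type} [NormedAddCommGroup E] [NormedSpace ℝ E]
  [NormedAddCommGroup F] [NormedSpace ℝ F] {K : Set E}

/-- Currying yields a continuous map into C(I, W), whose distance is uniform because `I` is compact.
-/
lemma eventually_forall_dist_lt {Q W : Type} [TopologicalSpace Q] [PseudoMetricSpace W]
    {g : Q × I → W} (hg : Continuous g) (q₀ : Q) {ε : ℝ} (hε : 0 < ε) :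
    ∀ᶠ q in 𝓝 q₀, ∀ s, dist (g (q, s)) (g (q₀, s)) < ε := by
  have h := (ContinuousMap.curry ⟨g, hg⟩).continuous.continuousAt (x := q₀)
  filter_upwards [Metric.tendsto_nhds.1 h ε hε] with q hq s
  exact (ContinuousMap.dist_lt_iff hε).1 hq s

lemma eventually_forall_dist_lt_of_continuousOn {f : P × I → E → F}
    (hf : ContinuousOn (fun z : (P × I) × E => f z.1 z.2) (univ ×ˢ K)) {p₀ : P} {x₀ : E}
    (hx₀ : x₀ ∈ K) {ε : ℝ} (hε : 0 < ε) :
    ∀ᶠ z : P × E in 𝓝[univ ×ˢ K] (p₀, x₀), ∀ s, dist (f (z.1, s) z.2) (f (p₀, s) x₀) < ε := by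
  have hg : Continuous fun w : ((univ ×ˢ K : Set (P × E)) × I) =>
      f (w.1.1.1, w.2) w.1.1.2 :=
    hf.comp_continuous (f := fun w : ((univ ×ˢ K : Set (P × E)) × I) =>
      (((w.1.1.1, w.2), w.1.1.2) : (P × I) × E)) (by fun_prop) fun w => ⟨trivial, w.1.2.2⟩
  have h := eventually_forall_dist_lt hg ⟨(p₀, x₀), trivial, hx₀⟩ hε
  have hmem : (p₀, x₀) ∈ (univ ×ˢ K : Set (P × E)) := ⟨trivial, hx₀⟩
  rw [nhdsWithin_eq_map_subtype_coe hmem]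
  exact h

lemma eventually_forall_mem_dist_lt {f : P × I → E → F} (hK : IsCompact K)
    (hf : ContinuousOn (fun z : (P × I) × E => f z.1 z.2) (univ ×ˢ K)) (p₀ : P)
    {ε : ℝ} (hε : 0 < ε) :
    ∀ᶠ p in 𝓝 p₀, ∀ s, ∀ x ∈ K, dist (f (p, s) x) (f (p₀, s) x) < ε := by
  have := isCompact_iff_compactSpace.1 hK
  have hg : Continuous fun w : P × (I × K) => f (w.1, w.2.1) w.2.2 :=
    hf.comp_continuous (f := fun w : P × (I × K) => (((w.1, w.2.1), (w.2.2 : E)) : (P × I) × E))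
      (by fun_prop) fun w => ⟨trivial, w.2.2.2⟩
  filter_upwards [eventually_forall_dist_lt hg p₀ hε] with p hp s x hx using hp (s, ⟨x, hx⟩)

end Tube

/-! ### The smooth topology and families -/

section Topologies

variable {P : Type} [TopologicalSpace P]
variable {E F : Type} [NormedAddCommGroup E] [NormedSpace ℝ E]
  [NormedAddCommGroup F] [NormedSpace ℝ F] {K : Set E}

/-- Unique differentiability makes the derivatives within `K` depend only on the values on `K`; they
coincide with the full derivatives of any extension that is smooth near `K`. -/
lemma allDerivs_apply {φ : K → F} {f : E → F} (hK : UniqueDiffOn ℝ K)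
    (hf : ∀ x ∈ K, SmoothNear f x) (h : ∀ x : K, f x = φ x) (k : ℕ) (x : K) :
    UniformFun.toFun (allDerivs φ k) x = iteratedFDeriv ℝ k f x := by
  have hx : SmoothNear f x := hf x x.2
  have e : EqOn (extendByZero φ) f K := fun y hy => by
    rw [extendByZero, h ⟨y, hy⟩]
    exact Subtype.val_injective.extend_apply φ 0 ⟨y, hy⟩
  change iteratedFDerivWithin ℝ k (extendByZero φ) K x = _
  rw [iteratedFDerivWithin_congr e x.2]
  exact iteratedFDerivWithin_eq_iteratedFDeriv hK (hx.contDiffAt.of_le (by exact_mod_cast le_top)) x.2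

/-- Compactness of `K` upgrades joint continuity of the derivatives to uniform convergence. -/
lemma continuous_allDerivs_of_family (hc : IsCompact K) (hK : UniqueDiffOn ℝ K)
    {φ : P → K → F} {f : P → E → F} (h : ∀ p (x : K), f p x = φ p x)
    (hf : ∀ k, FamilyOn K k f) : Continuous fun p => allDerivs (φ p) := by
  have := isCompact_iff_compactSpace.1 hc
  refine continuous_pi fun k => continuous_iff_continuousAt.2 fun p₀ => ?_
  rw [ContinuousAt, UniformFun.tendsto_iff_tendstoUniformly, Metric.tendstoUniformly_iff]
  intro ε hε
  have hg : Continuous fun w : P × K => iteratedFDeriv ℝ k (f w.1) w.2 :=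
    ((FamilyOn.iff_iteratedFDeriv.1 (hf k)).2 k le_rfl).comp_continuous
      (f := fun w : P × K => (w.1, (w.2 : E))) (by fun_prop) fun w => ⟨trivial, w.2.2⟩
  filter_upwards [eventually_forall_dist_lt hg p₀ hε] with p hp x
  rw [Function.comp_apply, dist_comm, allDerivs_apply hK ((hf 0).smooth p) (h p),
    allDerivs_apply hK ((hf 0).smooth p₀) (h p₀)]
  exact hp x

/-- Uniform closeness in the parameter and continuity of one member in the point add up to joint
continuity. The extensions `f p` may be chosen independently for different `p`. -/
lemma family_of_continuous_allDerivs (hK : UniqueDiffOn ℝ K)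
    {φ : P → K → F} {f : P → E → F} (h : ∀ p (x : K), f p x = φ p x)
    (hs : ∀ p, ∀ x ∈ K, SmoothNear (f p) x) (hc : Continuous fun p => allDerivs (φ p)) (k : ℕ) :
    FamilyOn K k f := by
  refine FamilyOn.iff_iteratedFDeriv.2 ⟨hs, fun j _ => ?_⟩
  rintro ⟨p₀, x₀⟩ ⟨-, hx₀⟩
  have hj : ContinuousAt (fun p => allDerivs (φ p) j) p₀ :=
    ((continuous_apply j).comp hc).continuousAt
  rw [ContinuousAt, UniformFun.tendsto_iff_tendstoUniformly, Metric.tendstoUniformly_iff] at hj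
  rw [ContinuousWithinAt, Metric.tendsto_nhds]
  intro ε hε
  have h1 : ∀ᶠ z : P × E in 𝓝[univ ×ˢ K] (p₀, x₀), ∀ x : K,
      dist (iteratedFDeriv ℝ j (f p₀) x) (iteratedFDeriv ℝ j (f z.1) x) < ε / 2 := by
    have : Filter.Tendsto Prod.fst (𝓝[univ ×ˢ K] (p₀, x₀)) (𝓝 p₀) :=
      continuous_fst.continuousAt.tendsto.mono_left nhdsWithin_le_nhds
    filter_upwards [this.eventually (hj (ε / 2) (half_pos hε))] with z hz x
    have := hz x
    rwa [Function.comp_apply, allDerivs_apply hK (hs _) (h _), allDerivs_apply hK (hs _) (h _)]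
      at this
  have h2 : ∀ᶠ z : P × E in 𝓝[univ ×ˢ K] (p₀, x₀),
      dist (iteratedFDeriv ℝ j (f p₀) z.2) (iteratedFDeriv ℝ j (f p₀) x₀) < ε / 2 := by
    have hc : ContinuousAt (iteratedFDeriv ℝ j (f p₀)) x₀ := by
      have := (hs p₀ x₀ hx₀).contDiffAt.iteratedFDeriv_right (m := 0) (i := j)
        (by exact_mod_cast le_top)
      exact this.continuousAt
    have ht : Filter.Tendsto Prod.snd (𝓝[univ ×ˢ K] (p₀, x₀)) (𝓝 x₀) :=
      continuous_snd.continuousAt.tendsto.mono_left nhdsWithin_le_nhds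
    exact ht.eventually (Metric.tendsto_nhds.1 hc _ (half_pos hε))
  filter_upwards [h1, h2, self_mem_nhdsWithin] with z hz1 hz2 hz3
  have := hz1 ⟨z.2, hz3.2⟩
  rw [dist_comm] at this
  linarith [dist_triangle (iteratedFDeriv ℝ j (f z.1) z.2) (iteratedFDeriv ℝ j (f p₀) z.2)
    (iteratedFDeriv ℝ j (f p₀) x₀)]

end Topologies

/-! ### Integrals of families -/

section Integrals

variable {P : Type} [TopologicalSpace P]
variable {E F : Type} [NormedAddCommGroup E] [NormedSpace ℝ E]
  [NormedAddCommGroup F] [NormedSpace ℝ F] [CompleteSpace F] {K : Set E}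

/-- The variable of integration is an additional parameter in a compact space, which makes the
estimate uniform in it; derivatives pass under the integral sign. -/
lemma FamilyOn.integral {k : ℕ} {f : P → ℝ × E → F} (hf : ∀ p, ContDiff ℝ ∞ (f p))
    (h : FamilyOn K k fun (q : P × Icc (0 : ℝ) 1) x => f q.1 (q.2, x)) :
    FamilyOn K k fun p x => ∫ u in (0 : ℝ)..1, f p (u, x) := by
  have h0 : ∀ {F : Type} [NormedAddCommGroup F] [NormedSpace ℝ F]
      {f : P → ℝ × E → F}, (∀ p, ContDiff ℝ ∞ (f p)) →
      FamilyOn K 0 (fun (q : P × Icc (0 : ℝ) 1) x => f q.1 (q.2, x)) →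
      FamilyOn K 0 fun p x => ∫ u in (0 : ℝ)..1, f p (u, x) := by
    intro F _ _ f hf h
    refine ⟨fun p x _ => (contDiff_parametric_integral (hf p)).smoothNear x, ?_⟩
    rintro ⟨p₀, x₀⟩ ⟨-, hx₀⟩
    rw [ContinuousWithinAt, Metric.tendsto_nhds]
    intro ε hε
    filter_upwards [eventually_forall_dist_lt_of_continuousOn
      (f := fun (q : P × Icc (0 : ℝ) 1) x => f q.1 (q.2, x)) h.2 (p₀ := p₀) hx₀ (half_pos hε)]
      with z hz
    have hi : ∀ p x, IntervalIntegrable (fun u : ℝ => f p (u, x)) volume 0 1 := fun p x =>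
      ((hf p).continuous.comp (by fun_prop : Continuous fun u : ℝ => (u, x))).intervalIntegrable _ _
    rw [dist_eq_norm, ← intervalIntegral.integral_sub (hi _ _) (hi _ _)]
    refine (intervalIntegral.norm_integral_le_of_norm_le_const (C := ε / 2) fun u hu => ?_).trans_lt
      (by norm_num; linarith)
    rw [uIoc_of_le zero_le_one] at hu
    rw [← dist_eq_norm]
    exact (hz ⟨u, hu.1.le, hu.2⟩).le
  induction k generalizing F with
  | zero => exact h0 hf h
  | succ k ih =>
    refine ⟨h0 hf h.1, ?_⟩
    simp_rw [fun p => funext (fderiv_parametric_integral (hf p))]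
    exact ih (f := fun p z => _root_.fderiv ℝ (fun y => f p (z.1, y)) z.2)
      (fun p => contDiff_fderiv_slice (hf p)) h.2

end Integrals

/-! ### Solutions of differential equations with parameters -/

section ParametricODE

variable {P : Type} [TopologicalSpace P]
variable {E V : Type} [NormedAddCommGroup E] [NormedSpace ℝ E]
  [NormedAddCommGroup V] [NormedSpace ℝ V] {K : Set E}

/-- Symmetry of the second derivative of `y` exchanges differentiation in time and in space.
Variational equations are obtained this way. -/
lemma hasDerivAt_fderiv_slice {y : ℝ × E → V} (hy : ContDiff ℝ ∞ y) {w : E → V} {t : ℝ} {x₀ : E}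
    (h : ∀ᶠ x in 𝓝 x₀, HasDerivAt (fun s => y (s, x)) (w x) t) :
    HasDerivAt (fun s => fderiv ℝ (fun x => y (s, x)) x₀) (fderiv ℝ w x₀) t := by
  have hy' : ContDiff ℝ ∞ (fderiv ℝ y) := hy.fderiv_right (by simp)
  have hd : ∀ z, HasFDerivAt y (fderiv ℝ y z) z := fun z =>
    (hy.differentiable (by simp) z).hasFDerivAt
  have hd' : HasFDerivAt (fderiv ℝ y) (fderiv ℝ (fderiv ℝ y) (t, x₀)) (t, x₀) :=
    (hy'.differentiable (by simp) _).hasFDerivAt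
  have hw : w =ᶠ[𝓝 x₀] fun x => fderiv ℝ y (t, x) (1, 0) := by
    filter_upwards [h] with x hx
    refine hx.unique ?_
    have := (hd (t, x)).comp_hasDerivAt t ((hasDerivAt_id t).prodMk (hasDerivAt_const t x))
    exact this
  have h1 : fderiv ℝ w x₀ = ((fderiv ℝ (fderiv ℝ y) (t, x₀)) (1, 0)).comp
      (ContinuousLinearMap.inr ℝ ℝ E) := by
    rw [hw.fderiv_eq]
    have h2 : HasFDerivAt (fun x => fderiv ℝ y (t, x) (1, 0))
        ((ContinuousLinearMap.apply ℝ V ((1, 0) : ℝ × E)).comp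
          ((fderiv ℝ (fderiv ℝ y) (t, x₀)).comp (ContinuousLinearMap.inr ℝ ℝ E))) x₀ :=
      (ContinuousLinearMap.apply ℝ V ((1, 0) : ℝ × E)).hasFDerivAt.comp x₀
        (hd'.comp x₀ (hasFDerivAt_prodMk_right t x₀))
    rw [h2.fderiv]
    ext v
    have hsymm := hy.contDiffAt.isSymmSndFDerivAt (x := (t, x₀))
      (by simp only [minSmoothness_of_isRCLikeNormedField]; exact WithTop.coe_le_coe.mpr (le_top : (2 : ℕ∞) ≤ ⊤))
    simpa using hsymm (0, v) (1, 0)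
  rw [h1]
  simp_rw [fderiv_slice hy]
  have h3 : HasDerivAt (fun s => fderiv ℝ y (s, x₀)) (fderiv ℝ (fderiv ℝ y) (t, x₀) (1, 0)) t :=
    hd'.comp_hasDerivAt t ((hasDerivAt_id t).prodMk (hasDerivAt_const t x₀))
  exact ((ContinuousLinearMap.compL ℝ E (ℝ × E) V).flip
    (ContinuousLinearMap.inr ℝ ℝ E)).hasFDerivAt.comp_hasDerivAt t h3

/-- A bound free of the quotient `ε / K`. Lipschitz constants below are increased by one so that `1
≤ K` holds. -/
lemma gronwallBound_le {δ K ε x : ℝ} (hε : 0 ≤ ε) (hK : 1 ≤ K) :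
    gronwallBound δ K ε x ≤ (δ + ε) * Real.exp (K * x) := by
  rw [gronwallBound_of_K_ne_0 (by positivity)]
  have h1 : ε / K ≤ ε := div_le_self hε hK
  have h2 := Real.exp_pos (K * x)
  have h3 : 0 ≤ ε / K := by positivity
  nlinarith

lemma continuousOn_of_eventually_forall_dist_le {T : ℝ} {y : P → ℝ × E → V}
    (hy : ∀ p, Continuous (y p))
    (h : ∀ p₀, ∀ x₀ ∈ K, ∀ ε > 0, ∀ᶠ z : P × E in 𝓝[univ ×ˢ K] (p₀, x₀),
      ∀ t ∈ Icc 0 T, dist (y z.1 (t, z.2)) (y p₀ (t, x₀)) ≤ ε) :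
    ContinuousOn (fun z : (P × Icc 0 T) × E => y z.1.1 (z.1.2, z.2)) (univ ×ˢ K) := by
  rintro ⟨⟨p₀, t₀⟩, x₀⟩ ⟨-, hx₀⟩
  rw [ContinuousWithinAt, Metric.tendsto_nhds]
  intro ε hε
  have ht : Filter.Tendsto (fun z : (P × Icc 0 T) × E => (z.1.1, z.2))
      (𝓝[univ ×ˢ K] ((p₀, t₀), x₀)) (𝓝[univ ×ˢ K] (p₀, x₀)) :=
    ContinuousWithinAt.tendsto_nhdsWithin (by fun_prop) fun z hz => ⟨trivial, hz.2⟩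
  have hc : Continuous fun z : (P × Icc 0 T) × E => y p₀ (z.1.2, x₀) :=
    (hy p₀).comp (by fun_prop)
  have h2 := (Metric.tendsto_nhds.1 (hc.continuousAt (x := ((p₀, t₀), x₀)))
    (ε / 2) (half_pos hε)).filter_mono (nhdsWithin_le_nhds (s := univ ×ˢ K))
  filter_upwards [ht.eventually (h p₀ x₀ hx₀ (ε / 2) (half_pos hε)), h2] with z h1 h2
  have := h1 z.1.2 z.1.2.2
  linarith [dist_triangle (y z.1.1 (z.1.2, z.2)) (y p₀ (z.1.2, x₀)) (y p₀ (t₀, x₀))]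

/-- The solution at `(p₀, x₀)` solves the equation at a nearby `(p, x)` up to a defect controlled by
the change of the coefficients; Gronwall's inequality compares the two solutions. -/
lemma continuousOn_linearODE {T : ℝ} (hT : 0 ≤ T) {y : P → ℝ × E → V}
    {A : P → ℝ × E → V →L[ℝ] V} {b : P → ℝ × E → V}
    (hy : ∀ p, Continuous (y p)) (hA : ∀ p, Continuous (A p)) {y₀ : V} (h0 : ∀ p x, y p (0, x) = y₀)
    (hode : ∀ p t x,
      HasDerivAt (fun s => y p (s, x)) (A p (t, x) (y p (t, x)) + b p (t, x)) t)
    (FA : ContinuousOn (fun z : (P × Icc 0 T) × E => A z.1.1 (z.1.2, z.2)) (univ ×ˢ K))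
    (Fb : ContinuousOn (fun z : (P × Icc 0 T) × E => b z.1.1 (z.1.2, z.2)) (univ ×ˢ K)) :
    ContinuousOn (fun z : (P × Icc 0 T) × E => y z.1.1 (z.1.2, z.2)) (univ ×ˢ K) := by
  refine continuousOn_of_eventually_forall_dist_le hy fun p₀ x₀ hx₀ ε hε => ?_
  obtain ⟨R, hR⟩ := (isCompact_Icc (a := (0 : ℝ)) (b := T)).exists_bound_of_continuousOn
    (f := fun t => y p₀ (t, x₀)) ((hy p₀).comp (by fun_prop)).continuousOn
  obtain ⟨a, ha⟩ := (isCompact_Icc (a := (0 : ℝ)) (b := T)).exists_bound_of_continuousOn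
    (f := fun t => A p₀ (t, x₀)) ((hA p₀).comp (by fun_prop)).continuousOn
  have hT0 : (0 : ℝ) ∈ Icc 0 T := ⟨le_rfl, hT⟩
  have hR0 : 0 ≤ R := (norm_nonneg _).trans (hR 0 hT0)
  have ha0 : 0 ≤ a := (norm_nonneg _).trans (ha 0 hT0)
  set C := (R + 1) * Real.exp ((a + 1) * T) with hC
  have hCpos : 0 < C := by positivity
  -- `δ ≤ 1` keeps the nearby coefficient `A` below `a + 1` in norm, and `δ * C ≤ ε` absorbs the
  -- Gronwall factor applied to the defect `δ * (R + 1)`.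
  obtain ⟨δ, hδ, hδ1, hδC⟩ : ∃ δ > 0, δ ≤ 1 ∧ δ * C ≤ ε :=
    ⟨min 1 (ε / C), by positivity, min_le_left _ _, by
      calc _ ≤ ε / C * C := by gcongr; exact min_le_right _ _
        _ = ε := by field_simp⟩
  filter_upwards [eventually_forall_dist_lt_of_continuousOn
      (f := fun (q : P × Icc 0 T) x => A q.1 (q.2, x)) FA (p₀ := p₀) hx₀ hδ,
    eventually_forall_dist_lt_of_continuousOn
      (f := fun (q : P × Icc 0 T) x => b q.1 (q.2, x)) Fb (p₀ := p₀) hx₀ hδ] with z h1 h2 t ht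
  have hA' : ∀ s ∈ Icc 0 T, ‖A p₀ (s, x₀) - A z.1 (s, z.2)‖ ≤ δ := fun s hs => by
    rw [← dist_eq_norm, dist_comm]; exact (h1 ⟨s, hs⟩).le
  have hb' : ∀ s ∈ Icc 0 T, ‖b p₀ (s, x₀) - b z.1 (s, z.2)‖ ≤ δ := fun s hs => by
    rw [← dist_eq_norm, dist_comm]; exact (h2 ⟨s, hs⟩).le
  have hcont : ∀ p x, ContinuousOn (fun t => y p (t, x)) (Icc 0 T) := fun p x =>
    ((hy p).comp (by fun_prop)).continuousOn
  have key := dist_le_of_approx_trajectories_ODE_of_mem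
    (v := fun t w => A z.1 (t, z.2) w + b z.1 (t, z.2)) (s := fun _ => univ)
    (K := ⟨a + 1, by positivity⟩) (f := fun t => y z.1 (t, z.2)) (g := fun t => y p₀ (t, x₀))
    (a := 0) (b := T) (εf := 0) (εg := δ * (R + 1)) (δ := 0)
    (fun s hs => by
      refine (LipschitzWith.of_dist_le_mul fun u v => ?_).lipschitzOnWith
      have hs' := Ico_subset_Icc_self hs
      rw [dist_add_right, dist_eq_norm, dist_eq_norm, ← map_sub]
      refine (A z.1 (s, z.2)).le_of_opNorm_le ?_ _
      have := norm_sub_le (A p₀ (s, x₀)) (A p₀ (s, x₀) - A z.1 (s, z.2))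
      rw [sub_sub_cancel] at this
      exact this.trans (add_le_add (ha s hs') ((hA' s hs').trans hδ1)))
    (hcont _ _) (fun s _ => (hode _ s _).hasDerivWithinAt) (fun s _ => by simp)
    (fun _ _ => trivial) (hcont _ _) (fun s _ => (hode _ s _).hasDerivWithinAt)
    (fun s hs => by
      have hs' := Ico_subset_Icc_self hs
      rw [dist_eq_norm]
      have e : A p₀ (s, x₀) (y p₀ (s, x₀)) + b p₀ (s, x₀) -
          (A z.1 (s, z.2) (y p₀ (s, x₀)) + b z.1 (s, z.2)) =
          (A p₀ (s, x₀) - A z.1 (s, z.2)) (y p₀ (s, x₀)) + (b p₀ (s, x₀) - b z.1 (s, z.2)) := by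
        rw [sub_apply]; abel
      rw [e]
      refine (norm_add_le _ _).trans ?_
      have := (A p₀ (s, x₀) - A z.1 (s, z.2)).le_of_opNorm_le_of_le (hA' s hs') (hR s hs')
      linarith [hb' s hs'])
    (fun _ _ => trivial) (by simp [h0]) t ht
  refine key.trans ((gronwallBound_le (by positivity)
    (by change (1 : ℝ) ≤ a + 1; linarith)).trans (le_trans ?_ hδC))
  rw [hC, zero_add, zero_add, mul_assoc]
  change δ * ((R + 1) * Real.exp ((a + 1) * (t - 0))) ≤ _
  gcongr
  linarith [ht.2]

/-- The space derivative of a solution solves a linear equation of the same shape with values in `E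
→L[ℝ] V`, whose inhomogeneous term involves `y` and the derivatives of `A` and `b`. This permits an
induction on the order with `V` varying; the derivative starts from zero because the initial value
does not depend on `x`. -/
lemma FamilyOn.linearODE {T : ℝ} (hT : 0 ≤ T) {k : ℕ} {y : P → ℝ × E → V}
    {A : P → ℝ × E → V →L[ℝ] V} {b : P → ℝ × E → V}
    (hy : ∀ p, ContDiff ℝ ∞ (y p)) (hA : ∀ p, ContDiff ℝ ∞ (A p)) (hb : ∀ p, ContDiff ℝ ∞ (b p))
    {y₀ : V} (h0 : ∀ p x, y p (0, x) = y₀)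
    (hode : ∀ p t x,
      HasDerivAt (fun s => y p (s, x)) (A p (t, x) (y p (t, x)) + b p (t, x)) t)
    (FA : FamilyOn K k fun (q : P × Icc 0 T) x => A q.1 (q.2, x))
    (Fb : FamilyOn K k fun (q : P × Icc 0 T) x => b q.1 (q.2, x)) :
    FamilyOn K k fun (q : P × Icc 0 T) x => y q.1 (q.2, x) := by
  have hz : FamilyOn K 0 fun (q : P × Icc 0 T) x => y q.1 (q.2, x) :=
    ⟨fun q x _ => ((hy q.1).comp (by fun_prop)).smoothNear x,
      continuousOn_linearODE hT (fun p => (hy p).continuous) (fun p => (hA p).continuous) h0 hode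
        FA.continuousOn Fb.continuousOn⟩
  induction k generalizing V with
  | zero => exact hz
  | succ k ih =>
    have hyk := ih hy hA hb h0 hode FA.of_succ Fb.of_succ hz
    have hslice : ∀ {W : Type} [NormedAddCommGroup W] [NormedSpace ℝ W] {f : ℝ × E → W},
        ContDiff ℝ ∞ f → ∀ t x, HasFDerivAt (fun x => f (t, x))
          (_root_.fderiv ℝ (fun x => f (t, x)) x) x := fun hf t x =>
      ((hf.comp (by fun_prop : ContDiff ℝ ∞ fun x : E => (t, x))).differentiable
        (by simp) x).hasFDerivAt
    let N : P → ℝ × E → E →L[ℝ] V := fun p z => _root_.fderiv ℝ (fun x => y p (z.1, x)) z.2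
    let A' : P → ℝ × E → (E →L[ℝ] V) →L[ℝ] E →L[ℝ] V := fun p z =>
      ContinuousLinearMap.compL ℝ E V V (A p z)
    let b' : P → ℝ × E → E →L[ℝ] V := fun p z =>
      (ContinuousLinearMap.flipₗᵢ ℝ E V V : (E →L[ℝ] V →L[ℝ] V) →L[ℝ] V →L[ℝ] E →L[ℝ] V)
        (_root_.fderiv ℝ (fun x => A p (z.1, x)) z.2) (y p z) +
      _root_.fderiv ℝ (fun x => b p (z.1, x)) z.2
    have hN : ∀ p, ContDiff ℝ ∞ (N p) := fun p => contDiff_fderiv_slice (hy p)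
    have hcomp : ContDiff ℝ ∞ fun L : V →L[ℝ] V => ContinuousLinearMap.compL ℝ E V V L :=
      ContinuousLinearMap.contDiff _
    have hA' : ∀ p, ContDiff ℝ ∞ (A' p) := fun p => hcomp.comp (hA p)
    have hb' : ∀ p, ContDiff ℝ ∞ (b' p) := fun p =>
      (ContDiff.clm_apply ((ContinuousLinearMap.contDiff _).comp (contDiff_fderiv_slice (hA p)))
        (hy p)).add (contDiff_fderiv_slice (hb p))
    have hN0 : ∀ p x, N p (0, x) = 0 := fun p x => by
      simp [N, h0]
    have hNode : ∀ p t x, HasDerivAt (fun s => N p (s, x))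
        (A' p (t, x) (N p (t, x)) + b' p (t, x)) t := by
      intro p t x
      have h := hasDerivAt_fderiv_slice (hy p) (x₀ := x)
        (Filter.Eventually.of_forall fun x => hode p t x)
      have h2 := ((hslice (hA p) t x).clm_apply (hslice (hy p) t x)).add (hslice (hb p) t x)
      have e : A' p (t, x) (N p (t, x)) + b' p (t, x) = _ := (add_assoc _ _ _).symm.trans h2.fderiv.symm
      rw [e]
      exact h
    have FA' : FamilyOn K k fun (q : P × Icc 0 T) x => A' q.1 (q.2, x) :=
      FamilyOn.clm (G := (E →L[ℝ] V) →L[ℝ] E →L[ℝ] V)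
        (ContinuousLinearMap.compL ℝ E V V) FA.of_succ
    have Fb' : FamilyOn K k fun (q : P × Icc 0 T) x => b' q.1 (q.2, x) :=
      (FamilyOn.bilin _ FA.fderiv hyk).add Fb.fderiv
    refine FamilyOn.succ hz (ih hN hA' hb' hN0 hNode FA' Fb' ?_)
    exact ⟨fun q x _ => ((hN q.1).comp (by fun_prop)).smoothNear x,
      continuousOn_linearODE hT (fun p => (hN p).continuous) (fun p => (hA' p).continuous) hN0 hNode
        FA'.continuousOn Fb'.continuousOn⟩

/-- Order zero is Gronwall's inequality, for which `K` must be invariant because the fields are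
compared only on `K`. For higher orders, the derivative of the flow solves the linear variational
equation, whose coefficient `fderiv X` along `χ` is under control by induction. -/
lemma FamilyOn.flow {T : ℝ} (hT : 0 ≤ T) (hK : IsCompact K) {χ X : P → ℝ × E → E}
    (hχ : ∀ p, ContDiff ℝ ∞ (χ p)) (hX : ∀ p, ContDiff ℝ ∞ (X p))
    (hL : ∀ p, ∃ L : NNReal, ∀ t, LipschitzWith L fun x => X p (t, x))
    (h0 : ∀ p x, χ p (0, x) = x)
    (hode : ∀ p t x, HasDerivAt (fun s => χ p (s, x)) (X p (t, χ p (t, x))) t)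
    (hm : ∀ p, ∀ t ∈ Icc 0 T, ∀ x ∈ K, χ p (t, x) ∈ K)
    (FX : ∀ k, FamilyOn K k fun (q : P × Icc 0 T) x => X q.1 (q.2, x)) (k : ℕ) :
    FamilyOn K k fun (q : P × Icc 0 T) x => χ q.1 (q.2, x) := by
  have hz : FamilyOn K 0 fun (q : P × Icc 0 T) x => χ q.1 (q.2, x) := by
    refine ⟨fun q x _ => ((hχ q.1).comp (by fun_prop)).smoothNear x,
      continuousOn_of_eventually_forall_dist_le (fun p => (hχ p).continuous)
        fun p₀ x₀ hx₀ ε hε => ?_⟩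
    obtain ⟨L, hL⟩ := hL p₀
    -- The factor 2 accounts for two errors of size `ε / C`: the initial point and the field.
    set C := 2 * Real.exp ((L + 1) * T) with hC
    have hCpos : 0 < C := by positivity
    have hδ : 0 < ε / C := by positivity
    have h1 : ∀ᶠ z : P × E in 𝓝[univ ×ˢ K] (p₀, x₀), ∀ s : Icc 0 T, ∀ x ∈ K,
        dist (X z.1 (s, x)) (X p₀ (s, x)) < ε / C := by
      have ht : Filter.Tendsto Prod.fst (𝓝[univ ×ˢ K] (p₀, x₀)) (𝓝 p₀) :=
        continuous_fst.continuousAt.tendsto.mono_left nhdsWithin_le_nhds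
      exact ht.eventually (eventually_forall_mem_dist_lt
        (f := fun (q : P × Icc 0 T) x => X q.1 (q.2, x)) hK (FX 0).2 p₀ hδ)
    have h2 : ∀ᶠ z : P × E in 𝓝[univ ×ˢ K] (p₀, x₀), dist z.2 x₀ < ε / C := by
      have ht : Filter.Tendsto Prod.snd (𝓝[univ ×ˢ K] (p₀, x₀)) (𝓝 x₀) :=
        continuous_snd.continuousAt.tendsto.mono_left nhdsWithin_le_nhds
      exact Metric.tendsto_nhds.1 ht _ hδ
    filter_upwards [h1, h2, self_mem_nhdsWithin] with z h1 h2 hzK t ht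
    have hcont : ∀ p x, ContinuousOn (fun t => χ p (t, x)) (Icc 0 T) := fun p x =>
      ((hχ p).continuous.comp (by fun_prop)).continuousOn
    have key := dist_le_of_approx_trajectories_ODE
      (v := fun t w => X p₀ (t, w)) (K := L + 1) (f := fun t => χ z.1 (t, z.2))
      (g := fun t => χ p₀ (t, x₀)) (a := 0) (b := T) (εf := ε / C) (εg := 0) (δ := ε / C)
      (fun s => (hL s).weaken (by simp)) (hcont _ _) (fun s _ => (hode _ s _).hasDerivWithinAt)
      (fun s hs => (h1 ⟨s, Ico_subset_Icc_self hs⟩ _ (hm _ s (Ico_subset_Icc_self hs) _ hzK.2)).le)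
      (hcont _ _) (fun s _ => (hode _ s _).hasDerivWithinAt) (fun s _ => by simp)
      (by simpa [h0] using h2.le) t ht
    refine key.trans ((gronwallBound_le (by positivity) (by simp)).trans ?_)
    calc (ε / C + (ε / C + 0)) * Real.exp (((L + 1 : NNReal) : ℝ) * (t - 0))
        = ε / C * (2 * Real.exp ((L + 1) * t)) := by push_cast; ring_nf
      _ ≤ ε / C * C := by
          rw [hC]; gcongr; exact ht.2
      _ = ε := by field_simp
  induction k with
  | zero => exact hz
  | succ k ih =>
    let A : P → ℝ × E → (E →L[ℝ] E) →L[ℝ] E →L[ℝ] E := fun p z =>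
      ContinuousLinearMap.compL ℝ E E E (_root_.fderiv ℝ (fun x => X p (z.1, x)) (χ p z))
    have hA : ∀ p, ContDiff ℝ ∞ (A p) := fun p =>
      (ContinuousLinearMap.compL ℝ E E E).contDiff.comp
        ((contDiff_fderiv_slice (hX p)).comp (contDiff_fst.prodMk (hχ p)))
    refine FamilyOn.succ hz (FamilyOn.linearODE hT
      (y := fun p z => _root_.fderiv ℝ (fun x => χ p (z.1, x)) z.2) (A := A) (b := fun _ _ => 0)
      (y₀ := ContinuousLinearMap.id ℝ E) (fun p => contDiff_fderiv_slice (hχ p)) hA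
      (fun p => contDiff_const) (fun p x => ?_) (fun p t x => ?_)
      (((FX (k + 1)).fderiv.comp ih fun q x hx => hm q.1 q.2 q.2.2 x hx).clm
        (ContinuousLinearMap.compL ℝ E E E)) (FamilyOn.of_continuous continuous_const k))
    · simp only [h0]; exact fderiv_fun_id
    · have h := hasDerivAt_fderiv_slice (hχ p) (x₀ := x)
        (Filter.Eventually.of_forall fun x => hode p t x)
      have h1 : HasFDerivAt (fun x => X p (t, x)) _ (χ p (t, x)) :=
        (((hX p).comp (by fun_prop : ContDiff ℝ ∞ fun x : E => (t, x))).differentiable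
          (by simp) _).hasFDerivAt
      have h2 : HasFDerivAt (fun x => χ p (t, x)) _ x :=
        (((hχ p).comp (by fun_prop : ContDiff ℝ ∞ fun x : E => (t, x))).differentiable
          (by simp) _).hasFDerivAt
      have h3 := h1.comp x h2
      rw [add_zero]
      have e : A p (t, x) (_root_.fderiv ℝ (fun x => χ p (t, x)) x) = _ := h3.fderiv.symm
      rw [e]
      exact h

end ParametricODE

/-! ### Flows on the closed unit disk -/

/-- Multiplication by a cutoff that equals one near `C` and vanishes off a compact set on which `w`
is smooth. -/
lemma exists_contDiff_eventuallyEq {E F : Type} [NormedAddCommGroup E] [NormedSpace ℝ E]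
    [FiniteDimensional ℝ E] [NormedAddCommGroup F] [NormedSpace ℝ F] {w : E → F} {C : Set E}
    (hC : IsCompact C) (hw : ∀ z ∈ C, SmoothNear w z) :
    ∃ v : E → F, ContDiff ℝ ∞ v ∧ HasCompactSupport v ∧ ∀ z ∈ C, v =ᶠ[𝓝 z] w := by
  have hU : IsOpen {z | SmoothNear w z} := isOpen_iff_mem_nhds.2 fun z hz => hz.eventually
  obtain ⟨L, hL, hCL, hLU⟩ := exists_compact_between hC hU hw
  obtain ⟨χ, h1, h0, -⟩ := exists_contMDiffMap_one_nhds_of_subset_interior (n := ⊤)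
    (modelWithCornersSelf ℝ E) hC.isClosed hCL
  have hχ : ContDiff ℝ ∞ χ := χ.contMDiff.contDiff
  refine ⟨fun z => χ z • w z, contDiff_iff_contDiffAt.2 fun z => ?_, ?_, fun z hz => ?_⟩
  · by_cases hz : z ∈ L
    · exact hχ.contDiffAt.smul (hLU hz).contDiffAt
    · refine contDiffAt_const (c := (0 : F)) |>.congr_of_eventuallyEq ?_
      filter_upwards [hL.isClosed.isOpen_compl.mem_nhds hz] with y hy
      rw [h0 y hy, zero_smul]
  · refine HasCompactSupport.intro hL fun z hz => ?_
    rw [h0 z hz, zero_smul]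
  · filter_upwards [Filter.Eventually.filter_mono (nhds_le_nhdsSet hz) h1] with y hy
    rw [hy, one_smul]

/-- A solution of a differential equation whose right-hand side is tangent to the unit sphere
does not leave the closed unit ball. -/
lemma norm_le_one_of_tangent {E : Type} [NormedAddCommGroup E] [InnerProductSpace ℝ E]
    {X : ℝ × E → E} {L : NNReal} {T : ℝ} (hL : ∀ t, LipschitzWith L fun x => X (t, x))
    (htan : ∀ t ∈ Icc 0 T, ∀ x, ‖x‖ = 1 → inner ℝ (X (t, x)) x = 0) {u : ℝ → E}
    (hu : ∀ t, HasDerivAt u (X (t, u t)) t) (h0 : ‖u 0‖ ≤ 1) : ∀ t ∈ Icc 0 T, ‖u t‖ ≤ 1 := by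
  -- Outside the ball `‖u‖ ^ 2 - 1` grows at rate at most `2 * L`. The rate `2 * L + 1` of the
  -- barrier is larger, which gives the strict inequality needed at a contact; then `ε` tends to
  -- zero.
  have key : ∀ ε > 0, ∀ t ∈ Icc 0 T, ‖u t‖ ^ 2 ≤ 1 + ε * Real.exp ((2 * L + 1) * t) := by
    intro ε hε
    have hd : ∀ t, HasDerivAt (fun t => ‖u t‖ ^ 2) (2 * inner ℝ (u t) (X (t, u t))) t :=
      fun t => (hu t).norm_sq
    refine image_le_of_deriv_right_lt_deriv_boundary
      (B' := fun t => ε * (Real.exp ((2 * L + 1) * t) * (2 * L + 1)))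
      (fun t _ => (hd t).continuousAt.continuousWithinAt) (fun t _ => (hd t).hasDerivWithinAt)
      ?_ (fun t => ?_) (fun t ht he => ?_)
    · simp only [mul_zero, Real.exp_zero, mul_one]
      nlinarith [norm_nonneg (u 0)]
    · have := (((hasDerivAt_id t).const_mul (2 * (L : ℝ) + 1)).exp.const_mul ε).const_add 1
      simpa using this
    · set e := ε * Real.exp ((2 * L + 1) * t) with he'
      have hepos : 0 < e := by positivity
      have hr : 1 < ‖u t‖ := by
        by_contra hle
        nlinarith [norm_nonneg (u t)]
      set r := ‖u t‖ with hrdef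
      have hr0 : r ≠ 0 := by positivity
      -- At the radial projection `v` to the sphere the field has no radial component; at distance
      -- `r - 1` from `v` the Lipschitz bound allows a radial component of at most `L * (r - 1)`.
      set v := r⁻¹ • u t with hv
      have hvn : ‖v‖ = 1 := by
        rw [hv, norm_smul, norm_inv, Real.norm_of_nonneg (by positivity), ← hrdef]
        field_simp
      have huv : u t = r • v := by rw [hv, smul_smul, mul_inv_cancel₀ hr0, one_smul]
      have h1 : inner ℝ (u t) (X (t, v)) = 0 := by
        rw [real_inner_comm, huv, inner_smul_right, htan t (Ico_subset_Icc_self ht) v hvn, mul_zero]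
      have h2 : ‖u t - v‖ = r - 1 := by
        have : u t - v = (r - 1) • v := by rw [sub_smul, one_smul, ← huv]
        rw [this, norm_smul, hvn, mul_one, Real.norm_of_nonneg (by linarith)]
      have h3 : inner ℝ (u t) (X (t, u t)) ≤ r * (L * (r - 1)) := by
        have : inner ℝ (u t) (X (t, u t)) = inner ℝ (u t) (X (t, u t) - X (t, v)) := by
          rw [inner_sub_right, h1, sub_zero]
        rw [this]
        refine (real_inner_le_norm _ _).trans ?_
        gcongr
        have := (hL t).dist_le_mul (u t) v
        rwa [dist_eq_norm, dist_eq_norm, h2] at this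
      have h4 : r * (L * (r - 1)) ≤ L * (r ^ 2 - 1) := by
        have : 0 ≤ (L : ℝ) * (r - 1) := mul_nonneg L.2 (by linarith)
        nlinarith
      have h5 : r ^ 2 - 1 = e := by linarith
      rw [h5] at h4
      have h6 : ε * (Real.exp ((2 * L + 1) * t) * (2 * L + 1)) = e * (2 * L + 1) := by
        rw [he']; ring
      rw [h6]
      nlinarith
  intro t ht
  have h1 : ‖u t‖ ^ 2 ≤ 1 := by
    refine le_of_forall_pos_le_add fun ε hε => ?_
    have := key (ε / Real.exp ((2 * L + 1) * t)) (by positivity) t ht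
    rwa [div_mul_cancel₀ _ (Real.exp_pos _).ne'] at this
  nlinarith [norm_nonneg (u t)]

/-- A smooth compactly supported time-dependent vector field has a global flow; `Φ s (t, x)` is
the state at time `t + s` of the solution which is at `x` at time `t`. -/
lemma exists_suspended_flow {E : Type} [NormedAddCommGroup E] [NormedSpace ℝ E]
    [FiniteDimensional ℝ E] {W : ℝ × E → E} (hW : ContDiff ℝ ∞ W) (hc : HasCompactSupport W) :
    ∃ Φ : ℝ → ℝ × E → ℝ × E, ContDiff ℝ ∞ (fun z : ℝ × (ℝ × E) => Φ z.1 z.2) ∧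
      (∀ z, Φ 0 z = z) ∧ (∀ s t z, Φ (s + t) z = Φ s (Φ t z)) ∧ (∀ s z, (Φ s z).1 = z.1 + s) ∧
      ∀ s z, HasDerivAt (fun s => (Φ s z).2) (W (Φ s z)) s := by
  have : CompleteSpace E := FiniteDimensional.complete ℝ E
  obtain ⟨L, hL⟩ := ContDiff.lipschitzWith_of_hasCompactSupport hc hW (by simp)
  obtain ⟨C, hC⟩ := hc.exists_bound_of_continuous hW.continuous
  have hV : ContDiff ℝ ∞ fun z : ℝ × E => ((1 : ℝ), W z) := contDiff_const.prodMk hW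
  have hVL : LipschitzWith (max 0 L) fun z : ℝ × E => ((1 : ℝ), W z) :=
    (LipschitzWith.const (1 : ℝ)).prodMk hL
  have hVC : ∀ z : ℝ × E, ‖((1 : ℝ), W z)‖ ≤ (max 1 C.toNNReal : NNReal) := fun z => by
    rw [Prod.norm_def]
    simp only [norm_one]
    push_cast
    exact max_le_max le_rfl ((hC z).trans (Real.le_coe_toNNReal C))
  obtain ⟨Φ, h0, h⟩ := exists_flow hVL hVC
  have h1 : ∀ s z, (Φ s z).1 = z.1 + s := by
    intro s z
    have hd : ∀ s, HasDerivAt (fun s => (Φ s z).1 - s) 0 s := fun s => by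
      have h2 : HasDerivAt (fun s => (Φ s z).1) 1 s :=
        (ContinuousLinearMap.fst ℝ ℝ E).hasFDerivAt.comp_hasDerivAt s (h s z)
      simpa using h2.fun_sub (hasDerivAt_id' s)
    have := is_const_of_deriv_eq_zero (fun s => (hd s).differentiableAt)
      (fun s => (hd s).deriv) s 0
    simp only [h0, sub_zero] at this
    linarith
  exact ⟨Φ, contDiff_flow hV hVL h0 h, h0, flow_add hVL h0 h, h1, fun s z =>
    (ContinuousLinearMap.snd ℝ ℝ E).hasFDerivAt.comp_hasDerivAt s (h s z)⟩

/-- The closed unit disk. -/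
abbrev disk : Set E2 := Metric.closedBall 0 1

/-- Each field is replaced by a compactly supported one that agrees with it near `Icc 0 T ×ˢ disk`.
Tangency confines the solutions to the disk, where the replacement is not felt. `ψ p (t, ·)` runs
back from time `t` to time `0`. -/
theorem exists_disk_flow {P : Type} [TopologicalSpace P] {T : ℝ} (hT : 0 ≤ T) {W : P → ℝ × E2 → E2}
    (hs : ∀ p, ∀ z ∈ Icc 0 T ×ˢ disk, SmoothNear (W p) z)
    (FW : ∀ k, FamilyOn disk k fun (q : P × Icc 0 T) x => W q.1 (q.2, x))
    (htan : ∀ p, ∀ t ∈ Icc 0 T, ∀ x, ‖x‖ = 1 → inner ℝ (W p (t, x)) x = 0) :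
    ∃ φ ψ : P → ℝ × E2 → E2, (∀ p, ContDiff ℝ ∞ (φ p)) ∧ (∀ p, ContDiff ℝ ∞ (ψ p)) ∧
      (∀ p x, φ p (0, x) = x) ∧
      (∀ p, ∀ t ∈ Icc 0 T, ∀ x ∈ disk, φ p (t, x) ∈ disk ∧ ψ p (t, x) ∈ disk ∧
        ψ p (t, φ p (t, x)) = x ∧ φ p (t, ψ p (t, x)) = x ∧
        HasDerivAt (fun s => φ p (s, x)) (W p (t, φ p (t, x))) t) ∧
      (∀ k, FamilyOn disk k fun (q : P × Icc 0 T) x => φ q.1 (q.2, x)) ∧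
      ∀ k, FamilyOn disk k fun p x => ψ p (T, x) := by
  have hcomp : IsCompact (Icc 0 T ×ˢ disk) := isCompact_Icc.prod (isCompact_closedBall _ _)
  choose V hV hVc hVW using fun p => exists_contDiff_eventuallyEq hcomp (hs p)
  choose Φ hΦ h0 hadd h1 hder using fun p => exists_suspended_flow (hV p) (hVc p)
  have hVeq : ∀ p, ∀ t ∈ Icc 0 T, ∀ x ∈ disk, V p (t, x) = W p (t, x) := fun p t ht x hx =>
    (hVW p (t, x) ⟨ht, hx⟩).self_of_nhds
  have hVtan : ∀ p, ∀ t ∈ Icc 0 T, ∀ x, ‖x‖ = 1 → inner ℝ (V p (t, x)) x = 0 :=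
    fun p t ht x hx => by
      rw [hVeq p t ht x (by simp [disk, hx])]; exact htan p t ht x hx
  have hVL : ∀ p, ∃ L : NNReal, ∀ t, LipschitzWith L fun x => V p (t, x) := fun p => by
    obtain ⟨L, hL⟩ := ContDiff.lipschitzWith_of_hasCompactSupport (hVc p) (hV p) (by simp)
    exact ⟨L * 1, fun t => hL.comp (LipschitzWith.prodMk_left t)⟩
  have FV : ∀ k, FamilyOn disk k fun (q : P × Icc 0 T) x => V q.1 (q.2, x) := fun k =>
    (FW k).congr fun q x hx =>
      ((by fun_prop : Continuous fun y : E2 => ((q.2 : ℝ), y)).continuousAt.eventually (hVW q.1 _ ⟨q.2.2, hx⟩)).mono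
        fun y hy => hy.symm
  have hΦeq : ∀ p s t x, Φ p s (t, x) = (t + s, (Φ p s (t, x)).2) := fun p s t x =>
    Prod.ext (h1 p s (t, x)) rfl
  let φ : P → ℝ × E2 → E2 := fun p z => (Φ p z.1 (0, z.2)).2
  let ψ : P → ℝ × E2 → E2 := fun p z => (Φ p (-z.1) (z.1, z.2)).2
  -- `χ` runs back from the fixed time `T`, so it is the solution of a reversed equation starting at
  -- the identity and `FamilyOn.flow` applies to it. At time `T` it coincides with `ψ`.
  let χ : P → ℝ × E2 → E2 := fun p z => (Φ p (-z.1) (T, z.2)).2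
  have hφ : ∀ p, ContDiff ℝ ∞ (φ p) := fun p =>
    contDiff_snd.comp ((hΦ p).comp (by fun_prop : ContDiff ℝ ∞ fun z : ℝ × E2 =>
      (z.1, ((0 : ℝ), z.2))))
  have hψ : ∀ p, ContDiff ℝ ∞ (ψ p) := fun p =>
    contDiff_snd.comp ((hΦ p).comp (by fun_prop : ContDiff ℝ ∞ fun z : ℝ × E2 =>
      (-z.1, (z.1, z.2))))
  have hχ : ∀ p, ContDiff ℝ ∞ (χ p) := fun p =>
    contDiff_snd.comp ((hΦ p).comp (by fun_prop : ContDiff ℝ ∞ fun z : ℝ × E2 =>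
      (-z.1, (T, z.2))))
  have hφ0 : ∀ p x, φ p (0, x) = x := fun p x => by simp [φ, h0]
  have hφd : ∀ p t x, HasDerivAt (fun s => φ p (s, x)) (V p (t, φ p (t, x))) t := fun p t x => by
    have := hder p t (0, x)
    rw [hΦeq p t 0 x, zero_add] at this
    exact this
  have hback : ∀ p a t x, HasDerivAt (fun s => (Φ p (-s) (a, x)).2)
      (-V p (a - t, (Φ p (-t) (a, x)).2)) t := fun p a t x => by
    have h2 := (hder p (-t) (a, x)).scomp t (hasDerivAt_neg t)
    rw [hΦeq p (-t) a x, ← sub_eq_add_neg, neg_one_smul] at h2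
    exact h2
  have hφm : ∀ p, ∀ t ∈ Icc 0 T, ∀ x ∈ disk, φ p (t, x) ∈ disk := fun p t ht x hx => by
    obtain ⟨L, hL⟩ := hVL p
    rw [mem_closedBall_zero_iff] at hx ⊢
    exact norm_le_one_of_tangent hL (hVtan p) (fun t => hφd p t x) (by rwa [hφ0]) t ht
  have hbm : ∀ p, ∀ a ≤ T, ∀ t ∈ Icc 0 a, ∀ x ∈ disk, (Φ p (-t) (a, x)).2 ∈ disk :=
    fun p a ha t ht x hx => by
      obtain ⟨L, hL⟩ := hVL p
      rw [mem_closedBall_zero_iff] at hx ⊢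
      refine norm_le_one_of_tangent (X := fun z => -V p (a - z.1, z.2)) (T := a)
        (fun t => (hL (a - t)).neg) (fun s hs x hx => ?_) (fun t => hback p a t x)
        (by simpa [h0] using hx) t ht
      rw [inner_neg_left, hVtan p _ ⟨by linarith [hs.2], by linarith [hs.1]⟩ x hx, neg_zero]
  refine ⟨φ, ψ, hφ, hψ, hφ0, fun p t ht x hx => ⟨hφm p t ht x hx, hbm p t ht.2 t ⟨ht.1, le_rfl⟩ x hx,
    ?_, ?_, ?_⟩, ?_, ?_⟩
  · change (Φ p (-t) (t, (Φ p t (0, x)).2)).2 = x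
    have : (t, (Φ p t (0, x)).2) = Φ p t (0, x) := by
      rw [hΦeq p t 0 x, zero_add]
    rw [this, ← hadd, neg_add_cancel, h0]
  · change (Φ p t (0, (Φ p (-t) (t, x)).2)).2 = x
    have : (0, (Φ p (-t) (t, x)).2) = Φ p (-t) (t, x) := by
      rw [hΦeq p (-t) t x, add_neg_cancel]
    rw [this, ← hadd, add_neg_cancel, h0]
  · rw [← hVeq p t ht _ (hφm p t ht x hx)]
    exact hφd p t x
  · exact FamilyOn.flow hT (isCompact_closedBall _ _) hφ hV hVL hφ0 hφd hφm FV
  · intro k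
    have hr : Continuous fun q : P × Icc 0 T =>
        ((q.1, ⟨T - q.2, by linarith [q.2.2.2], by linarith [q.2.2.1]⟩) : P × Icc 0 T) := by
      fun_prop
    have Fχ := FamilyOn.flow hT (isCompact_closedBall _ _) hχ (X := fun p z => -V p (T - z.1, z.2))
      (fun p => ((hV p).comp (by fun_prop)).neg)
      (fun p => (hVL p).imp fun L hL t => (hL (T - t)).neg) (fun p x => by simp [χ, h0])
      (fun p t x => hback p T t x) (fun p t ht x hx => hbm p T le_rfl t ht x hx)
      (fun k => (((FV k).reparam hr).clm (-ContinuousLinearMap.id ℝ E2)).congr fun q x _ =>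
        Filter.Eventually.of_forall fun y => by simp) k
    exact Fχ.reparam (by fun_prop : Continuous fun p : P => (p, (⟨T, hT, le_rfl⟩ : Icc 0 T)))

/-! ### The continuity equation in the plane -/

section Plane

/-- The standard basis vectors of the plane. -/
noncomputable abbrev planeBasis (i : Fin 2) : E2 := EuclideanSpace.single i 1

lemma plane_expand (v : E2) : v = v 0 • planeBasis 0 + v 1 • planeBasis 1 := by
  ext i; fin_cases i <;> simp

/-- The trace of an endomorphism of the plane. -/
noncomputable def planeTrace (A : E2 →L[ℝ] E2) : ℝ := A (planeBasis 0) 0 + A (planeBasis 1) 1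

lemma plane_det_eq (M : E2 →L[ℝ] E2) :
    M.det = M (planeBasis 0) 0 * M (planeBasis 1) 1 - M (planeBasis 1) 0 * M (planeBasis 0) 1 := by
  rw [ContinuousLinearMap.det, ← LinearMap.det_toMatrix (EuclideanSpace.basisFun (Fin 2) ℝ).toBasis,
    Matrix.det_fin_two]
  simp [LinearMap.toMatrix_apply]

lemma plane_apply_apply (A : E2 →L[ℝ] E2) (v : E2) (i : Fin 2) :
    A v i = v 0 * A (planeBasis 0) i + v 1 * A (planeBasis 1) i := by
  conv_lhs => rw [plane_expand v]
  simp only [map_add, map_smul, PiLp.add_apply, PiLp.smul_apply, smul_eq_mul]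

lemma plane_functional_apply (A : E2 →L[ℝ] ℝ) (v : E2) :
    A v = v 0 * A (planeBasis 0) + v 1 * A (planeBasis 1) := by
  conv_lhs => rw [plane_expand v]
  simp only [map_add, map_smul, smul_eq_mul]

/-- Liouville's formula: a density which solves the continuity equation along a flow is
transported by the flow. -/
lemma det_mul_density_eq {T : ℝ} {η X G : ℝ × E2 → E2} {ρ : ℝ × E2 → ℝ} {x₀ : E2}
    (hη : ContDiff ℝ ∞ η)
    (hode : ∀ t ∈ Icc 0 T, ∀ᶠ x in 𝓝 x₀, HasDerivAt (fun s => η (s, x)) (X (t, η (t, x))) t)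
    (hX : ∀ t ∈ Icc 0 T, DifferentiableAt ℝ (fun y => X (t, y)) (η (t, x₀)))
    (hρ : ∀ t ∈ Icc 0 T, DifferentiableAt ℝ ρ (t, η (t, x₀)))
    (hG : ∀ t ∈ Icc 0 T, ∀ᶠ y in 𝓝 (η (t, x₀)), G (t, y) = ρ (t, y) • X (t, y))
    (hcont : ∀ t ∈ Icc 0 T, fderiv ℝ ρ (t, η (t, x₀)) (1, 0) +
      planeTrace (fderiv ℝ (fun y => G (t, y)) (η (t, x₀))) = 0) :
    ∀ t ∈ Icc 0 T, (fderiv ℝ (fun x => η (t, x)) x₀).det * ρ (t, η (t, x₀)) =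
      (fderiv ℝ (fun x => η (0, x)) x₀).det * ρ (0, η (0, x₀)) := by
  have hder : ∀ t ∈ Icc 0 T, HasDerivAt
      (fun t => (fderiv ℝ (fun x => η (t, x)) x₀).det * ρ (t, η (t, x₀))) 0 t := by
    intro t ht
    set y := η (t, x₀) with hy
    set M := fderiv ℝ (fun x => η (t, x)) x₀ with hM
    set A := fderiv ℝ (fun y => X (t, y)) y with hA
    set R := fderiv ℝ ρ (t, y) with hR
    have hηx : HasFDerivAt (fun x => η (t, x)) M x₀ :=
      ((hη.comp (by fun_prop : ContDiff ℝ ∞ fun x : E2 => (t, x))).differentiable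
        (by simp) x₀).hasFDerivAt
    have hcomp : fderiv ℝ (fun x => X (t, η (t, x))) x₀ = A.comp M :=
      (HasFDerivAt.comp (g := fun y => X (t, y)) x₀ (hX t ht).hasFDerivAt hηx).fderiv
    have hMd : HasDerivAt (fun s => fderiv ℝ (fun x => η (s, x)) x₀) (A.comp M) t := by
      rw [← hcomp]; exact hasDerivAt_fderiv_slice hη (hode t ht)
    have hent : ∀ i j : Fin 2, HasDerivAt
        (fun s => fderiv ℝ (fun x => η (s, x)) x₀ (planeBasis j) i) (A (M (planeBasis j)) i) t :=
      fun i j => ((EuclideanSpace.proj i).comp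
        (ContinuousLinearMap.apply ℝ E2 (planeBasis j))).hasFDerivAt.comp_hasDerivAt t hMd
    -- Jacobi's formula in dimension two: the equation `M' = A M` gives `(det M)' = tr A * det M`.
    have hdet : HasDerivAt (fun s => (fderiv ℝ (fun x => η (s, x)) x₀).det)
        (planeTrace A * M.det) t := by
      simp_rw [plane_det_eq]
      refine (((hent 0 0).fun_mul (hent 1 1)).fun_sub ((hent 0 1).fun_mul (hent 1 0))).congr_deriv ?_
      rw [plane_apply_apply A (M (planeBasis 0)) 0, plane_apply_apply A (M (planeBasis 0)) 1,
        plane_apply_apply A (M (planeBasis 1)) 0, plane_apply_apply A (M (planeBasis 1)) 1,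
        planeTrace]
      ring
    have hρd : HasDerivAt (fun s => ρ (s, η (s, x₀))) (R (1, X (t, y))) t :=
      HasFDerivAt.comp_hasDerivAt (f := fun s => (s, η (s, x₀))) t (hρ t ht).hasFDerivAt
        ((hasDerivAt_id t).prodMk (hode t ht).self_of_nhds)
    have hρy : HasFDerivAt (fun y => ρ (t, y)) (R.comp (ContinuousLinearMap.inr ℝ ℝ E2)) y :=
      (hρ t ht).hasFDerivAt.comp y (hasFDerivAt_prodMk_right t y)
    have hGd : fderiv ℝ (fun y => G (t, y)) y =
        ρ (t, y) • A + (R.comp (ContinuousLinearMap.inr ℝ ℝ E2)).smulRight (X (t, y)) := by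
      rw [Filter.EventuallyEq.fderiv_eq (hG t ht)]
      exact (hρy.smul (hX t ht).hasFDerivAt).fderiv
    have htr : planeTrace (fderiv ℝ (fun y => G (t, y)) y) =
        ρ (t, y) * planeTrace A + R (0, X (t, y)) := by
      have h1 := plane_functional_apply (R.comp (ContinuousLinearMap.inr ℝ ℝ E2)) (X (t, y))
      simp only [ContinuousLinearMap.comp_apply, ContinuousLinearMap.inr_apply] at h1
      rw [hGd, planeTrace, planeTrace, h1]
      simp only [add_apply, smul_apply,
        ContinuousLinearMap.smulRight_apply, ContinuousLinearMap.comp_apply,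
        ContinuousLinearMap.inr_apply, PiLp.add_apply, PiLp.smul_apply, smul_eq_mul]
      ring
    have hsplit : R (1, X (t, y)) = R (1, 0) + R (0, X (t, y)) := by
      rw [← map_add, Prod.mk_add_mk, add_zero, zero_add]
    refine (hdet.fun_mul hρd).congr_deriv ?_
    have := hcont t ht
    rw [htr] at this
    rw [hsplit]
    linear_combination M.det * this
  intro t ht
  exact constant_of_has_deriv_right_zero (fun s hs => (hder s hs).continuousAt.continuousWithinAt)
    (fun s hs => (hder s (Ico_subset_Icc_self hs)).hasDerivWithinAt) t ht

/-- The differential equations hold only for starting points in the closed disk, so they can be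
differentiated in the starting point only in the interior. Jacobian identities reach the boundary by
continuity. -/
lemma eqOn_disk_of_eqOn_ball {F : Type} [TopologicalSpace F] [T2Space F] {f g : E2 → F}
    (hf : Continuous f) (hg : Continuous g) (h : EqOn f g (Metric.ball 0 1)) : EqOn f g disk := by
  have := h.closure hf hg
  rwa [closure_ball (0 : E2) one_ne_zero] at this

end Plane

/-! ### A right inverse of the divergence on the disk -/

section Divergence

/-- Rotation of the plane by the angle `α`. -/
noncomputable def planeRot (α : ℝ) (x : E2) : E2 :=
  !₂[Real.cos α * x 0 - Real.sin α * x 1, Real.sin α * x 0 + Real.cos α * x 1]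

lemma contDiff_planeRot : ContDiff ℝ ∞ fun z : ℝ × E2 => planeRot z.1 z.2 := by
  rw [contDiff_euclidean]
  intro i
  fin_cases i
  · simp only [planeRot]
    simp
    fun_prop
  · simp only [planeRot]
    simp
    fun_prop

lemma norm_planeRot (α : ℝ) (x : E2) : ‖planeRot α x‖ = ‖x‖ := by
  rw [EuclideanSpace.norm_eq, EuclideanSpace.norm_eq]
  congr 1
  simp only [Fin.sum_univ_two, planeRot, Real.norm_eq_abs, sq_abs]
  simp
  linear_combination (x 0 ^ 2 + x 1 ^ 2) * Real.cos_sq_add_sin_sq α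

lemma planeRot_add (α β : ℝ) (x : E2) : planeRot (α + β) x = planeRot α (planeRot β x) := by
  ext i
  fin_cases i
  · simp [planeRot, Real.cos_add, Real.sin_add]; ring
  · simp [planeRot, Real.cos_add, Real.sin_add]; ring

lemma planeRot_two_pi (x : E2) : planeRot (2 * Real.pi) x = x := by
  ext i; fin_cases i <;> simp [planeRot]

lemma planeRot_zero (x : E2) : planeRot 0 x = x := by
  ext i; fin_cases i <;> simp [planeRot]

lemma exists_planeRot_eq {x : E2} (hx : ‖x‖ = 1) : ∃ β, x = planeRot β (planeBasis 0) := by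
  have h : x 0 ^ 2 + x 1 ^ 2 = 1 := by
    have := EuclideanSpace.norm_sq_eq x
    rw [hx, Fin.sum_univ_two] at this
    simpa using this.symm
  have hz : ‖(⟨x 0, x 1⟩ : ℂ)‖ = 1 := by
    rw [Complex.norm_eq_sqrt_sq_add_sq, h, Real.sqrt_one]
  refine ⟨Complex.arg ⟨x 0, x 1⟩, ?_⟩
  have h1 := Complex.norm_mul_cos_arg ⟨x 0, x 1⟩
  have h2 := Complex.norm_mul_sin_arg ⟨x 0, x 1⟩
  rw [hz, one_mul] at h1 h2
  ext i
  fin_cases i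
  · simp [planeRot, h1]
  · simp [planeRot, h2]

lemma planeRot_eq (α : ℝ) (x : E2) :
    planeRot α x = Real.cos α • x + Real.sin α • !₂[-x 1, x 0] := by
  ext i
  fin_cases i
  · simp [planeRot]; ring
  · simp [planeRot]; ring

lemma hasDerivAt_planeRot_zero (x : E2) : HasDerivAt (fun α => planeRot α x) !₂[-x 1, x 0] 0 := by
  simp_rw [planeRot_eq]
  simpa using ((Real.hasDerivAt_cos 0).smul_const x).fun_add
    ((Real.hasDerivAt_sin 0).smul_const !₂[-x 1, x 0])

attribute [irreducible] planeRot

variable (f : E2 → ℝ)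

/-- The radial mean `∫₀¹ s f(sx) ds`. -/
noncomputable def radialMean (x : E2) : ℝ := ∫ s in (0 : ℝ)..1, s * f (s • x)

/-- The mean of `radialMean f` over the unit circle. -/
noncomputable def circleMean : ℝ :=
  ∫ u in (0 : ℝ)..1, radialMean f (planeRot (2 * Real.pi * u) (planeBasis 0))

/-- A function whose angular derivative is `radialMean f` minus its mean over circles. -/
noncomputable def streamFunction (x : E2) : ℝ :=
  ∫ u in (0 : ℝ)..1, 2 * Real.pi * u * radialMean f (planeRot (2 * Real.pi * u) x)

/-- A vector field with divergence `f`. -/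
noncomputable def divInverse (x : E2) : E2 :=
  radialMean f x • x - (fderiv ℝ (streamFunction f) x (planeBasis 1) • planeBasis 0 -
    fderiv ℝ (streamFunction f) x (planeBasis 0) • planeBasis 1)

variable {f}

lemma contDiff_radialMean_integrand (hf : ContDiff ℝ ∞ f) :
    ContDiff ℝ ∞ fun z : ℝ × E2 => z.1 * f (z.1 • z.2) :=
  contDiff_fst.mul (hf.comp (contDiff_fst.smul contDiff_snd))

lemma contDiff_radialMean (hf : ContDiff ℝ ∞ f) : ContDiff ℝ ∞ (radialMean f) :=
  contDiff_parametric_integral (contDiff_radialMean_integrand hf)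

lemma contDiff_streamFunction_integrand (hf : ContDiff ℝ ∞ f) : ContDiff ℝ ∞ fun z : ℝ × E2 =>
    2 * Real.pi * z.1 * radialMean f (planeRot (2 * Real.pi * z.1) z.2) := by
  have h1 : ContDiff ℝ ∞ fun z : ℝ × E2 => (2 * Real.pi * z.1, z.2) := by fun_prop
  have h2 : ContDiff ℝ ∞ fun z : ℝ × E2 => planeRot (2 * Real.pi * z.1) z.2 :=
    contDiff_planeRot.comp h1
  have h3 : ContDiff ℝ ∞ fun z : ℝ × E2 => radialMean f (planeRot (2 * Real.pi * z.1) z.2) :=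
    (contDiff_radialMean hf).comp h2
  have h4 : ContDiff ℝ ∞ fun z : ℝ × E2 => 2 * Real.pi * z.1 := by fun_prop
  exact h4.mul h3

lemma contDiff_streamFunction (hf : ContDiff ℝ ∞ f) : ContDiff ℝ ∞ (streamFunction f) :=
  contDiff_parametric_integral (contDiff_streamFunction_integrand hf)

lemma contDiff_divInverse (hf : ContDiff ℝ ∞ f) : ContDiff ℝ ∞ (divInverse f) := by
  have h : ContDiff ℝ ∞ (fderiv ℝ (streamFunction f)) :=
    (contDiff_streamFunction hf).fderiv_right (by simp)
  exact ((contDiff_radialMean hf).smul contDiff_id).sub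
    (((h.clm_apply contDiff_const).smul contDiff_const).sub
      ((h.clm_apply contDiff_const).smul contDiff_const))

/-- Integrate the `s`-derivative of `s ^ 2 * f (s • x)` over [0, 1]. The left side is the divergence
of `radialMean f x • x`. -/
lemma two_mul_radialMean_add (hf : ContDiff ℝ ∞ f) (x : E2) :
    2 * radialMean f x + fderiv ℝ (radialMean f) x x = f x := by
  have hd : ∀ y, HasFDerivAt f (fderiv ℝ f y) y := fun y =>
    (hf.differentiable (by simp) y).hasFDerivAt
  have hcd : Continuous (fderiv ℝ f) := hf.continuous_fderiv (by simp)
  have hslice : ∀ s : ℝ, fderiv ℝ (fun y => s * f (s • y)) x x = s ^ 2 * fderiv ℝ f (s • x) x := by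
    intro s
    have h1 : HasFDerivAt (fun y : E2 => s • y) (s • ContinuousLinearMap.id ℝ E2) x :=
      (hasFDerivAt_id x).const_smul s
    have h2 : HasFDerivAt (fun y : E2 => s * f (s • y)) _ x :=
      (HasFDerivAt.comp (g := f) x (hd (s • x)) h1).const_mul s
    rw [h2.fderiv]
    simp only [smul_apply, ContinuousLinearMap.comp_apply, ContinuousLinearMap.id_apply,
      map_smul, smul_eq_mul]
    ring
  have hcs : Continuous fun s : ℝ => fderiv ℝ (fun y => s * f (s • y)) x :=
    (contDiff_fderiv_slice (contDiff_radialMean_integrand hf)).continuous.comp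
      (by fun_prop : Continuous fun s : ℝ => (s, x))
  have h1 : fderiv ℝ (radialMean f) x x = ∫ s in (0 : ℝ)..1, s ^ 2 * fderiv ℝ f (s • x) x := by
    have h2 := fderiv_parametric_integral (contDiff_radialMean_integrand hf) x
    have h3 : fderiv ℝ (radialMean f) x =
      ∫ u in (0 : ℝ)..1, fderiv ℝ (fun y => u * f (u • y)) x := h2
    rw [h3, ContinuousLinearMap.intervalIntegral_apply (hcs.intervalIntegrable _ _)]
    simp_rw [hslice]
  have h2 : ∀ s ∈ uIcc (0 : ℝ) 1, HasDerivAt (fun s : ℝ => s ^ 2 * f (s • x))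
      (2 * (s * f (s • x)) + s ^ 2 * fderiv ℝ f (s • x) x) s := by
    intro s _
    have h3 : HasDerivAt (fun s : ℝ => s • x) x s := by
      simpa using (hasDerivAt_id s).smul_const x
    have h4 : HasDerivAt (fun s : ℝ => f (s • x)) (fderiv ℝ f (s • x) x) s :=
      HasFDerivAt.comp_hasDerivAt (l := f) s (hd (s • x)) h3
    refine ((hasDerivAt_pow 2 s).fun_mul h4).congr_deriv ?_
    push_cast
    ring
  have hc1 : Continuous fun s : ℝ => 2 * (s * f (s • x)) := by
    have := hf.continuous; fun_prop
  have hc2 : Continuous fun s : ℝ => s ^ 2 * fderiv ℝ f (s • x) x := by fun_prop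
  have h5 := intervalIntegral.integral_eq_sub_of_hasDerivAt h2
    ((hc1.add hc2).intervalIntegrable _ _)
  rw [intervalIntegral.integral_add (hc1.intervalIntegrable _ _) (hc2.intervalIntegrable _ _),
    intervalIntegral.integral_const_mul] at h5
  rw [h1, radialMean, h5]
  simp

/-- The radial term already has divergence `f`; the rotated gradient is divergence-free by symmetry
of second derivatives. -/
lemma trace_fderiv_divInverse (hf : ContDiff ℝ ∞ f) (x : E2) :
    planeTrace (fderiv ℝ (divInverse f) x) = f x := by
  have h : ContDiff ℝ ∞ (fderiv ℝ (streamFunction f)) :=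
    (contDiff_streamFunction hf).fderiv_right (by simp)
  set S := fderiv ℝ (fderiv ℝ (streamFunction f)) x with hS
  have hg : HasFDerivAt (radialMean f) (fderiv ℝ (radialMean f) x) x :=
    ((contDiff_radialMean hf).differentiable (by simp) x).hasFDerivAt
  have hψ : ∀ i, HasFDerivAt (fun y => fderiv ℝ (streamFunction f) y (planeBasis i))
      ((ContinuousLinearMap.apply ℝ ℝ (planeBasis i)).comp S) x := fun i =>
    (ContinuousLinearMap.apply ℝ ℝ (planeBasis i)).hasFDerivAt.comp x
      (h.differentiable (by simp) x).hasFDerivAt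
  have hsymm : S (planeBasis 0) (planeBasis 1) = S (planeBasis 1) (planeBasis 0) :=
    (contDiff_streamFunction hf).contDiffAt.isSymmSndFDerivAt
      (by simp only [minSmoothness_of_isRCLikeNormedField]
          exact WithTop.coe_le_coe.mpr (le_top : (2 : ℕ∞) ≤ ⊤)) _ _
  have hD := (hg.smul (hasFDerivAt_id x)).sub
    (((hψ 1).smul_const (planeBasis 0)).sub ((hψ 0).smul_const (planeBasis 1)))
  have hD' : fderiv ℝ (divInverse f) x = _ := hD.fderiv
  have h2 := two_mul_radialMean_add hf x
  rw [plane_functional_apply] at h2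
  rw [hD', planeTrace]
  simp only [sub_apply, add_apply, smul_apply,
    ContinuousLinearMap.smulRight_apply, ContinuousLinearMap.comp_apply,
    ContinuousLinearMap.apply_apply, PiLp.sub_apply, PiLp.add_apply, PiLp.smul_apply, smul_eq_mul,
    ContinuousLinearMap.id_apply, id]
  simp
  linarith [h2, hsymm]

/-- On the circle the radial term has normal component `radialMean f x`, and the rotated gradient
removes the angular derivative of the stream function, which is `radialMean f x` minus its mean. A
constant remains, and it vanishes for the difference of two densities with equal `circleMean`. -/
lemma inner_divInverse (hf : ContDiff ℝ ∞ f) {x : E2} (hx : ‖x‖ = 1) :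
    inner ℝ (divInverse f x) x = circleMean f := by
  have hg := contDiff_radialMean hf
  have hgd : ∀ y, HasFDerivAt (radialMean f) (fderiv ℝ (radialMean f) y) y := fun y =>
    (hg.differentiable (by simp) y).hasFDerivAt
  let h : ℝ → ℝ := fun u => radialMean f (planeRot (2 * Real.pi * u) x)
  have hr : ContDiff ℝ ∞ fun u : ℝ => planeRot (2 * Real.pi * u) x :=
    contDiff_planeRot.comp (by fun_prop : ContDiff ℝ ∞ fun u : ℝ => (2 * Real.pi * u, x))
  have hh : ContDiff ℝ ∞ h := hg.comp hr
  have hslice : ∀ u : ℝ,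
      fderiv ℝ (fun y => 2 * Real.pi * u * radialMean f (planeRot (2 * Real.pi * u) y)) x
        !₂[-x 1, x 0] = u * deriv h u := by
    intro u
    have h1 : DifferentiableAt ℝ
        (fun y => 2 * Real.pi * u * radialMean f (planeRot (2 * Real.pi * u) y)) (planeRot 0 x) :=
      ((contDiff_streamFunction_integrand hf).comp
        (by fun_prop : ContDiff ℝ ∞ fun y : E2 => (u, y))).differentiable (by simp) _
    have h2 := h1.hasFDerivAt.comp_hasDerivAt 0 (hasDerivAt_planeRot_zero x)
    rw [planeRot_zero] at h2
    have h3 : HasDerivAt (fun α : ℝ => 2 * Real.pi * u * h (u + α / (2 * Real.pi)))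
        (2 * Real.pi * u * (deriv h u * (1 / (2 * Real.pi)))) 0 := by
      have h4 : HasDerivAt (fun α : ℝ => u + α / (2 * Real.pi)) (1 / (2 * Real.pi)) 0 :=
        ((hasDerivAt_id (0 : ℝ)).div_const _).const_add _
      have h5 : HasDerivAt h (deriv h u) (u + 0 / (2 * Real.pi)) := by
        simpa using (hh.differentiable (by simp) u).hasDerivAt
      exact (h5.comp 0 h4).const_mul _
    have h6 : (fun α : ℝ => 2 * Real.pi * u * h (u + α / (2 * Real.pi))) =
        (fun y => 2 * Real.pi * u * radialMean f (planeRot (2 * Real.pi * u) y)) ∘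
          fun α => planeRot α x := by
      ext α
      simp only [h, Function.comp]
      rw [← planeRot_add]
      congr 3
      field_simp
    rw [h6] at h3
    rw [h2.unique h3]
    field_simp
  have hcs : Continuous fun u : ℝ =>
      fderiv ℝ (fun y => 2 * Real.pi * u * radialMean f (planeRot (2 * Real.pi * u) y)) x :=
    (contDiff_fderiv_slice (contDiff_streamFunction_integrand hf)).continuous.comp
      (by fun_prop : Continuous fun s : ℝ => (s, x))
  have hc' : Continuous (deriv h) := hh.continuous_deriv (by simp)
  have h1 : fderiv ℝ (streamFunction f) x !₂[-x 1, x 0] = ∫ u in (0 : ℝ)..1, u * deriv h u := by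
    have h3 : fderiv ℝ (streamFunction f) x = ∫ u in (0 : ℝ)..1,
        fderiv ℝ (fun y => 2 * Real.pi * u * radialMean f (planeRot (2 * Real.pi * u) y)) x :=
      fderiv_parametric_integral (contDiff_streamFunction_integrand hf) x
    rw [h3, ContinuousLinearMap.intervalIntegral_apply (hcs.intervalIntegrable _ _)]
    simp_rw [hslice]
  -- The weight `u` in `streamFunction` is chosen for this integration by parts: it leaves the value
  -- at the end point minus the mean.
  have h2 : ∫ u in (0 : ℝ)..1, u * deriv h u = h 1 - ∫ u in (0 : ℝ)..1, h u := by
    have := intervalIntegral.integral_mul_deriv_eq_deriv_mul (a := 0) (b := 1)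
      (u := fun u : ℝ => u) (v := h) (u' := fun _ => 1) (v' := deriv h)
      (fun u _ => hasDerivAt_id u) (fun u _ => (hh.differentiable (by simp) u).hasDerivAt)
      (continuous_const.intervalIntegrable _ _) (hc'.intervalIntegrable _ _)
    simpa using this
  have h3 : h 1 = radialMean f x := by simp [h, planeRot_two_pi]
  -- By periodicity the mean does not depend on the point of the circle from which the angle is
  -- counted.
  have h4 : ∫ u in (0 : ℝ)..1, h u = circleMean f := by
    obtain ⟨β, hβ⟩ := exists_planeRot_eq hx
    let h₀ : ℝ → ℝ := fun u => radialMean f (planeRot (2 * Real.pi * u) (planeBasis 0))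
    have hp : Function.Periodic h₀ 1 := fun u => by
      simp only [h₀]
      rw [mul_add, mul_one, planeRot_add, planeRot_two_pi]
    have e : ∀ u, h u = h₀ (u + β / (2 * Real.pi)) := fun u => by
      simp only [h, h₀]
      conv_lhs => rw [hβ, ← planeRot_add]
      congr 2
      field_simp
    simp_rw [e]
    rw [intervalIntegral.integral_comp_add_right, zero_add, add_comm (1 : ℝ)]
    have := hp.intervalIntegral_add_eq (β / (2 * Real.pi)) 0
    rw [zero_add] at this
    exact this
  have h5 : inner ℝ (divInverse f x) x =
      radialMean f x - fderiv ℝ (streamFunction f) x !₂[-x 1, x 0] := by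
    have hx2 : x 0 ^ 2 + x 1 ^ 2 = 1 := by
      have := EuclideanSpace.norm_sq_eq x
      rw [hx, Fin.sum_univ_two] at this
      simpa using this.symm
    rw [plane_functional_apply]
    simp only [divInverse, PiLp.inner_apply, Fin.sum_univ_two]
    simp
    linear_combination (radialMean f x) * hx2
  rw [h5, h1, h2, h3, h4]
  ring

end Divergence

/-! ### Moser's theorem on the disk -/

section Moser

variable {P : Type} [TopologicalSpace P]

lemma FamilyOn.smul {E F : Type} [NormedAddCommGroup E] [NormedSpace ℝ E] [NormedAddCommGroup F]
    [NormedSpace ℝ F] {K : Set E} {k : ℕ} {c : P → E → ℝ} {f : P → E → F} (hc : FamilyOn K k c)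
    (hf : FamilyOn K k f) : FamilyOn K k fun p x => c p x • f p x :=
  FamilyOn.bilin (ContinuousLinearMap.lsmul ℝ ℝ) hc hf

lemma FamilyOn.mul {E : Type} [NormedAddCommGroup E] [NormedSpace ℝ E]
    {K : Set E} {k : ℕ} {c f : P → E → ℝ} (hc : FamilyOn K k c)
    (hf : FamilyOn K k f) : FamilyOn K k fun p x => c p x * f p x :=
  FamilyOn.bilin (ContinuousLinearMap.mul ℝ ℝ) hc hf

lemma FamilyOn.neg {E F : Type} [NormedAddCommGroup E] [NormedSpace ℝ E] [NormedAddCommGroup F]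
    [NormedSpace ℝ F] {K : Set E} {k : ℕ} {f : P → E → F}
    (hf : FamilyOn K k f) : FamilyOn K k fun p x => -f p x :=
  hf.clm (-ContinuousLinearMap.id ℝ F)

lemma FamilyOn.sub {E F : Type} [NormedAddCommGroup E] [NormedSpace ℝ E] [NormedAddCommGroup F]
    [NormedSpace ℝ F] {K : Set E} {k : ℕ} {f g : P → E → F}
    (hf : FamilyOn K k f) (hg : FamilyOn K k g) : FamilyOn K k fun p x => f p x - g p x := by
  simp_rw [sub_eq_add_neg]
  exact hf.add hg.neg

lemma FamilyOn.inv {E : Type} [NormedAddCommGroup E] [NormedSpace ℝ E]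
    {K : Set E} {k : ℕ} {f : P → E → ℝ} (hf : FamilyOn K k f) (h0 : ∀ p, ∀ x ∈ K, f p x ≠ 0) :
    FamilyOn K k fun p x => (f p x)⁻¹ :=
  FamilyOn.comp_smooth (g := fun y : ℝ => y⁻¹) (L := {0}ᶜ) (fun y hy => by
    filter_upwards [isOpen_compl_singleton.mem_nhds hy] with z hz
    exact contDiffAt_inv ℝ hz) hf h0

lemma SmoothNear.inv_smul {E F : Type} [NormedAddCommGroup E] [NormedSpace ℝ E]
    [NormedAddCommGroup F] [NormedSpace ℝ F] {c : E → ℝ} {f : E → F} {x : E}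
    (hc : SmoothNear c x) (hf : SmoothNear f x) (h0 : c x ≠ 0) :
    SmoothNear (fun y => (c y)⁻¹ • f y) x := by
  filter_upwards [hc, hf, hc.differentiableAt.continuousAt.eventually_ne h0] with y h1 h2 h3
  exact (h1.inv h3).smul h2

/-- Contractions towards the origin preserve the disk, so control of `f` on the disk suffices. In
the next lemma rotations play the same role. -/
lemma FamilyOn.radialMean {f : P → E2 → ℝ} (hf : ∀ p, ContDiff ℝ ∞ (f p)) {k : ℕ}
    (Ff : FamilyOn disk k f) : FamilyOn disk k fun p => radialMean (f p) := by
  have hs : ContDiff ℝ ∞ fun z : ℝ × E2 => z.1 • z.2 := contDiff_fst.smul contDiff_snd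
  have hc : Continuous fun q : P × Icc (0 : ℝ) 1 => (q.2 : ℝ) := by fun_prop
  refine FamilyOn.integral (f := fun p z => z.1 * f p (z.1 • z.2))
    (fun p => contDiff_radialMean_integrand (hf p)) ?_
  refine (FamilyOn.of_continuous hc k).mul ((Ff.reparam continuous_fst).comp
    ((FamilyOn.of_joint hs disk k).reparam hc) fun q x hx => ?_)
  rw [mem_closedBall_zero_iff] at hx ⊢
  rw [norm_smul, Real.norm_of_nonneg q.2.2.1]
  exact mul_le_one₀ q.2.2.2 (norm_nonneg _) hx

lemma FamilyOn.streamFunction {f : P → E2 → ℝ} (hf : ∀ p, ContDiff ℝ ∞ (f p)) {k : ℕ}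
    (Ff : FamilyOn disk k f) : FamilyOn disk k fun p => streamFunction (f p) := by
  have hc : Continuous fun q : P × Icc (0 : ℝ) 1 => 2 * Real.pi * (q.2 : ℝ) := by fun_prop
  refine FamilyOn.integral
    (f := fun p z => 2 * Real.pi * z.1 * _root_.radialMean (f p) (planeRot (2 * Real.pi * z.1) z.2))
    (fun p => contDiff_streamFunction_integrand (hf p)) ?_
  refine (FamilyOn.of_continuous hc k).mul (((Ff.radialMean hf).reparam continuous_fst).comp
    ((FamilyOn.of_joint contDiff_planeRot disk k).reparam hc) fun q x hx => ?_)
  rw [mem_closedBall_zero_iff] at hx ⊢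
  rwa [norm_planeRot]

lemma FamilyOn.divInverse {f : P → E2 → ℝ} (hf : ∀ p, ContDiff ℝ ∞ (f p))
    (Ff : ∀ k, FamilyOn disk k f) (k : ℕ) : FamilyOn disk k fun p => divInverse (f p) := by
  have hψ := ((Ff (k + 1)).streamFunction hf).fderiv
  have he : ∀ i j : Fin 2, FamilyOn disk k fun p x =>
      _root_.fderiv ℝ (_root_.streamFunction (f p)) x (planeBasis i) • planeBasis j := fun i j =>
    (hψ.clm (ContinuousLinearMap.apply ℝ ℝ (planeBasis i))).smul
      (FamilyOn.of_continuous continuous_const k)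
  exact (((Ff k).radialMean hf).smul (FamilyOn.of_smoothNear (fun x _ => contDiff_id.smoothNear x)
    k)).sub ((he 1 0).sub (he 0 1))

lemma radialMean_sub {f g : E2 → ℝ} (hf : Continuous f) (hg : Continuous g) (x : E2) :
    radialMean (fun y => f y - g y) x = radialMean f x - radialMean g x := by
  have h1 : Continuous fun s : ℝ => s * f (s • x) := by fun_prop
  have h2 : Continuous fun s : ℝ => s * g (s • x) := by fun_prop
  rw [radialMean, radialMean, radialMean,
    ← intervalIntegral.integral_sub (h1.intervalIntegrable _ _) (h2.intervalIntegrable _ _)]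
  simp_rw [mul_sub]

lemma radialMean_const_mul (c : ℝ) (f : E2 → ℝ) (x : E2) :
    radialMean (fun y => c * f y) x = c * radialMean f x := by
  rw [radialMean, radialMean, ← intervalIntegral.integral_const_mul]
  simp_rw [mul_left_comm]

lemma continuous_circleMean_integrand {f : E2 → ℝ} (hf : ContDiff ℝ ∞ f) :
    Continuous fun u : ℝ => radialMean f (planeRot (2 * Real.pi * u) (planeBasis 0)) := by
  have h : Continuous fun u : ℝ => planeRot (2 * Real.pi * u) (planeBasis 0) :=
    contDiff_planeRot.continuous.comp
      (by fun_prop : Continuous fun u : ℝ => (2 * Real.pi * u, planeBasis 0))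
  exact (contDiff_radialMean hf).continuous.comp h

lemma circleMean_sub {f g : E2 → ℝ} (hf : ContDiff ℝ ∞ f) (hg : ContDiff ℝ ∞ g) :
    circleMean (fun y => f y - g y) = circleMean f - circleMean g := by
  rw [circleMean, circleMean, circleMean, ← intervalIntegral.integral_sub
    ((continuous_circleMean_integrand hf).intervalIntegrable _ _)
    ((continuous_circleMean_integrand hg).intervalIntegrable _ _)]
  simp_rw [radialMean_sub hf.continuous hg.continuous]

lemma circleMean_const_mul (c : ℝ) (f : E2 → ℝ) :
    circleMean (fun y => c * f y) = c * circleMean f := by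
  rw [circleMean, circleMean, ← intervalIntegral.integral_const_mul]
  simp_rw [radialMean_const_mul]

lemma circleMean_pos {f : E2 → ℝ} (hf : ContDiff ℝ ∞ f) (hpos : ∀ x ∈ disk, 0 < f x) :
    0 < circleMean f := by
  have hr : ∀ x ∈ disk, 0 < radialMean f x := by
    intro x hx
    have hfc := hf.continuous
    refine intervalIntegral.intervalIntegral_pos_of_pos_on
      ((by fun_prop : Continuous fun s : ℝ => s * f (s • x)).intervalIntegrable _ _)
      (fun s hs => mul_pos hs.1 (hpos _ ?_)) zero_lt_one
    rw [mem_closedBall_zero_iff] at hx ⊢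
    rw [norm_smul, Real.norm_of_nonneg hs.1.le]
    exact mul_le_one₀ hs.2.le (norm_nonneg _) hx
  refine intervalIntegral.intervalIntegral_pos_of_pos_on
    ((continuous_circleMean_integrand hf).intervalIntegrable _ _)
    (fun s _ => hr _ ?_) zero_lt_one
  rw [mem_closedBall_zero_iff, norm_planeRot]
  simp

/-- The mean is treated as a family of constant functions on a single point, which reduces the claim
to `FamilyOn.integral`. -/
lemma continuous_circleMean {f : P → E2 → ℝ} (hf : ∀ p, ContDiff ℝ ∞ (f p))
    (Ff : FamilyOn disk 0 f) : Continuous fun p => circleMean (f p) := by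
  have hc : Continuous fun q : P × Icc (0 : ℝ) 1 => 2 * Real.pi * (q.2 : ℝ) := by fun_prop
  have hrot : ContDiff ℝ ∞ fun z : ℝ × E2 => planeRot (2 * Real.pi * z.1) (planeBasis 0) := by
    have := contDiff_planeRot.comp
      (by fun_prop : ContDiff ℝ ∞ fun z : ℝ × E2 => (2 * Real.pi * z.1, planeBasis 0))
    simpa only [Function.comp_def] using this
  have hmem : ∀ α, planeRot α (planeBasis 0) ∈ disk := fun α => by
    rw [mem_closedBall_zero_iff, norm_planeRot]; simp
  have h1 : ∀ p, ContDiff ℝ ∞ fun z : ℝ × E2 =>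
      radialMean (f p) (planeRot (2 * Real.pi * z.1) (planeBasis 0)) := fun p => by
    have := ContDiff.comp (g := radialMean (f p)) (contDiff_radialMean (hf p)) hrot
    simpa only [Function.comp_def] using this
  have h2 : FamilyOn {(0 : E2)} 0 fun (q : P × Icc (0 : ℝ) 1) (_ : E2) =>
      planeRot (2 * Real.pi * (q.2 : ℝ)) (planeBasis 0) :=
    FamilyOn.of_continuous (by
      have := contDiff_planeRot.continuous.comp
        (by fun_prop : Continuous fun q : P × Icc (0 : ℝ) 1 =>
          (2 * Real.pi * (q.2 : ℝ), planeBasis 0))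
      simpa only [Function.comp_def] using this) 0
  have h3 : FamilyOn disk 0 fun (q : P × Icc (0 : ℝ) 1) => radialMean (f q.1) :=
    (Ff.radialMean hf).reparam continuous_fst
  have h4 : FamilyOn {(0 : E2)} 0 fun (q : P × Icc (0 : ℝ) 1) (_ : E2) =>
      radialMean (f q.1) (planeRot (2 * Real.pi * (q.2 : ℝ)) (planeBasis 0)) :=
    FamilyOn.comp h3 h2 fun q x _ => hmem _
  have h : FamilyOn {(0 : E2)} 0 fun (p : P) (_ : E2) => circleMean (f p) :=
    FamilyOn.integral (f := fun p (z : ℝ × E2) =>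
      radialMean (f p) (planeRot (2 * Real.pi * z.1) (planeBasis 0))) h1 h4
  exact h.continuousOn.comp_continuous (f := fun p : P => (p, (0 : E2))) (by fun_prop)
    fun p => ⟨trivial, rfl⟩

/-- Along the segment `ρ` from `a` to `b`, the field `W = Z / ρ` satisfies ∂_tρ + div(ρW) = (b - a)
+ (a - b) = 0, so its flow transports `a` to `b`. Equal circle means make `W` tangent to the circle.
Explicit formulas followed by a flow yield continuity in `p`. -/
theorem exists_moser {a b : P → E2 → ℝ} (ha : ∀ p, ContDiff ℝ ∞ (a p))
    (hb : ∀ p, ContDiff ℝ ∞ (b p)) (Fa : ∀ k, FamilyOn disk k a) (Fb : ∀ k, FamilyOn disk k b)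
    (hapos : ∀ p, ∀ x ∈ disk, 0 < a p x) (hbpos : ∀ p, ∀ x ∈ disk, 0 < b p x)
    (hmean : ∀ p, circleMean (a p) = circleMean (b p)) :
    ∃ m n : P → E2 → E2, (∀ p, ContDiff ℝ ∞ (m p)) ∧ (∀ p, ContDiff ℝ ∞ (n p)) ∧
      (∀ p, ∀ x ∈ disk, m p x ∈ disk ∧ n p x ∈ disk ∧ n p (m p x) = x ∧ m p (n p x) = x ∧
        (fderiv ℝ (m p) x).det * b p (m p x) = a p x) ∧
      (∀ k, FamilyOn disk k m) ∧ ∀ k, FamilyOn disk k n := by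
  let ρ : P → ℝ × E2 → ℝ := fun p z => (1 - z.1) * a p z.2 + z.1 * b p z.2
  let Z : P → E2 → E2 := fun p => divInverse fun y => a p y - b p y
  let W : P → ℝ × E2 → E2 := fun p z => (ρ p z)⁻¹ • Z p z.2
  have hsub : ∀ p, ContDiff ℝ ∞ fun y => a p y - b p y := fun p => (ha p).sub (hb p)
  have hZ : ∀ p, ContDiff ℝ ∞ (Z p) := fun p => contDiff_divInverse (hsub p)
  have FZ : ∀ k, FamilyOn disk k Z := fun k =>
    FamilyOn.divInverse hsub (fun k => (Fa k).sub (Fb k)) k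
  have hρ : ∀ p, ContDiff ℝ ∞ (ρ p) := fun p =>
    ((contDiff_const.sub contDiff_fst).mul ((ha p).comp contDiff_snd)).add
      (contDiff_fst.mul ((hb p).comp contDiff_snd))
  have hρpos : ∀ p, ∀ t ∈ Icc (0 : ℝ) 1, ∀ x ∈ disk, 0 < ρ p (t, x) := fun p t ht x hx => by
    have h1 := hapos p x hx
    have h2 := hbpos p x hx
    have h3 : 0 ≤ 1 - t := by linarith [ht.2]
    have h4 := ht.1
    rcases h4.eq_or_lt with h | h
    · simp only [ρ, ← h]; linarith
    · exact add_pos_of_nonneg_of_pos (by positivity) (by positivity)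
  have hWs : ∀ p, ∀ z ∈ Icc (0 : ℝ) 1 ×ˢ disk, SmoothNear (W p) z := fun p z hz =>
    ((hρ p).smoothNear z).inv_smul (((hZ p).comp contDiff_snd).smoothNear z)
      (hρpos p z.1 hz.1 z.2 hz.2).ne'
  have Fρ : ∀ k, FamilyOn disk k fun (q : P × Icc (0 : ℝ) 1) x => ρ q.1 (q.2, x) := fun k =>
    ((FamilyOn.of_continuous (by fun_prop : Continuous fun q : P × Icc (0 : ℝ) 1 => 1 - (q.2 : ℝ))
      k).mul ((Fa k).reparam continuous_fst)).add
    ((FamilyOn.of_continuous (by fun_prop : Continuous fun q : P × Icc (0 : ℝ) 1 => (q.2 : ℝ))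
      k).mul ((Fb k).reparam continuous_fst))
  have FW : ∀ k, FamilyOn disk k fun (q : P × Icc (0 : ℝ) 1) x => W q.1 (q.2, x) := fun k =>
    ((Fρ k).inv fun q x hx => (hρpos q.1 q.2 q.2.2 x hx).ne').smul ((FZ k).reparam continuous_fst)
  have htan : ∀ p, ∀ t ∈ Icc (0 : ℝ) 1, ∀ x, ‖x‖ = 1 → inner ℝ (W p (t, x)) x = 0 := by
    intro p t _ x hx
    simp only [W, inner_smul_left]
    rw [inner_divInverse (hsub p) hx, circleMean_sub (ha p) (hb p), hmean p, sub_self, mul_zero]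
  obtain ⟨φ, ψ, hφ, hψ, hφ0, hφψ, Fφ, Fψ⟩ := exists_disk_flow zero_le_one hWs FW htan
  have h1 : (1 : ℝ) ∈ Icc (0 : ℝ) 1 := ⟨zero_le_one, le_rfl⟩
  have hφs : ∀ p, ContDiff ℝ ∞ fun x => φ p (1, x) := fun p => (hφ p).comp (by fun_prop)
  refine ⟨fun p x => φ p (1, x), fun p x => ψ p (1, x), hφs,
    fun p => (hψ p).comp (by fun_prop), fun p x hx => ?_, fun k => (Fφ k).reparam
      (by fun_prop : Continuous fun p : P => (p, (⟨1, h1⟩ : Icc (0 : ℝ) 1))), Fψ⟩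
  obtain ⟨m1, m2, m3, m4, -⟩ := hφψ p 1 h1 x hx
  refine ⟨m1, m2, m3, m4, ?_⟩
  revert x
  suffices h : EqOn (fun x => (fderiv ℝ (fun x => φ p (1, x)) x).det * b p (φ p (1, x))) (a p) disk
    from fun x hx _ _ _ _ => h hx
  refine eqOn_disk_of_eqOn_ball ?_ (ha p).continuous fun x hx => ?_
  · exact (ContinuousLinearMap.continuous_det.comp ((hφs p).continuous_fderiv (by simp))).mul
      ((hb p).continuous.comp (hφs p).continuous)
  have hx' : x ∈ disk := Metric.ball_subset_closedBall hx
  have hmem : ∀ t ∈ Icc (0 : ℝ) 1, φ p (t, x) ∈ disk := fun t ht => (hφψ p t ht x hx').1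
  have k1 : ∀ t ∈ Icc (0 : ℝ) 1, ∀ᶠ y in 𝓝 x,
      HasDerivAt (fun s => φ p (s, y)) (W p (t, φ p (t, y))) t := fun t ht => by
    filter_upwards [Metric.isOpen_ball.mem_nhds hx] with y hy
    exact (hφψ p t ht y (Metric.ball_subset_closedBall hy)).2.2.2.2
  have k2 : ∀ t ∈ Icc (0 : ℝ) 1, DifferentiableAt ℝ (fun y => W p (t, y)) (φ p (t, x)) :=
    fun t ht => by
      have hd : DifferentiableAt ℝ (W p) (t, φ p (t, x)) :=
        (hWs p (t, φ p (t, x)) (mk_mem_prod ht (hmem t ht))).differentiableAt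
      exact DifferentiableAt.comp (g := W p) (f := fun y : E2 => (t, y)) _ hd
        ((differentiableAt_const t).prodMk differentiableAt_id)
  have k3 : ∀ t ∈ Icc (0 : ℝ) 1, DifferentiableAt ℝ (ρ p) (t, φ p (t, x)) :=
    fun t _ => (hρ p).differentiable (by simp) _
  have k4 : ∀ t ∈ Icc (0 : ℝ) 1, ∀ᶠ y in 𝓝 (φ p (t, x)),
      Z p y = ρ p (t, y) • W p (t, y) := fun t ht => by
    have hc : ContinuousAt (fun y => ρ p (t, y)) (φ p (t, x)) :=
      ((hρ p).continuous.comp (by fun_prop : Continuous fun y : E2 => (t, y))).continuousAt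
    filter_upwards [hc.eventually_ne (hρpos p t ht _ (hmem t ht)).ne'] with y hy
    simp only [W, smul_smul, mul_inv_cancel₀ hy, one_smul]
  have k5 : ∀ t ∈ Icc (0 : ℝ) 1, fderiv ℝ (ρ p) (t, φ p (t, x)) (1, 0) +
      planeTrace (fderiv ℝ (Z p) (φ p (t, x))) = 0 := fun t ht => by
    have htr : planeTrace (fderiv ℝ (Z p) (φ p (t, x))) =
        a p (φ p (t, x)) - b p (φ p (t, x)) := trace_fderiv_divInverse (hsub p) _
    have hd : HasDerivAt (fun s : ℝ => ρ p (s, φ p (t, x)))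
        (fderiv ℝ (ρ p) (t, φ p (t, x)) (1, 0)) t :=
      HasFDerivAt.comp_hasDerivAt (f := fun s : ℝ => (s, φ p (t, x))) t
        ((hρ p).differentiable (by simp) _).hasFDerivAt
        ((hasDerivAt_id t).prodMk (hasDerivAt_const t (φ p (t, x))))
    have hd' : HasDerivAt (fun s : ℝ => ρ p (s, φ p (t, x)))
        (-1 * a p (φ p (t, x)) + 1 * b p (φ p (t, x))) t :=
      (((hasDerivAt_id' t).const_sub 1).mul_const (a p (φ p (t, x)))).fun_add
        ((hasDerivAt_id' t).mul_const (b p (φ p (t, x))))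
    rw [hd.unique hd', htr]
    ring
  have key := det_mul_density_eq (X := W p) (G := fun z => Z p z.2) (ρ := ρ p) (hφ p)
    k1 k2 k3 k4 k5 1 h1
  simp only [hφ0, ρ, sub_self, zero_mul, zero_add, one_mul, sub_zero, add_zero] at key
  simp only [fderiv_fun_id] at key
  rw [key]
  simp [ContinuousLinearMap.det]

end Moser

/-! ### Charts of sections diffeomorphic to the disk -/

section Chart

/-- A diffeomorphism of the closed unit disk onto `S`, given by smooth maps of the plane. -/
structure DiskChart (S : Set E2) where
  param : E2 → E2
  coord : E2 → E2
  contDiff_param : ContDiff ℝ ∞ param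
  contDiff_coord : ContDiff ℝ ∞ coord
  param_mem : ∀ x ∈ disk, param x ∈ S
  coord_mem : ∀ q ∈ S, coord q ∈ disk
  coord_param : ∀ x ∈ disk, coord (param x) = x
  param_coord : ∀ q ∈ S, param (coord q) = q

lemma SmoothDiffeo.nonempty_diskChart {S : Set E2} (Ψ : SmoothDiffeo disk S) :
    Nonempty (DiskChart S) := by
  obtain ⟨f, hf, hfΨ⟩ := Ψ.smooth_toFun
  obtain ⟨g, hg, hgΨ⟩ := Ψ.smooth_invFun
  have hf' : ∀ x (hx : x ∈ disk), f x = Ψ.toEquiv ⟨x, hx⟩ := fun x hx => hfΨ ⟨x, hx⟩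
  have hg' : ∀ q (hq : q ∈ S), g q = Ψ.toEquiv.symm ⟨q, hq⟩ := fun q hq => hgΨ ⟨q, hq⟩
  refine ⟨⟨f, g, hf, hg, fun x hx => ?_, fun q hq => ?_, fun x hx => ?_, fun q hq => ?_⟩⟩
  · rw [hf' x hx]; exact Subtype.property _
  · rw [hg' q hq]; exact Subtype.property _
  · rw [hf' x hx, hg' _ (Subtype.property _)]; simp
  · rw [hg' q hq, hf' _ (Subtype.property _)]; simp

namespace DiskChart

variable {S : Set E2} (c : DiskChart S)

lemma image_param : c.param '' disk = S :=
  Subset.antisymm (image_subset_iff.2 c.param_mem) fun q hq =>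
    ⟨c.coord q, c.coord_mem q hq, c.param_coord q hq⟩

include c in
lemma isCompact : IsCompact S := by
  rw [← c.image_param]
  exact (isCompact_closedBall _ _).image c.contDiff_param.continuous

lemma hasFDerivAt_param (x : E2) : HasFDerivAt c.param (fderiv ℝ c.param x) x :=
  (c.contDiff_param.differentiable (by simp) x).hasFDerivAt

lemma hasFDerivAt_coord (q : E2) : HasFDerivAt c.coord (fderiv ℝ c.coord q) q :=
  (c.contDiff_coord.differentiable (by simp) q).hasFDerivAt

lemma uniqueDiffOn_disk : UniqueDiffOn ℝ disk :=
  uniqueDiffOn_convex (convex_closedBall _ _) (by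
    rw [interior_closedBall _ one_ne_zero]; exact ⟨0, by simp⟩)

/-- The two maps are inverse only on the disk; unique differentiability passes the relation to the
derivatives, boundary points included. -/
lemma fderiv_coord_comp {x : E2} (hx : x ∈ disk) :
    (fderiv ℝ c.coord (c.param x)).comp (fderiv ℝ c.param x) = ContinuousLinearMap.id ℝ E2 := by
  have h1 : HasFDerivWithinAt (fun y => c.coord (c.param y))
      ((fderiv ℝ c.coord (c.param x)).comp (fderiv ℝ c.param x)) disk x :=
    ((c.hasFDerivAt_coord (c.param x)).comp x (c.hasFDerivAt_param x)).hasFDerivWithinAt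
  have h2 : HasFDerivWithinAt (fun y => c.coord (c.param y)) (ContinuousLinearMap.id ℝ E2) disk x :=
    (hasFDerivWithinAt_id x disk).congr (fun y hy => c.coord_param y hy) (c.coord_param x hx)
  exact (uniqueDiffOn_disk x hx).eq h1 h2

lemma fderiv_coord_apply {x : E2} (hx : x ∈ disk) (v : E2) :
    fderiv ℝ c.coord (c.param x) (fderiv ℝ c.param x v) = v :=
  DFunLike.congr_fun (c.fderiv_coord_comp hx) v

lemma fderiv_param_apply {x : E2} (hx : x ∈ disk) (v : E2) :
    fderiv ℝ c.param x (fderiv ℝ c.coord (c.param x) v) = v := by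
  have h : ((fderiv ℝ c.coord (c.param x) : E2 →L[ℝ] E2) : E2 →ₗ[ℝ] E2) ∘ₗ
      (fderiv ℝ c.param x : E2 →L[ℝ] E2) = LinearMap.id :=
    LinearMap.ext fun v => c.fderiv_coord_apply hx v
  exact DFunLike.congr_fun ((LinearMap.comp_eq_id_comm ℝ E2).1 h) v

lemma det_mul_det {x : E2} (hx : x ∈ disk) :
    (fderiv ℝ c.coord (c.param x)).det * (fderiv ℝ c.param x).det = 1 := by
  have h := congrArg ContinuousLinearMap.det (c.fderiv_coord_comp hx)
  simpa [ContinuousLinearMap.det, ContinuousLinearMap.toLinearMap_comp, LinearMap.det_comp]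
    using h

lemma det_fderiv_param_ne_zero {x : E2} (hx : x ∈ disk) : (fderiv ℝ c.param x).det ≠ 0 :=
  right_ne_zero_of_mul_eq_one (c.det_mul_det hx)

include c in
lemma uniqueDiffOn : UniqueDiffOn ℝ S := by
  rw [← c.image_param]
  exact uniqueDiffOn_disk.image (fun x _ => (c.hasFDerivAt_param x).hasFDerivWithinAt)
    fun x hx => Function.Surjective.denseRange fun v => ⟨_, c.fderiv_param_apply hx v⟩

/-- `coord` is open at this point, having a surjective derivative. It would carry a neighbourhood
contained in `S` onto a neighbourhood of `x` contained in the disk. -/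
lemma param_notMem_interior {x : E2} (hx : ‖x‖ = 1) : c.param x ∉ interior S := by
  intro hS
  have hxd : x ∈ disk := by simp [disk, hx]
  have hst : HasStrictFDerivAt c.coord (fderiv ℝ c.coord (c.param x)) (c.param x) :=
    c.contDiff_coord.contDiffAt.hasStrictFDerivAt (by simp)
  have hsurj : (fderiv ℝ c.coord (c.param x) : E2 →L[ℝ] E2).range = ⊤ :=
    LinearMap.range_eq_top.2 fun v => ⟨_, c.fderiv_coord_apply hxd v⟩
  have h1 := hst.map_nhds_eq_of_surj hsurj
  rw [c.coord_param x hxd] at h1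
  have h2 : disk ∈ 𝓝 x := by
    rw [← h1]
    exact Filter.mem_of_superset (Filter.image_mem_map (mem_interior_iff_mem_nhds.1 hS))
      (image_subset_iff.2 c.coord_mem)
  rw [← mem_interior_iff_mem_nhds, interior_closedBall _ one_ne_zero] at h2
  simp [hx] at h2

end DiskChart

end Chart

/-! ### Rotations about the axis -/

section Rotation

/-- The rotation of space by the angle `t` about the axis of symmetry. -/
noncomputable def spin (t : ℝ) (v : E3) : E3 :=
  !₂[Real.cos t * v 0 - Real.sin t * v 1, Real.sin t * v 0 + Real.cos t * v 1, v 2]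

@[simp] lemma spin_apply_zero (t : ℝ) (v : E3) :
    spin t v 0 = Real.cos t * v 0 - Real.sin t * v 1 := by simp [spin]

@[simp] lemma spin_apply_one (t : ℝ) (v : E3) :
    spin t v 1 = Real.sin t * v 0 + Real.cos t * v 1 := by simp [spin]

@[simp] lemma spin_apply_two (t : ℝ) (v : E3) : spin t v 2 = v 2 := by simp [spin]

lemma continuous_spin (t : ℝ) : Continuous (spin t) := by
  refine (PiLp.continuous_toLp 2 _).comp (continuous_pi fun i => ?_)
  fin_cases i <;> simp <;> fun_prop

/-- The point with cylindrical coordinates `(q 0, t, q 1)`. -/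
noncomputable def cyl (z : ℝ × E2) : E3 :=
  !₂[z.2 0 * Real.cos z.1, z.2 0 * Real.sin z.1, z.2 1]

@[simp] lemma cyl_apply_zero (z : ℝ × E2) : cyl z 0 = z.2 0 * Real.cos z.1 := by simp [cyl]

@[simp] lemma cyl_apply_one (z : ℝ × E2) : cyl z 1 = z.2 0 * Real.sin z.1 := by simp [cyl]

@[simp] lemma cyl_apply_two (z : ℝ × E2) : cyl z 2 = z.2 1 := by simp [cyl]

lemma contDiff_cyl : ContDiff ℝ ∞ cyl := by
  refine contDiff_euclidean.2 fun i => ?_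
  fin_cases i
  · simp only [Fin.zero_eta, cyl_apply_zero]
    exact ((contDiff_euclidean.1 contDiff_snd) 0).mul (Real.contDiff_cos.comp contDiff_fst)
  · simp only [Fin.mk_one, cyl_apply_one]
    exact ((contDiff_euclidean.1 contDiff_snd) 0).mul (Real.contDiff_sin.comp contDiff_fst)
  · simp only [Fin.reduceFinMk, cyl_apply_two]
    exact (contDiff_euclidean.1 contDiff_snd) 1

lemma cyl_zero (q : E2) : cyl (0, q) = halfPlanePoint q := by
  ext i; fin_cases i <;> simp [halfPlanePoint]

lemma cyl_two_pi (q : E2) : cyl (2 * Real.pi, q) = halfPlanePoint q := by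
  ext i; fin_cases i <;> simp [halfPlanePoint]

lemma spin_cyl (s t : ℝ) (q : E2) : spin s (cyl (t, q)) = cyl (s + t, q) := by
  ext i; fin_cases i <;> simp [Real.cos_add, Real.sin_add] <;> ring

lemma exists_cyl_eq (x : E3) : ∃ t ∈ Icc (-Real.pi) Real.pi,
    cyl (t, !₂[√(x 0 ^ 2 + x 1 ^ 2), x 2]) = x := by
  let w : ℂ := ⟨x 0, x 1⟩
  have hn : ‖w‖ = √(x 0 ^ 2 + x 1 ^ 2) := by
    rw [Complex.norm_def, Complex.normSq_apply]; simp [w, sq]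
  refine ⟨w.arg, ⟨(Complex.neg_pi_lt_arg w).le, Complex.arg_le_pi w⟩, ?_⟩
  ext i
  fin_cases i
  · simp [← hn, Complex.norm_mul_cos_arg]; rfl
  · simp [← hn, Complex.norm_mul_sin_arg]; rfl
  · simp

/-- The derivative of the cylindrical coordinates. -/
lemma fderiv_cyl_apply (t : ℝ) (q : E2) (a : ℝ) (v : E2) :
    fderiv ℝ cyl (t, q) (a, v) = !₂[v 0 * Real.cos t - q 0 * (Real.sin t * a),
      v 0 * Real.sin t + q 0 * (Real.cos t * a), v 1] := by
  have h0 : HasDerivAt (fun s : ℝ => (t + s * a, q + s • v)) (a, v) 0 := by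
    have h1 : HasDerivAt (fun s : ℝ => t + s * a) a 0 := by
      simpa using ((hasDerivAt_id (0 : ℝ)).mul_const a).const_add t
    have h2 : HasDerivAt (fun s : ℝ => q + s • v) v 0 := by
      simpa using ((hasDerivAt_id (0 : ℝ)).smul_const v).const_add q
    exact h1.prodMk h2
  have h1 : HasDerivAt (fun s : ℝ => cyl (t + s * a, q + s • v))
      (fderiv ℝ cyl (t, q) (a, v)) 0 := by
    have h : HasFDerivAt cyl (fderiv ℝ cyl (t, q)) (t + 0 * a, q + (0 : ℝ) • v) := by
      simpa using (contDiff_cyl.differentiable (by simp) (t, q)).hasFDerivAt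
    exact HasFDerivAt.comp_hasDerivAt (f := fun s : ℝ => (t + s * a, q + s • v)) 0 h h0
  have hc : HasDerivAt (fun s : ℝ => t + s * a) a 0 := by
    simpa using ((hasDerivAt_id (0 : ℝ)).mul_const a).const_add t
  have hq : ∀ i, HasDerivAt (fun s : ℝ => q i + s * v i) (v i) 0 := fun i => by
    simpa using ((hasDerivAt_id (0 : ℝ)).mul_const (v i)).const_add (q i)
  have hcoord : ∀ i, HasDerivAt (fun s : ℝ => cyl (t + s * a, q + s • v) i)
      (fderiv ℝ cyl (t, q) (a, v) i) 0 := fun i =>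
    (EuclideanSpace.proj i : E3 →L[ℝ] ℝ).hasFDerivAt.comp_hasDerivAt 0 h1
  ext i
  refine (hcoord i).unique ?_
  fin_cases i
  · simp only [Fin.zero_eta, cyl_apply_zero, PiLp.add_apply, PiLp.smul_apply, smul_eq_mul]
    refine ((hq 0).fun_mul hc.cos).congr_deriv ?_
    simp; ring
  · simp only [Fin.mk_one, cyl_apply_one, PiLp.add_apply, PiLp.smul_apply, smul_eq_mul]
    refine ((hq 0).fun_mul hc.sin).congr_deriv ?_
    simp
  · simp only [Fin.reduceFinMk, cyl_apply_two, PiLp.add_apply, PiLp.smul_apply, smul_eq_mul]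
    refine (hq 1).congr_deriv ?_
    simp

lemma fderiv_cyl_surjective {t : ℝ} {q : E2} (hq : q 0 ≠ 0) :
    Function.Surjective (fderiv ℝ cyl (t, q)) := by
  intro v
  refine ⟨((-Real.sin t * v 0 + Real.cos t * v 1) / q 0,
    !₂[Real.cos t * v 0 + Real.sin t * v 1, v 2]), ?_⟩
  rw [fderiv_cyl_apply]
  have h := Real.sin_sq_add_cos_sq t
  ext i
  fin_cases i
  · simp; field_simp; linear_combination (v 0) * h
  · simp; field_simp; linear_combination (v 1) * h
  · simp

end Rotation

/-! ### Toroidal domains -/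

namespace IsAxisymmetricToroidalDomain

variable {Ω : Set E3} (hΩ : IsAxisymmetricToroidalDomain Ω)
include hΩ

lemma spin_mem {x : E3} (hx : x ∈ Ω) (t : ℝ) : spin t x ∈ Ω := by
  refine hΩ.axisymmetric x _ ?_ (by simp) hx
  simp only [spin_apply_zero, spin_apply_one]
  linear_combination -(x 0 ^ 2 + x 1 ^ 2) * Real.sin_sq_add_cos_sq t

lemma spin_mem_closure {x : E3} (hx : x ∈ closure Ω) (t : ℝ) : spin t x ∈ closure Ω :=
  map_mem_closure (continuous_spin t) hx fun _ hy => hΩ.spin_mem hy t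

lemma cyl_mem_iff (t : ℝ) (q : E2) : cyl (t, q) ∈ Ω ↔ halfPlanePoint q ∈ Ω := by
  rw [← cyl_zero]
  constructor
  · intro h; simpa [spin_cyl] using hΩ.spin_mem h (-t)
  · intro h; simpa [spin_cyl] using hΩ.spin_mem h t

lemma cyl_mem_closure_iff (t : ℝ) (q : E2) :
    cyl (t, q) ∈ closure Ω ↔ halfPlanePoint q ∈ closure Ω := by
  rw [← cyl_zero]
  constructor
  · intro h; simpa [spin_cyl] using hΩ.spin_mem_closure h (-t)
  · intro h; simpa [spin_cyl] using hΩ.spin_mem_closure h t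

lemma cyl_mem_closure {q : E2} (hq : q ∈ closedSection Ω) (t : ℝ) : cyl (t, q) ∈ closure Ω :=
  (hΩ.cyl_mem_closure_iff t q).2 hq.2

lemma closure_eq_image : closure Ω = cyl '' (Icc (-Real.pi) Real.pi ×ˢ closedSection Ω) := by
  refine Subset.antisymm (fun x hx => ?_) ?_
  · obtain ⟨t, ht, hx'⟩ := exists_cyl_eq x
    refine ⟨_, ⟨ht, ?_, ?_⟩, hx'⟩
    · simpa using Real.sqrt_pos.2 (hΩ.off_axis x hx)
    · rw [← hΩ.cyl_mem_closure_iff t, hx']; exact hx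
  · rintro _ ⟨⟨t, q⟩, ⟨-, hq⟩, rfl⟩
    exact hΩ.cyl_mem_closure hq t

lemma nonempty_diskChart : Nonempty (DiskChart (closedSection Ω)) :=
  hΩ.section_disk.elim fun Ψ => Ψ.nonempty_diskChart

lemma isCompact_closedSection : IsCompact (closedSection Ω) :=
  hΩ.nonempty_diskChart.elim fun c => c.isCompact

lemma uniqueDiffOn_closedSection : UniqueDiffOn ℝ (closedSection Ω) :=
  hΩ.nonempty_diskChart.elim fun c => c.uniqueDiffOn

/-- The closure is the image under `cyl` of a product of sets of unique differentiability, and `cyl`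
has surjective derivative off the axis. -/
lemma uniqueDiffOn_closure : UniqueDiffOn ℝ (closure Ω) := by
  rw [hΩ.closure_eq_image]
  refine ((uniqueDiffOn_Icc (by linarith [Real.pi_pos])).prod
    hΩ.uniqueDiffOn_closedSection).image (f' := fun z => fderiv ℝ cyl z)
    (fun z _ => (contDiff_cyl.differentiable (by simp) z).hasFDerivAt.hasFDerivWithinAt)
    fun z hz => ?_
  exact (fderiv_cyl_surjective hz.2.1.ne').denseRange

/-- Were the point in the open set `Ω`, nearby points of the half-plane would belong to the section
too, and `c.param x` would be interior to it. -/
lemma cyl_param_mem_frontier (c : DiskChart (closedSection Ω)) (t : ℝ) {x : E2} (hx : ‖x‖ = 1) :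
    cyl (t, c.param x) ∈ frontier Ω := by
  have hxd : x ∈ disk := by simp [disk, hx]
  have hq := c.param_mem x hxd
  rw [hΩ.isOpen.frontier_eq]
  refine ⟨hΩ.cyl_mem_closure hq t, fun h => c.param_notMem_interior hx ?_⟩
  rw [hΩ.cyl_mem_iff, ← cyl_zero] at h
  rw [mem_interior_iff_mem_nhds]
  have h1 : ContinuousAt (fun q : E2 => cyl (0, q)) (c.param x) :=
    (contDiff_cyl.continuous.comp (by fun_prop : Continuous fun q : E2 => ((0 : ℝ), q))).continuousAt
  have h2 : ContinuousAt (fun q : E2 => q 0) (c.param x) := by fun_prop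
  filter_upwards [h1.eventually (hΩ.isOpen.mem_nhds h), h2.eventually (lt_mem_nhds hq.1)]
    with q hq1 hq2
  rw [cyl_zero] at hq1
  exact ⟨hq2, subset_closure hq1⟩

end IsAxisymmetricToroidalDomain

/-! ### Braided fields in cylindrical coordinates -/

namespace BraidedField

variable {Ω : Set E3} (B : BraidedField Ω)

/-- A smooth extension of a braided field to the whole space. -/
noncomputable def extension : E3 → E3 := Classical.choose B.smooth

lemma contDiff_extension : ContDiff ℝ ∞ B.extension := (Classical.choose_spec B.smooth).1

lemma extension_eq (x : closure Ω) : B.extension x = B.toFun x :=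
  (Classical.choose_spec B.smooth).2 x

/-- The extensions are chosen field by field with no continuity in `B`; on `closure Ω` their
derivatives are still those of the field. -/
lemma familyOn_extension (hΩ : IsAxisymmetricToroidalDomain Ω) (k : ℕ) :
    FamilyOn (closure Ω) k fun B : BraidedField Ω => B.extension :=
  family_of_continuous_allDerivs hΩ.uniqueDiffOn_closure (φ := fun B : BraidedField Ω => B.toFun)
    (fun B x => B.extension_eq x) (fun B x _ => B.contDiff_extension.smoothNear x)
    continuous_induced_dom k

lemma sum_fderiv_extension_of_mem_closure (hΩ : IsOpen Ω) {x : E3} (hx : x ∈ closure Ω) :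
    ∑ i, fderiv ℝ B.extension x (EuclideanSpace.single i 1) i = 0 := by
  have hc : Continuous fun x => ∑ i, fderiv ℝ B.extension x (EuclideanSpace.single i 1) i := by
    have := B.contDiff_extension.continuous_fderiv (by simp)
    fun_prop
  refine closure_minimal (s := Ω)
    (t := {x | ∑ i, fderiv ℝ B.extension x (EuclideanSpace.single i 1) i = 0}) (fun y hy => ?_)
    (isClosed_eq hc continuous_const) hx
  have h : extendByZero B.toFun =ᶠ[𝓝 y] B.extension := by
    filter_upwards [hΩ.mem_nhds hy] with z hz
    have hz' := subset_closure hz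
    exact (Subtype.val_injective.extend_apply B.toFun 0 ⟨z, hz'⟩).trans
      (B.extension_eq ⟨z, hz'⟩).symm
  have := B.div_eq_zero y hy
  rwa [h.fderiv_eq] at this

/-- A Cartesian component, as a function of the cylindrical coordinates. -/
noncomputable def component (i : Fin 3) (z : ℝ × E2) : ℝ := B.extension (cyl z) i

/-- The radial component. -/
noncomputable def radial (z : ℝ × E2) : ℝ :=
  Real.cos z.1 * B.component 0 z + Real.sin z.1 * B.component 1 z

/-- The component along the unit vector in the direction of `∂_θ`. -/
noncomputable def azimuthal (z : ℝ × E2) : ℝ :=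
  Real.cos z.1 * B.component 1 z - Real.sin z.1 * B.component 0 z

/-- The meridional part of the field, times `r`. -/
noncomputable def flux (z : ℝ × E2) : E2 :=
  (z.2 0 * B.radial z) • planeBasis 0 + (z.2 0 * B.component 2 z) • planeBasis 1

/-- The vector field on the section whose flow, with time `θ`, follows the trajectories. -/
noncomputable def sectionField (z : ℝ × E2) : E2 := (B.azimuthal z)⁻¹ • B.flux z

lemma contDiff_component (i : Fin 3) : ContDiff ℝ ∞ (B.component i) := by
  have h : ContDiff ℝ ∞ fun z => B.extension (cyl z) := B.contDiff_extension.comp contDiff_cyl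
  exact contDiff_euclidean.1 h i

lemma contDiff_coordinate (i : Fin 2) : ContDiff ℝ ∞ fun z : ℝ × E2 => z.2 i :=
  contDiff_euclidean.1 contDiff_snd i

lemma contDiff_cos_fst : ContDiff ℝ ∞ fun z : ℝ × E2 => Real.cos z.1 :=
  Real.contDiff_cos.comp contDiff_fst

lemma contDiff_sin_fst : ContDiff ℝ ∞ fun z : ℝ × E2 => Real.sin z.1 :=
  Real.contDiff_sin.comp contDiff_fst

lemma contDiff_radial : ContDiff ℝ ∞ B.radial :=
  (contDiff_cos_fst.mul (B.contDiff_component 0)).add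
    (contDiff_sin_fst.mul (B.contDiff_component 1))

lemma contDiff_azimuthal : ContDiff ℝ ∞ B.azimuthal :=
  (contDiff_cos_fst.mul (B.contDiff_component 1)).sub
    (contDiff_sin_fst.mul (B.contDiff_component 0))

lemma contDiff_flux : ContDiff ℝ ∞ B.flux :=
  (((contDiff_coordinate 0).mul B.contDiff_radial).smul contDiff_const).add
    (((contDiff_coordinate 0).mul (B.contDiff_component 2)).smul contDiff_const)

lemma azimuthal_two_pi (q : E2) : B.azimuthal (2 * Real.pi, q) = B.azimuthal (0, q) := by
  simp [azimuthal, component, cyl_zero, cyl_two_pi]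

lemma azimuthal_eq_swirl (hΩ : IsAxisymmetricToroidalDomain Ω) {q : E2}
    (hq : q ∈ closedSection Ω) (t : ℝ) : B.azimuthal (t, q) =
      swirl (cyl (t, q)) (B.toFun ⟨cyl (t, q), hΩ.cyl_mem_closure hq t⟩) * q 0 := by
  have hq0 := hq.1.ne'
  rw [← B.extension_eq, swirl, azimuthal, component, component]
  simp only [cyl_apply_zero, cyl_apply_one]
  have h : (q 0 * Real.cos t) ^ 2 + (q 0 * Real.sin t) ^ 2 = q 0 ^ 2 := by
    linear_combination q 0 ^ 2 * Real.sin_sq_add_cos_sq t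
  rw [h]
  field_simp

lemma azimuthal_pos (hΩ : IsAxisymmetricToroidalDomain Ω) {q : E2}
    (hq : q ∈ closedSection Ω) (t : ℝ) : 0 < B.azimuthal (t, q) := by
  rw [B.azimuthal_eq_swirl hΩ hq]
  exact mul_pos (B.swirl_pos ⟨cyl (t, q), _⟩) hq.1

lemma smoothNear_sectionField (hΩ : IsAxisymmetricToroidalDomain Ω) {q : E2}
    (hq : q ∈ closedSection Ω) (t : ℝ) : SmoothNear B.sectionField (t, q) :=
  (B.contDiff_azimuthal.smoothNear _).inv_smul (B.contDiff_flux.smoothNear _)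
    (B.azimuthal_pos hΩ hq t).ne'

lemma flux_apply_zero (z : ℝ × E2) : B.flux z 0 = z.2 0 * B.radial z := by simp [flux]

lemma flux_apply_one (z : ℝ × E2) : B.flux z 1 = z.2 0 * B.component 2 z := by simp [flux]

/-- A curve that solves the equation of `sectionField` in the time θ has spatial velocity
proportional to the field. The factor `q 0 / B.azimuthal (t, q)` is 1/B^θ on the section. -/
lemma fderiv_cyl_sectionField {t : ℝ} {q : E2} (h : B.azimuthal (t, q) ≠ 0) :
    fderiv ℝ cyl (t, q) (1, B.sectionField (t, q)) =
      (q 0 / B.azimuthal (t, q)) • B.extension (cyl (t, q)) := by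
  have ht := Real.sin_sq_add_cos_sq t
  have h0 : B.radial (t, q) * Real.cos t - B.azimuthal (t, q) * Real.sin t =
      B.component 0 (t, q) := by
    simp only [radial, azimuthal]; linear_combination B.component 0 (t, q) * ht
  have h1 : B.radial (t, q) * Real.sin t + B.azimuthal (t, q) * Real.cos t =
      B.component 1 (t, q) := by
    simp only [radial, azimuthal]; linear_combination B.component 1 (t, q) * ht
  rw [fderiv_cyl_apply]
  ext i
  fin_cases i
  · simp only [Fin.zero_eta, sectionField, PiLp.smul_apply, flux_apply_zero, smul_eq_mul]
    change _ = _ * B.component 0 (t, q)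
    rw [← h0]; simp; field_simp
  · simp only [Fin.mk_one, sectionField, PiLp.smul_apply, flux_apply_zero, smul_eq_mul]
    change _ = _ * B.component 1 (t, q)
    rw [← h1]; simp; field_simp
  · simp only [Fin.reduceFinMk, sectionField, PiLp.smul_apply, flux_apply_one, smul_eq_mul]
    change _ = _ * B.component 2 (t, q)
    simp; field_simp

lemma planeTrace_fderiv_eq {F : E2 → E2} {q : E2} (hF : DifferentiableAt ℝ F q) {d : Fin 2 → ℝ}
    (h : ∀ i, HasDerivAt (fun s : ℝ => F (q + s • planeBasis i) i) (d i) 0) :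
    planeTrace (fderiv ℝ F q) = d 0 + d 1 := by
  have h1 : ∀ i, fderiv ℝ F q (planeBasis i) i = d i := fun i => by
    have h2 : HasDerivAt (fun s : ℝ => q + s • planeBasis i) (planeBasis i) 0 := by
      simpa using ((hasDerivAt_id (0 : ℝ)).smul_const (planeBasis i)).const_add q
    have h3 : HasFDerivAt F (fderiv ℝ F q) (q + (0 : ℝ) • planeBasis i) := by
      simpa using hF.hasFDerivAt
    have h4 : HasDerivAt (fun s : ℝ => F (q + s • planeBasis i))
        (fderiv ℝ F q (planeBasis i)) 0 :=
      HasFDerivAt.comp_hasDerivAt (f := fun s : ℝ => q + s • planeBasis i) 0 h3 h2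
    exact ((EuclideanSpace.proj i : E2 →L[ℝ] ℝ).hasFDerivAt.comp_hasDerivAt 0 h4).unique (h i)
  rw [planeTrace, h1, h1]

lemma hasDerivAt_component (i : Fin 3) (t : ℝ) (q : E2) (a : ℝ) (v : E2) :
    HasDerivAt (fun s : ℝ => B.component i (t + s * a, q + s • v))
      (fderiv ℝ B.extension (cyl (t, q)) (fderiv ℝ cyl (t, q) (a, v)) i) 0 := by
  have h0 : HasDerivAt (fun s : ℝ => (t + s * a, q + s • v)) (a, v) 0 := by
    have h1 : HasDerivAt (fun s : ℝ => t + s * a) a 0 := by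
      simpa using ((hasDerivAt_id (0 : ℝ)).mul_const a).const_add t
    have h2 : HasDerivAt (fun s : ℝ => q + s • v) v 0 := by
      simpa using ((hasDerivAt_id (0 : ℝ)).smul_const v).const_add q
    exact h1.prodMk h2
  have h1 : HasFDerivAt (fun z => B.extension (cyl z))
      ((fderiv ℝ B.extension (cyl (t, q))).comp (fderiv ℝ cyl (t, q)))
      (t + 0 * a, q + (0 : ℝ) • v) := by
    rw [zero_mul, zero_smul, add_zero, add_zero]
    exact HasFDerivAt.comp (g := B.extension) (t, q)
      (B.contDiff_extension.differentiable (by simp) _).hasFDerivAt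
      (contDiff_cyl.differentiable (by simp) _).hasFDerivAt
  have h2 := HasFDerivAt.comp_hasDerivAt (f := fun s : ℝ => (t + s * a, q + s • v)) 0 h1 h0
  exact (EuclideanSpace.proj i : E3 →L[ℝ] ℝ).hasFDerivAt.comp_hasDerivAt 0 h2

lemma space_apply_apply (A : E3 →L[ℝ] E3) (a b c : ℝ) (i : Fin 3) : A !₂[a, b, c] i =
    a * A (EuclideanSpace.single 0 1) i + b * A (EuclideanSpace.single 1 1) i +
      c * A (EuclideanSpace.single 2 1) i := by
  have h : (!₂[a, b, c] : E3) = a • EuclideanSpace.single 0 1 + b • EuclideanSpace.single 1 1 +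
      c • EuclideanSpace.single 2 1 := by
    ext j; fin_cases j <;> simp
  rw [h]
  simp only [map_add, map_smul, PiLp.add_apply, PiLp.smul_apply, smul_eq_mul]

/-- The continuity equation for the density `r B^θ` on the section. -/
lemma fderiv_azimuthal_add_planeTrace (hΩ : IsAxisymmetricToroidalDomain Ω) {q : E2}
    (hq : q ∈ closedSection Ω) (t : ℝ) : fderiv ℝ B.azimuthal (t, q) (1, 0) +
      planeTrace (fderiv ℝ (fun y => B.flux (t, y)) q) = 0 := by
  have hdiv := B.sum_fderiv_extension_of_mem_closure hΩ.isOpen (hΩ.cyl_mem_closure hq t)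
  rw [Fin.sum_univ_three] at hdiv
  set A := fderiv ℝ B.extension (cyl (t, q)) with hA
  have hts := Real.sin_sq_add_cos_sq t
  have h1 : HasDerivAt (fun s : ℝ => B.azimuthal (t + s * 1, q + s • (0 : E2)))
      (fderiv ℝ B.azimuthal (t, q) (1, 0)) 0 := by
    have hz : HasDerivAt (fun s : ℝ => (t + s * 1, q + s • (0 : E2))) (1, 0) 0 := by
      have h1 : HasDerivAt (fun s : ℝ => t + s * 1) 1 0 := by
        simpa using (hasDerivAt_id (0 : ℝ)).const_add t
      have h2 : HasDerivAt (fun s : ℝ => q + s • (0 : E2)) 0 0 := by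
        simpa using hasDerivAt_const (0 : ℝ) q
      exact h1.prodMk h2
    have h : HasFDerivAt B.azimuthal (fderiv ℝ B.azimuthal (t, q))
        (t + 0 * 1, q + (0 : ℝ) • (0 : E2)) := by
      rw [zero_mul, zero_smul, add_zero, add_zero]
      exact (B.contDiff_azimuthal.differentiable (by simp) _).hasFDerivAt
    exact HasFDerivAt.comp_hasDerivAt (f := fun s : ℝ => (t + s * 1, q + s • (0 : E2))) 0 h hz
  have hlin : HasDerivAt (fun s : ℝ => t + s * 1) 1 0 := by
    simpa using (hasDerivAt_id (0 : ℝ)).const_add t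
  have h1' := (hlin.cos.fun_mul (B.hasDerivAt_component 1 t q 1 0)).fun_sub
    (hlin.sin.fun_mul (B.hasDerivAt_component 0 t q 1 0))
  have e1 := h1.unique h1'
  have hq0 : HasDerivAt (fun s : ℝ => q 0 + s) 1 0 := (hasDerivAt_id' (0 : ℝ)).const_add (q 0)
  have hr : HasDerivAt (fun s : ℝ => B.radial (t, q + s • planeBasis 0))
      (Real.cos t * A (fderiv ℝ cyl (t, q) (0, planeBasis 0)) 0 +
        Real.sin t * A (fderiv ℝ cyl (t, q) (0, planeBasis 0)) 1) 0 := by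
    have := ((B.hasDerivAt_component 0 t q 0 (planeBasis 0)).const_mul (Real.cos t)).fun_add
      ((B.hasDerivAt_component 1 t q 0 (planeBasis 0)).const_mul (Real.sin t))
    simp only [mul_zero, add_zero] at this
    exact this
  have hv : HasDerivAt (fun s : ℝ => B.component 2 (t, q + s • planeBasis 1))
      (A (fderiv ℝ cyl (t, q) (0, planeBasis 1)) 2) 0 := by
    have := B.hasDerivAt_component 2 t q 0 (planeBasis 1)
    simpa only [mul_zero, add_zero] using this
  have h2 := planeTrace_fderiv_eq (F := fun y => B.flux (t, y)) (q := q)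
    (d := ![1 * B.radial (t, q) + q 0 * (Real.cos t * A (fderiv ℝ cyl (t, q) (0, planeBasis 0)) 0 +
        Real.sin t * A (fderiv ℝ cyl (t, q) (0, planeBasis 0)) 1),
      q 0 * A (fderiv ℝ cyl (t, q) (0, planeBasis 1)) 2])
    ((B.contDiff_flux.comp (by fun_prop : ContDiff ℝ ∞ fun y : E2 => (t, y))).differentiable
      (by simp) q) (fun i => by
      fin_cases i
      · simp only [Fin.zero_eta, flux_apply_zero, PiLp.add_apply, PiLp.smul_apply, smul_eq_mul]
        have := hq0.fun_mul hr
        simpa using this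
      · simp only [Fin.mk_one, flux_apply_one, PiLp.add_apply, PiLp.smul_apply, smul_eq_mul]
        have := hv.const_mul (q 0)
        simpa using this)
  rw [e1, h2]
  simp only [fderiv_cyl_apply, space_apply_apply, Matrix.cons_val_zero, Matrix.cons_val_one, radial]
  simp
  -- The sum is r div B written in the rotating frame; `hts` expresses the invariance of the trace
  -- of the horizontal block under rotation.
  linear_combination (q 0) * hdiv + q 0 *
    (A (EuclideanSpace.single 0 1) 0 + A (EuclideanSpace.single 1 1) 1) * hts

end BraidedField

/-! ### The field on the disk -/

/-- If `x` is on the unit circle and the nonzero functional `ℓ` is the derivative at `x` of a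
function with a maximum over the disk at `x`, the kernel of `ℓ` is tangent to the circle. -/
lemma inner_eq_zero_of_isLocalMaxOn {h : E2 → ℝ} {ℓ : E2 →L[ℝ] ℝ} {x w : E2} (hx : ‖x‖ = 1)
    (hmax : IsLocalMaxOn h disk x) (hℓ : HasFDerivAt h ℓ x) (h0 : ℓ ≠ 0) (hw : ℓ w = 0) :
    inner ℝ w x = 0 := by
  -- Vectors with negative inner product with `x` point into the disk. Letting them approach the
  -- tangent line gives the inequality there for `y` and `-y`, so `ℓ` vanishes on that line.
  have hneg : ∀ y : E2, inner ℝ y x < 0 → ℓ y ≤ 0 := by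
    intro y hy
    refine hmax.hasFDerivWithinAt_nonpos hℓ.hasFDerivWithinAt
      (mem_posTangentConeAt_of_frequently_mem (Filter.Eventually.frequently ?_))
    have hc : Filter.Tendsto (fun t : ℝ => 2 * inner ℝ y x + t * ‖y‖ ^ 2) (𝓝[>] 0)
        (𝓝 (2 * inner ℝ y x + 0 * ‖y‖ ^ 2)) :=
      ((by fun_prop : Continuous fun t : ℝ => 2 * inner ℝ y x + t * ‖y‖ ^ 2).tendsto 0).mono_left
        nhdsWithin_le_nhds
    filter_upwards [hc.eventually (gt_mem_nhds (by linarith : 2 * inner ℝ y x + 0 * ‖y‖ ^ 2 < 0)),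
      self_mem_nhdsWithin] with t ht ht0
    have ht0' : 0 < t := ht0
    rw [mem_closedBall_zero_iff, ← abs_norm, ← sq_le_one_iff_abs_le_one, norm_add_sq_real, hx,
      inner_smul_right, real_inner_comm, norm_smul, mul_pow, Real.norm_eq_abs, sq_abs]
    nlinarith
  have hker : ∀ y : E2, inner ℝ y x = 0 → ℓ y ≤ 0 := by
    intro y hy
    have hc : Filter.Tendsto (fun t : ℝ => ℓ (y - t • x)) (𝓝[>] 0) (𝓝 (ℓ (y - (0 : ℝ) • x))) :=
      ((by fun_prop : Continuous fun t : ℝ => ℓ (y - t • x)).tendsto 0).mono_left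
        nhdsWithin_le_nhds
    rw [zero_smul, sub_zero] at hc
    refine le_of_tendsto hc ?_
    filter_upwards [self_mem_nhdsWithin] with t ht
    have ht' : 0 < t := ht
    refine hneg _ ?_
    rw [inner_sub_left, hy, inner_smul_left, real_inner_self_eq_norm_sq, hx]
    simpa using ht'
  have hker' : ∀ y : E2, inner ℝ y x = 0 → ℓ y = 0 := fun y hy =>
    le_antisymm (hker y hy) (by simpa using hker (-y) (by simpa using hy))
  -- A transversal `w` and the tangent line span the plane, and `ℓ` would vanish on both.
  by_contra hne
  refine h0 (ContinuousLinearMap.ext fun y => ?_)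
  have h1 := hker' (y - (inner ℝ y x / inner ℝ w x) • w) (by
    rw [inner_sub_left, inner_smul_left]; simp; field_simp; simp)
  simpa [hw] using h1

namespace BraidedField

variable {Ω : Set E3} (hΩ : IsAxisymmetricToroidalDomain Ω) (B : BraidedField Ω)
  (c : DiskChart (closedSection Ω))

lemma fderiv_eq_zero_of_isLocalDefiningFunction {x : closure Ω} (hx : (x : E3) ∈ frontier Ω)
    {ρ : E3 → ℝ} (hρ : IsLocalDefiningFunction Ω x ρ) : fderiv ℝ ρ x (B.toFun x) = 0 := by
  have h := B.tangent x hx _ ⟨ρ, hρ, rfl⟩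
  rw [inner_smul_right, mul_eq_zero, inv_eq_zero, norm_eq_zero] at h
  have hd : DifferentiableAt ℝ ρ x := hρ.1.differentiableAt (by simp)
  have h1 := h.resolve_left hρ.2.1
  rw [real_inner_comm] at h1
  rwa [gradient, InnerProductSpace.toDual_symm_apply] at h1

/-- The vector field `sectionField` in the coordinates of the disk. -/
noncomputable def diskField (z : ℝ × E2) : E2 :=
  fderiv ℝ c.coord (c.param z.2) (B.sectionField (z.1, c.param z.2))

include hΩ

lemma smoothNear_diskField (t : ℝ) {x : E2} (hx : x ∈ disk) :
    SmoothNear (B.diskField c) (t, x) := by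
  have h1 : ContDiff ℝ ∞ (fderiv ℝ c.coord) := c.contDiff_coord.fderiv_right (by simp)
  have h2 : ContDiff ℝ ∞ fun z : ℝ × E2 => fderiv ℝ c.coord (c.param z.2) :=
    h1.comp (c.contDiff_param.comp contDiff_snd)
  have h3 : ContDiff ℝ ∞ fun z : ℝ × E2 => (z.1, c.param z.2) :=
    contDiff_fst.prodMk (c.contDiff_param.comp contDiff_snd)
  have h4 : SmoothNear (fun z : ℝ × E2 => B.sectionField (z.1, c.param z.2)) (t, x) :=
    SmoothNear.comp (g := B.sectionField) (f := fun z : ℝ × E2 => (z.1, c.param z.2))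
      (B.smoothNear_sectionField hΩ (c.param_mem x hx) t) (h3.smoothNear _)
  filter_upwards [h4] with z hz using h2.contDiffAt.clm_apply hz

omit hΩ in
lemma fderiv_param_diskField (t : ℝ) {x : E2} (hx : x ∈ disk) :
    fderiv ℝ c.param x (B.diskField c (t, x)) = B.sectionField (t, c.param x) :=
  c.fderiv_param_apply hx _

/-- A defining function of `Ω`, pulled back to the disk, is nonpositive near `x` and zero at `x`, so
it has a maximum there. Its derivative is not zero: the defining function is constant along
rotations of a boundary point, so its nonzero gradient is detected within the half-plane. This
derivative annihilates the field because B is tangent to the boundary. -/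
lemma inner_diskField (t : ℝ) {x : E2} (hx : ‖x‖ = 1) :
    inner ℝ (B.diskField c (t, x)) x = 0 := by
  have hxd : x ∈ disk := by simp [disk, hx]
  have hq := c.param_mem x hxd
  have haz := (B.azimuthal_pos hΩ hq t).ne'
  have hfr : ∀ s, cyl (s, c.param x) ∈ frontier Ω := fun s => hΩ.cyl_param_mem_frontier c s hx
  obtain ⟨ρ, -, hρ⟩ := hΩ.analytic_boundary _ (hfr t)
  have hρd : HasFDerivAt ρ (fderiv ℝ ρ (cyl (t, c.param x))) (cyl (t, c.param x)) :=
    (hρ.1.differentiableAt (by simp)).hasFDerivAt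
  have hρc : ∀ᶠ y in 𝓝 (cyl (t, c.param x)), ContinuousAt ρ y := by
    have h1 : ContDiffAt ℝ 1 ρ (cyl (t, c.param x)) := hρ.1.of_le (by simp)
    exact (h1.eventually (by simp)).mono fun y hy => hy.continuousAt
  have hiff := hρ.2.2.eventually_nhds
  have hle : ∀ᶠ y in 𝓝 (cyl (t, c.param x)), y ∈ closure Ω → ρ y ≤ 0 := by
    filter_upwards [hρc, hiff] with y hy1 hy2 hy
    by_contra! hpos
    have h1 := hy1.eventually (lt_mem_nhds hpos)
    obtain ⟨z, ⟨hz1, hz2⟩, hz3⟩ := mem_closure_iff_nhds.1 hy _ (h1.and hy2)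
    exact absurd (hz2.1 hz3) (not_lt.2 hz1.le)
  have hzero : ∀ᶠ y in 𝓝 (cyl (t, c.param x)), y ∈ frontier Ω → ρ y = 0 := by
    filter_upwards [hle, hρ.2.2] with y hy1 hy2 hy
    rw [hΩ.isOpen.frontier_eq] at hy
    exact le_antisymm (hy1 hy.1) (not_lt.1 fun h => hy.2 (hy2.2 h))
  have hcyl : HasFDerivAt cyl (fderiv ℝ cyl (t, c.param x)) (t, c.param x) :=
    (contDiff_cyl.differentiable (by simp) _).hasFDerivAt
  have hρcyl : HasFDerivAt (fun z => ρ (cyl z))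
      ((fderiv ℝ ρ (cyl (t, c.param x))).comp (fderiv ℝ cyl (t, c.param x))) (t, c.param x) :=
    HasFDerivAt.comp (g := ρ) _ hρd hcyl
  have hrot : fderiv ℝ ρ (cyl (t, c.param x)) (fderiv ℝ cyl (t, c.param x) (1, 0)) = 0 := by
    have h1 : HasDerivAt (fun s : ℝ => ρ (cyl (s, c.param x)))
        (fderiv ℝ ρ (cyl (t, c.param x)) (fderiv ℝ cyl (t, c.param x) (1, 0))) t :=
      HasFDerivAt.comp_hasDerivAt (l := fun z => ρ (cyl z)) (f := fun s : ℝ => (s, c.param x)) t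
        hρcyl ((hasDerivAt_id t).prodMk (hasDerivAt_const t (c.param x)))
    have hcont : ContinuousAt (fun s : ℝ => cyl (s, c.param x)) t :=
      (contDiff_cyl.continuous.comp
        (by fun_prop : Continuous fun s : ℝ => (s, c.param x))).continuousAt
    have h2 : (fun s : ℝ => ρ (cyl (s, c.param x))) =ᶠ[𝓝 t] fun _ => 0 := by
      filter_upwards [hcont.eventually hzero] with s hs using hs (hfr s)
    exact h1.unique ((hasDerivAt_const t (0 : ℝ)).congr_of_eventuallyEq h2)
  have hin : HasFDerivAt (fun y => (t, c.param y))
      ((0 : E2 →L[ℝ] ℝ).prod (fderiv ℝ c.param x)) x :=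
    (hasFDerivAt_const t x).prodMk (c.hasFDerivAt_param x)
  have hh : HasFDerivAt (fun y => ρ (cyl (t, c.param y)))
      (((fderiv ℝ ρ (cyl (t, c.param x))).comp (fderiv ℝ cyl (t, c.param x))).comp
        ((0 : E2 →L[ℝ] ℝ).prod (fderiv ℝ c.param x))) x :=
    HasFDerivAt.comp (g := fun z => ρ (cyl z)) (f := fun y => (t, c.param y)) x hρcyl hin
  refine inner_eq_zero_of_isLocalMaxOn hx ?_ hh ?_ ?_
  · have hcont : ContinuousAt (fun y : E2 => cyl (t, c.param y)) x :=
      (contDiff_cyl.continuous.comp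
        (continuous_const.prodMk c.contDiff_param.continuous)).continuousAt
    have h0 : ρ (cyl (t, c.param x)) = 0 := hzero.self_of_nhds (hfr t)
    filter_upwards [nhdsWithin_le_nhds (hcont.eventually hle), self_mem_nhdsWithin] with y hy hyd
    change ρ (cyl (t, c.param y)) ≤ ρ (cyl (t, c.param x))
    rw [h0]
    exact hy (hΩ.cyl_mem_closure (c.param_mem y hyd) t)
  · intro hcon
    apply hρ.2.1
    have h1 : ∀ v : E2, fderiv ℝ ρ (cyl (t, c.param x))
        (fderiv ℝ cyl (t, c.param x) (0, v)) = 0 := fun v => by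
      have h2 := DFunLike.congr_fun hcon (fderiv ℝ c.coord (c.param x) v)
      simpa [c.fderiv_param_apply hxd v] using h2
    have h2 : fderiv ℝ ρ (cyl (t, c.param x)) = 0 := by
      ext v
      obtain ⟨⟨a, w⟩, rfl⟩ := fderiv_cyl_surjective (t := t) hq.1.ne' v
      have h3 : ((a, w) : ℝ × E2) = a • (1, 0) + (0, w) := by simp
      rw [h3, map_add, map_add, map_smul, map_smul, hrot, h1]
      simp
    rw [gradient, h2, map_zero]
  · change fderiv ℝ ρ (cyl (t, c.param x)) (fderiv ℝ cyl (t, c.param x)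
      (0, fderiv ℝ c.param x (B.diskField c (t, x)))) = 0
    rw [B.fderiv_param_diskField c t hxd]
    -- `cyl` sends the first vector on the right to a multiple of B and the second to the generator
    -- of rotations; both are tangent to the boundary.
    have h1 : ((0, B.sectionField (t, c.param x)) : ℝ × E2) =
        (1, B.sectionField (t, c.param x)) - (1, 0) := by simp
    have h2 : fderiv ℝ ρ (cyl (t, c.param x)) (B.extension (cyl (t, c.param x))) = 0 := by
      have := B.fderiv_eq_zero_of_isLocalDefiningFunction
        (x := ⟨cyl (t, c.param x), hΩ.cyl_mem_closure hq t⟩) (hfr t) hρ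
      rwa [← B.extension_eq] at this
    rw [h1, map_sub, map_sub, hrot, B.fderiv_cyl_sectionField haz, map_smul, h2]
    simp

/-! ### Joint dependence on the field and the angle -/

section Families

variable {P : Type} [TopologicalSpace P] {β : P → BraidedField Ω} {τ : P → ℝ}

lemma familyOn_component (hβ : Continuous β) (hτ : Continuous τ) (i : Fin 3) (k : ℕ) :
    FamilyOn (closedSection Ω) k fun p q => (β p).component i (τ p, q) := by
  have h1 : FamilyOn (closure Ω) k fun p => (β p).extension :=
    (familyOn_extension hΩ k).reparam hβ
  have h2 : FamilyOn (closedSection Ω) k fun p q => cyl (τ p, q) :=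
    (FamilyOn.of_joint contDiff_cyl (closedSection Ω) k).reparam hτ
  have h3 : FamilyOn (closedSection Ω) k fun p q => (β p).extension (cyl (τ p, q)) :=
    FamilyOn.comp h1 h2 fun p q hq => hΩ.cyl_mem_closure hq _
  exact h3.clm (EuclideanSpace.proj i : E3 →L[ℝ] ℝ)

omit hΩ in
lemma familyOn_coordinate (i : Fin 2) (K : Set E2) (k : ℕ) :
    FamilyOn K k fun (_ : P) (q : E2) => q i :=
  FamilyOn.of_smoothNear (f := fun q : E2 => q i)
    (fun q _ => (contDiff_euclidean.1 contDiff_id i : ContDiff ℝ ∞ fun q : E2 => q i).smoothNear q) k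

lemma familyOn_azimuthal (hβ : Continuous β) (hτ : Continuous τ) (k : ℕ) :
    FamilyOn (closedSection Ω) k fun p q => (β p).azimuthal (τ p, q) :=
  ((FamilyOn.of_continuous (Real.continuous_cos.comp hτ) k).mul
    (familyOn_component hΩ hβ hτ 1 k)).sub
    ((FamilyOn.of_continuous (Real.continuous_sin.comp hτ) k).mul
      (familyOn_component hΩ hβ hτ 0 k))

lemma familyOn_radial (hβ : Continuous β) (hτ : Continuous τ) (k : ℕ) :
    FamilyOn (closedSection Ω) k fun p q => (β p).radial (τ p, q) :=
  ((FamilyOn.of_continuous (Real.continuous_cos.comp hτ) k).mul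
    (familyOn_component hΩ hβ hτ 0 k)).add
    ((FamilyOn.of_continuous (Real.continuous_sin.comp hτ) k).mul
      (familyOn_component hΩ hβ hτ 1 k))

lemma familyOn_flux (hβ : Continuous β) (hτ : Continuous τ) (k : ℕ) :
    FamilyOn (closedSection Ω) k fun p q => (β p).flux (τ p, q) :=
  (((familyOn_coordinate 0 _ k).mul (familyOn_radial hΩ hβ hτ k)).smul
    (FamilyOn.of_continuous continuous_const k)).add
    (((familyOn_coordinate 0 _ k).mul (familyOn_component hΩ hβ hτ 2 k)).smul
      (FamilyOn.of_continuous continuous_const k))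

lemma familyOn_sectionField (hβ : Continuous β) (hτ : Continuous τ) (k : ℕ) :
    FamilyOn (closedSection Ω) k fun p q => (β p).sectionField (τ p, q) :=
  ((familyOn_azimuthal hΩ hβ hτ k).inv fun p _ hq => ((β p).azimuthal_pos hΩ hq (τ p)).ne').smul
    (familyOn_flux hΩ hβ hτ k)

omit hΩ in
lemma familyOn_param (k : ℕ) : FamilyOn disk k fun (_ : P) => c.param :=
  FamilyOn.of_smoothNear (fun x _ => c.contDiff_param.smoothNear x) k

lemma familyOn_diskField (hβ : Continuous β) (hτ : Continuous τ) (k : ℕ) :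
    FamilyOn disk k fun p x => (β p).diskField c (τ p, x) := by
  have h1 : FamilyOn disk k fun p x => (β p).sectionField (τ p, c.param x) :=
    FamilyOn.comp (g := fun p q => (β p).sectionField (τ p, q)) (f := fun _ => c.param)
      (familyOn_sectionField hΩ hβ hτ k) (familyOn_param c k)
      fun _ x hx => c.param_mem x hx
  have h2 : ContDiff ℝ ∞ (fderiv ℝ c.coord) := c.contDiff_coord.fderiv_right (by simp)
  have h3 : ContDiff ℝ ∞ fun x => fderiv ℝ c.coord (c.param x) := h2.comp c.contDiff_param
  have h4 : FamilyOn disk k fun (_ : P) x => fderiv ℝ c.coord (c.param x) :=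
    FamilyOn.of_smoothNear (fun x _ => h3.smoothNear x) k
  exact FamilyOn.bilin (ContinuousLinearMap.id ℝ (E2 →L[ℝ] E2)) h4 h1

end Families

end BraidedField

/-! ### First returns -/

/-- A function of time with positive derivative `σ (Θ t)⁻¹`. -/
lemma exists_time_change {T : ℝ} (hT : 0 < T) {σ : ℝ → ℝ} (hσ : ContinuousOn σ (Icc 0 T))
    (hpos : ∀ θ ∈ Icc 0 T, 0 < σ θ) : ∃ τ, 0 < τ ∧ ∃ Θ : ℝ → ℝ, Θ 0 = 0 ∧ Θ τ = T ∧
      (∀ t ∈ Icc 0 τ, Θ t ∈ Icc 0 T ∧ HasDerivAt Θ (σ (Θ t))⁻¹ t) ∧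
      ∀ t ∈ Ioo 0 τ, Θ t ∈ Ioo 0 T := by
  -- The extension by constants stays above the positive minimum of `σ`, so its primitive `S`, the
  -- elapsed time as a function of the angle, is an increasing bijection of the line. Its inverse is
  -- the required `Θ`.
  let σ' : ℝ → ℝ := IccExtend hT.le (domRestrict (Icc 0 T) σ)
  have hσ'c : Continuous σ' := (continuousOn_iff_continuous_domRestrict.1 hσ).Icc_extend'
  have hσ'eq : ∀ θ ∈ Icc 0 T, σ' θ = σ θ := fun θ hθ => IccExtend_of_mem _ _ hθ
  obtain ⟨θ₀, hθ₀, hmin⟩ := isCompact_Icc.exists_isMinOn (nonempty_Icc.2 hT.le) hσ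
  have hm : ∀ θ, σ θ₀ ≤ σ' θ := fun θ => hmin (projIcc 0 T hT.le θ).2
  have hm0 : 0 < σ θ₀ := hpos θ₀ hθ₀
  let S : ℝ → ℝ := fun θ => ∫ u in (0 : ℝ)..θ, σ' u
  have hS : ∀ θ, HasDerivAt S (σ' θ) θ := fun θ =>
    intervalIntegral.integral_hasDerivAt_right (hσ'c.intervalIntegrable _ _)
      hσ'c.aestronglyMeasurable.stronglyMeasurableAtFilter hσ'c.continuousAt
  have hS0 : S 0 = 0 := intervalIntegral.integral_same
  have hmono : StrictMono S := strictMono_of_deriv_pos fun θ => by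
    rw [(hS θ).deriv]; exact hm0.trans_le (hm θ)
  have hcont : Continuous S := continuous_iff_continuousAt.2 fun θ => (hS θ).continuousAt
  have hmono' : Monotone fun θ => S θ - σ θ₀ * θ := by
    have hd : ∀ θ, HasDerivAt (fun θ => S θ - σ θ₀ * θ) (σ' θ - σ θ₀ * 1) θ := fun θ =>
      (hS θ).fun_sub ((hasDerivAt_id' θ).const_mul _)
    refine monotone_of_deriv_nonneg (fun θ => (hd θ).differentiableAt) fun θ => ?_
    rw [(hd θ).deriv]; linarith [hm θ]
  have hsurj : Function.Surjective S := by
    refine hcont.surjective ?_ ?_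
    · refine Filter.tendsto_atTop_mono' _ ?_ (Filter.tendsto_id.const_mul_atTop hm0)
      filter_upwards [Filter.eventually_ge_atTop 0] with θ hθ
      have := hmono' hθ
      simp only [hS0, mul_zero, sub_zero] at this
      simp only [id]; linarith
    · refine Filter.tendsto_atBot_mono' _ ?_ (Filter.tendsto_id.const_mul_atBot hm0)
      filter_upwards [Filter.eventually_le_atBot 0] with θ hθ
      have := hmono' hθ
      simp only [hS0, mul_zero, sub_zero] at this
      simp only [id]; linarith
  let e := hmono.orderIsoOfSurjective S hsurj
  have he : ∀ θ, e θ = S θ := fun θ => rfl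
  have hsymm : ∀ θ, e.symm (S θ) = θ := fun θ => by rw [← he]; exact e.symm_apply_apply θ
  have hS' : ∀ t, S (e.symm t) = t := fun t => e.apply_symm_apply t
  have hΘ0 : e.symm 0 = 0 := by
    have := hsymm 0
    rwa [hS0] at this
  refine ⟨S T, ?_, e.symm, hΘ0, hsymm T, fun t ht => ?_, fun t ht => ?_⟩
  · rw [← hS0]; exact hmono hT
  · have hmem : e.symm t ∈ Icc 0 T :=
      ⟨hΘ0.symm.le.trans (e.symm.monotone ht.1), (e.symm.monotone ht.2).trans (hsymm T).le⟩
    refine ⟨hmem, ?_⟩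
    rw [← hσ'eq _ hmem]
    exact HasDerivAt.of_local_left_inverse e.symm.continuous.continuousAt (hS _)
      (hm0.trans_le (hm _)).ne' (Filter.Eventually.of_forall hS')
  · constructor
    · have := e.symm.strictMono ht.1
      rwa [hΘ0] at this
    · have := e.symm.strictMono ht.2
      rwa [hsymm] at this

/-- Parametrized by the angle, the curve has velocity a positive multiple of the field, and
`exists_time_change` turns it into a trajectory. At intermediate times the angle lies strictly
between 0 and 2π, so the half-plane is not met earlier. -/
lemma BraidedField.isFirstReturn {Ω : Set E3} (hΩ : IsAxisymmetricToroidalDomain Ω)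
    (B : BraidedField Ω) {y : ℝ → E2}
    (hy : ∀ θ ∈ Icc 0 (2 * Real.pi), y θ ∈ closedSection Ω)
    (hder : ∀ θ ∈ Icc 0 (2 * Real.pi), HasDerivAt y (B.sectionField (θ, y θ)) θ)
    {q q' : closedSection Ω} (hq : y 0 = q) (hq' : y (2 * Real.pi) = q') :
    IsFirstReturn B q q' := by
  have hπ : 0 < 2 * Real.pi := by positivity
  have hC : ∀ θ ∈ Icc 0 (2 * Real.pi), HasDerivAt (fun s => cyl (s, y s))
      ((y θ 0 / B.azimuthal (θ, y θ)) • B.extension (cyl (θ, y θ))) θ := fun θ hθ => by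
    rw [← B.fderiv_cyl_sectionField (B.azimuthal_pos hΩ (hy θ hθ) θ).ne']
    exact HasFDerivAt.comp_hasDerivAt (l := cyl) (f := fun s => (s, y s)) θ
      (contDiff_cyl.differentiable (by simp) _).hasFDerivAt
      ((hasDerivAt_id θ).prodMk (hder θ hθ))
  have hyc : ContinuousOn y (Icc 0 (2 * Real.pi)) := fun θ hθ =>
    (hder θ hθ).continuousAt.continuousWithinAt
  have hσ : ContinuousOn (fun θ => y θ 0 / B.azimuthal (θ, y θ)) (Icc 0 (2 * Real.pi)) := by
    refine ContinuousOn.div ?_ (B.contDiff_azimuthal.continuous.comp_continuousOn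
      (continuousOn_id.prodMk hyc)) fun θ hθ => (B.azimuthal_pos hΩ (hy θ hθ) θ).ne'
    exact (by fun_prop : Continuous fun v : E2 => v 0).comp_continuousOn hyc
  have hσpos : ∀ θ ∈ Icc 0 (2 * Real.pi), 0 < y θ 0 / B.azimuthal (θ, y θ) := fun θ hθ =>
    div_pos (hy θ hθ).1 (B.azimuthal_pos hΩ (hy θ hθ) θ)
  obtain ⟨τ, hτ, Θ, hΘ0, hΘτ, hΘ, hΘ'⟩ := exists_time_change hπ hσ hσpos
  refine ⟨τ, hτ, fun t => cyl (Θ t, y (Θ t)), fun t ht => ?_, ?_, ?_, fun t ht => ?_⟩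
  · obtain ⟨h1, h2⟩ := hΘ t ht
    have hmem := hΩ.cyl_mem_closure (hy _ h1) (Θ t)
    refine ⟨hmem, ?_⟩
    have h3 := ((hC _ h1).scomp t h2).hasDerivWithinAt (s := Icc 0 τ)
    rw [smul_smul, inv_mul_cancel₀ (hσpos _ h1).ne', one_smul] at h3
    rw [← B.extension_eq]
    exact h3
  · simp only [hΘ0, hq, cyl_zero]
  · simp only [hΘτ, hq', cyl_two_pi]
  · obtain ⟨h1, h2⟩ := hΘ' t ht
    have hr := (hy (Θ t) ⟨h1.le, h2.le⟩).1
    rintro ⟨h3, h4⟩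
    simp only [cyl_apply_zero, cyl_apply_one] at h3 h4
    have hcos := pos_of_mul_pos_right h3 hr.le
    have hsin := (mul_eq_zero.1 h4).resolve_left hr.ne'
    have hcos1 : Real.cos (Θ t) = 1 := by
      have := Real.sin_sq_add_cos_sq (Θ t)
      rw [hsin] at this
      nlinarith
    have := (Real.cos_eq_one_iff_of_lt_of_lt (by linarith) h2).1 hcos1
    exact h1.ne' this

/-! ### The flow of a braided field on the disk -/

namespace BraidedField

variable {Ω : Set E3}

/-- Liouville's formula for the density `azimuthal` along the flow carried to the section by
`param`. The final density equals the initial one by periodicity in the angle. -/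
lemma det_fderiv_flow (hΩ : IsAxisymmetricToroidalDomain Ω) (B : BraidedField Ω)
    (c : DiskChart (closedSection Ω)) {φ : ℝ × E2 → E2} (hφ : ContDiff ℝ ∞ φ)
    (h0 : ∀ x, φ (0, x) = x)
    (hmem : ∀ t ∈ Icc 0 (2 * Real.pi), ∀ x ∈ disk, φ (t, x) ∈ disk)
    (hder : ∀ t ∈ Icc 0 (2 * Real.pi), ∀ x ∈ disk,
      HasDerivAt (fun s => φ (s, x)) (B.diskField c (t, φ (t, x))) t) {x : E2} (hx : x ∈ disk) :
    (fderiv ℝ c.param (φ (2 * Real.pi, x))).det * (fderiv ℝ (fun y => φ (2 * Real.pi, y)) x).det *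
      B.azimuthal (0, c.param (φ (2 * Real.pi, x))) =
      (fderiv ℝ c.param x).det * B.azimuthal (0, c.param x) := by
  have hπ : 2 * Real.pi ∈ Icc 0 (2 * Real.pi) := ⟨by positivity, le_rfl⟩
  have hφs : ContDiff ℝ ∞ fun y => φ (2 * Real.pi, y) :=
    hφ.comp (by fun_prop : ContDiff ℝ ∞ fun y : E2 => (2 * Real.pi, y))
  have hDc : Continuous fun x => (fderiv ℝ c.param x).det :=
    ContinuousLinearMap.continuous_det.comp (c.contDiff_param.continuous_fderiv (by simp))
  have hac : Continuous fun x => B.azimuthal (0, c.param x) :=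
    B.contDiff_azimuthal.continuous.comp (continuous_const.prodMk c.contDiff_param.continuous)
  have hφd : Continuous fun x => (fderiv ℝ (fun y => φ (2 * Real.pi, y)) x).det :=
    ContinuousLinearMap.continuous_det.comp (hφs.continuous_fderiv (by simp))
  refine eqOn_disk_of_eqOn_ball (((hDc.comp hφs.continuous).mul hφd).mul (hac.comp hφs.continuous))
    (hDc.mul hac) (fun x hx => ?_) hx
  have hxd : x ∈ disk := Metric.ball_subset_closedBall hx
  have hη : ContDiff ℝ ∞ fun z => c.param (φ z) := c.contDiff_param.comp hφ
  have hq : ∀ t ∈ Icc 0 (2 * Real.pi), c.param (φ (t, x)) ∈ closedSection Ω := fun t ht =>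
    c.param_mem _ (hmem t ht x hxd)
  have k1 : ∀ t ∈ Icc 0 (2 * Real.pi), ∀ᶠ y in 𝓝 x,
      HasDerivAt (fun s => c.param (φ (s, y))) (B.sectionField (t, c.param (φ (t, y)))) t := by
    intro t ht
    filter_upwards [Metric.isOpen_ball.mem_nhds hx] with y hy
    have hyd : y ∈ disk := Metric.ball_subset_closedBall hy
    rw [← B.fderiv_param_diskField c t (hmem t ht y hyd)]
    exact HasFDerivAt.comp_hasDerivAt (f := fun s => φ (s, y)) t
      (c.hasFDerivAt_param _) (hder t ht y hyd)
  have k2 : ∀ t ∈ Icc 0 (2 * Real.pi),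
      DifferentiableAt ℝ (fun y => B.sectionField (t, y)) (c.param (φ (t, x))) := by
    intro t ht
    have hd : DifferentiableAt ℝ B.sectionField (t, c.param (φ (t, x))) :=
      (B.smoothNear_sectionField hΩ (hq t ht) t).differentiableAt
    exact DifferentiableAt.comp (g := B.sectionField) (f := fun y : E2 => (t, y)) _ hd
      ((differentiableAt_const t).prodMk differentiableAt_id)
  have k3 : ∀ t ∈ Icc 0 (2 * Real.pi),
      DifferentiableAt ℝ B.azimuthal (t, c.param (φ (t, x))) :=
    fun t _ => B.contDiff_azimuthal.differentiable (by simp) _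
  have k4 : ∀ t ∈ Icc 0 (2 * Real.pi), ∀ᶠ y in 𝓝 (c.param (φ (t, x))),
      B.flux (t, y) = B.azimuthal (t, y) • B.sectionField (t, y) := by
    intro t ht
    have hc : ContinuousAt (fun y => B.azimuthal (t, y)) (c.param (φ (t, x))) :=
      (B.contDiff_azimuthal.continuous.comp
        (by fun_prop : Continuous fun y : E2 => (t, y))).continuousAt
    filter_upwards [hc.eventually_ne (B.azimuthal_pos hΩ (hq t ht) t).ne'] with y hy
    rw [sectionField, smul_smul, mul_inv_cancel₀ hy, one_smul]
  have key := det_mul_density_eq (X := B.sectionField) (G := B.flux) (ρ := B.azimuthal) hη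
    k1 k2 k3 k4 (fun t ht => B.fderiv_azimuthal_add_planeTrace hΩ (hq t ht) t) _ hπ
  have hchain : fderiv ℝ (fun y => c.param (φ (2 * Real.pi, y))) x =
      (fderiv ℝ c.param (φ (2 * Real.pi, x))).comp (fderiv ℝ (fun y => φ (2 * Real.pi, y)) x) :=
    (HasFDerivAt.comp (g := c.param) (f := fun y => φ (2 * Real.pi, y)) x (c.hasFDerivAt_param _)
      (hφs.differentiable (by simp) x).hasFDerivAt).fderiv
  rw [hchain, B.azimuthal_two_pi] at key
  simp only [h0] at key
  refine Eq.trans ?_ key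
  simp [ContinuousLinearMap.det, ContinuousLinearMap.toLinearMap_comp, LinearMap.det_comp]

end BraidedField

/-! ### Diffeomorphisms of the section and measures -/

/-- Change of variables for the injective restriction of `h` to the preimage of a measurable set.
Absolute values make the orientation irrelevant. -/
lemma measurePreserving_of_abs_det_mul {S : Set E2} (hS : MeasurableSet S) (e : S ≃ S) {h : E2 → E2}
    (hh : ContDiff ℝ ∞ h) (he : ∀ q : S, h q = e q) {α β : E2 → ℝ}
    (hdet : ∀ q ∈ S, |(fderiv ℝ h q).det| * β (h q) = α q) :
    MeasurePreserving e
      ((Measure.comap Subtype.val volume).withDensity fun q : S => ENNReal.ofReal (α q))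
      ((Measure.comap Subtype.val volume).withDensity fun q : S => ENNReal.ofReal (β q)) := by
  have hec : Continuous e := by
    refine continuous_induced_rng.2 ?_
    have : Subtype.val ∘ e = fun q : S => h q := funext fun q => (he q).symm
    rw [this]
    exact hh.continuous.comp continuous_subtype_val
  refine ⟨hec.measurable, Measure.ext fun A hA => ?_⟩
  rw [Measure.map_apply hec.measurable hA, withDensity_apply _ hA,
    withDensity_apply _ (hec.measurable hA), setLIntegral_subtype hS _ fun q => ENNReal.ofReal (α q),
    setLIntegral_subtype hS _ fun q => ENNReal.ofReal (β q)]
  have himg : Subtype.val '' A = h '' (Subtype.val '' (e ⁻¹' A)) := by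
    rw [image_image]
    simp_rw [he]
    rw [← image_image Subtype.val e, image_preimage_eq _ e.surjective]
  have hinj : InjOn h (Subtype.val '' (e ⁻¹' A)) := by
    rintro _ ⟨x, -, rfl⟩ _ ⟨y, -, rfl⟩ hxy
    rw [he, he] at hxy
    rw [e.injective (Subtype.val_injective hxy)]
  have hmeas : MeasurableSet (Subtype.val '' (e ⁻¹' A)) := hS.subtype_image (hec.measurable hA)
  rw [himg, lintegral_image_eq_lintegral_abs_det_fderiv_mul volume hmeas
    (fun q _ => ((hh.differentiable (by simp)) q).hasFDerivAt.hasFDerivWithinAt) hinj]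
  refine setLIntegral_congr_fun hmeas ?_
  rintro _ ⟨q, -, rfl⟩
  change ENNReal.ofReal (α q) = _ * _
  rw [← hdet q q.2, ENNReal.ofReal_mul (abs_nonneg _)]

namespace DiskChart

variable {S : Set E2} (c : DiskChart S)

/-- `m` and `n` restrict to mutually inverse bijections of the disk. -/
def InverseOnDisk (m n : E2 → E2) : Prop :=
  ∀ x ∈ disk, m x ∈ disk ∧ n x ∈ disk ∧ n (m x) = x ∧ m (n x) = x

/-- A map of the disk, transported to `S`. -/
def conj (m : E2 → E2) (q : E2) : E2 := c.param (m (c.coord q))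

lemma contDiff_conj {m : E2 → E2} (hm : ContDiff ℝ ∞ m) : ContDiff ℝ ∞ (c.conj m) :=
  c.contDiff_param.comp (hm.comp c.contDiff_coord)

/-- The diffeomorphism of `S` given by a diffeomorphism of the disk. -/
def diffeo (m n : E2 → E2) (hm : ContDiff ℝ ∞ m) (hn : ContDiff ℝ ∞ n) (h : InverseOnDisk m n) :
    SmoothDiffeo S S where
  toEquiv :=
    { toFun := fun q => ⟨c.conj m q, c.param_mem _ (h _ (c.coord_mem q q.2)).1⟩
      invFun := fun q => ⟨c.conj n q, c.param_mem _ (h _ (c.coord_mem q q.2)).2.1⟩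
      left_inv := fun q => Subtype.ext (by
        simp only [conj]
        rw [c.coord_param _ (h _ (c.coord_mem q q.2)).1, (h _ (c.coord_mem q q.2)).2.2.1,
          c.param_coord q q.2])
      right_inv := fun q => Subtype.ext (by
        simp only [conj]
        rw [c.coord_param _ (h _ (c.coord_mem q q.2)).2.1, (h _ (c.coord_mem q q.2)).2.2.2,
          c.param_coord q q.2]) }
  smooth_toFun := ⟨c.conj m, c.contDiff_conj hm, fun _ => rfl⟩
  smooth_invFun := ⟨c.conj n, c.contDiff_conj hn, fun _ => rfl⟩

lemma diffeo_apply {m n : E2 → E2} (hm : ContDiff ℝ ∞ m) (hn : ContDiff ℝ ∞ n)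
    (h : InverseOnDisk m n) (q : S) : ((c.diffeo m n hm hn h).toEquiv q : E2) = c.conj m q := rfl

lemma diffeo_symm_apply {m n : E2 → E2} (hm : ContDiff ℝ ∞ m) (hn : ContDiff ℝ ∞ n)
    (h : InverseOnDisk m n) (q : S) : ((c.diffeo m n hm hn h).toEquiv.symm q : E2) = c.conj n q :=
  rfl

/-- The topology on diffeomorphisms is induced by the maps and their derivatives, so no control of
the inverses `n` is required. -/
lemma continuous_diffeo {P : Type} [TopologicalSpace P] {m n : P → E2 → E2}
    (hm : ∀ p, ContDiff ℝ ∞ (m p)) (hn : ∀ p, ContDiff ℝ ∞ (n p))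
    (h : ∀ p, InverseOnDisk (m p) (n p)) (Fm : ∀ k, FamilyOn disk k m) :
    Continuous fun p => c.diffeo (m p) (n p) (hm p) (hn p) (h p) := by
  refine continuous_induced_rng.2 (continuous_allDerivs_of_family c.isCompact c.uniqueDiffOn
    (f := fun p => c.conj (m p)) (fun _ _ => rfl) fun k => ?_)
  have h1 : FamilyOn S k fun p q => m p (c.coord q) :=
    FamilyOn.comp (g := m) (f := fun _ => c.coord) (Fm k)
      (FamilyOn.of_smoothNear (fun q _ => c.contDiff_coord.smoothNear q) k)
      fun _ q hq => c.coord_mem q hq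
  exact FamilyOn.comp (L := disk) (g := fun _ => c.param) (f := fun p q => m p (c.coord q))
    (FamilyOn.of_smoothNear (fun x _ => c.contDiff_param.smoothNear x) k) h1
    fun p q hq => ((h p) _ (c.coord_mem q hq)).1

lemma measurePreserving_diffeo {m n : E2 → E2} (hm : ContDiff ℝ ∞ m) (hn : ContDiff ℝ ∞ n)
    (h : InverseOnDisk m n) {α β : E2 → ℝ}
    (hdet : ∀ x ∈ disk, |(fderiv ℝ c.param (m x)).det * (fderiv ℝ m x).det| *
      β (c.param (m x)) = |(fderiv ℝ c.param x).det| * α (c.param x)) :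
    MeasurePreserving (c.diffeo m n hm hn h).toEquiv
      ((Measure.comap Subtype.val volume).withDensity fun q : S => ENNReal.ofReal (α q))
      ((Measure.comap Subtype.val volume).withDensity fun q : S => ENNReal.ofReal (β q)) := by
  refine measurePreserving_of_abs_det_mul c.isCompact.measurableSet _ (c.contDiff_conj hm)
    (fun _ => rfl) fun q hq => ?_
  have hx := c.coord_mem q hq
  have hchain : fderiv ℝ (c.conj m) q = (fderiv ℝ c.param (m (c.coord q))).comp
      ((fderiv ℝ m (c.coord q)).comp (fderiv ℝ c.coord q)) := by
    have h1 : HasFDerivAt (fun q => m (c.coord q))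
        ((fderiv ℝ m (c.coord q)).comp (fderiv ℝ c.coord q)) q :=
      HasFDerivAt.comp (g := m) q (hm.differentiable (by simp) _).hasFDerivAt
        (c.hasFDerivAt_coord q)
    exact (HasFDerivAt.comp (g := c.param) (f := fun q => m (c.coord q)) q
      (c.hasFDerivAt_param _) h1).fderiv
  have hd : (fderiv ℝ (c.conj m) q).det = (fderiv ℝ c.param (m (c.coord q))).det *
      (fderiv ℝ m (c.coord q)).det * (fderiv ℝ c.coord q).det := by
    rw [hchain]
    simp [ContinuousLinearMap.det, ContinuousLinearMap.toLinearMap_comp, LinearMap.det_comp,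
      mul_assoc]
  have h1 := c.det_mul_det hx
  have h2 := hdet _ hx
  rw [c.param_coord q hq] at h1 h2
  rw [hd, abs_mul, mul_right_comm, conj, h2, mul_right_comm, ← abs_mul,
    mul_comm _ (ContinuousLinearMap.det _), h1]
  simp

include c in
lemma volume_pos : 0 < volume S := by
  have h0 : (0 : E2) ∈ disk := by simp [disk]
  have hst : HasStrictFDerivAt c.param (fderiv ℝ c.param 0) 0 :=
    c.contDiff_param.contDiffAt.hasStrictFDerivAt (by simp)
  have hsurj : (fderiv ℝ c.param 0 : E2 →L[ℝ] E2).range = ⊤ :=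
    LinearMap.range_eq_top.2 fun v => ⟨_, c.fderiv_param_apply h0 v⟩
  refine Measure.measure_pos_of_mem_nhds volume (x := c.param 0) ?_
  rw [← hst.map_nhds_eq_of_surj hsurj]
  exact Filter.mem_of_superset (Filter.image_mem_map (Metric.closedBall_mem_nhds _ one_pos))
    c.image_param.subset

end DiskChart

namespace BraidedField

variable {Ω : Set E3} (hΩ : IsAxisymmetricToroidalDomain Ω) (B : BraidedField Ω)
include hΩ

lemma fieldMeasure_eq : fieldMeasure B = (Measure.comap Subtype.val volume).withDensity
    fun q : closedSection Ω => ENNReal.ofReal (B.azimuthal (0, q)) := by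
  rw [fieldMeasure]
  congr 1
  ext q
  rw [B.azimuthal_eq_swirl hΩ q.2]
  simp only [cyl_zero]

omit hΩ in
lemma continuous_azimuthal_section : Continuous fun q : E2 => B.azimuthal (0, q) :=
  B.contDiff_azimuthal.continuous.comp (by fun_prop : Continuous fun q : E2 => ((0 : ℝ), q))

lemma smul_fieldMeasure {a : ℝ} (ha : 0 ≤ a) : ENNReal.ofReal a • fieldMeasure B =
    (Measure.comap Subtype.val volume).withDensity
      fun q : closedSection Ω => ENNReal.ofReal (a * B.azimuthal (0, q)) := by
  rw [B.fieldMeasure_eq hΩ, ← withDensity_smul]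
  · congr 1
    ext q
    simp [ENNReal.ofReal_mul ha]
  · exact (B.continuous_azimuthal_section.comp continuous_subtype_val).measurable.ennreal_ofReal

lemma fieldMeasure_univ : fieldMeasure B univ =
    ∫⁻ q in closedSection Ω, ENNReal.ofReal (B.azimuthal (0, q)) := by
  rw [B.fieldMeasure_eq hΩ, withDensity_apply _ MeasurableSet.univ,
    setLIntegral_subtype hΩ.isCompact_closedSection.measurableSet univ
      fun q => ENNReal.ofReal (B.azimuthal (0, q))]
  simp

lemma fieldMeasure_univ_ne_top : fieldMeasure B univ ≠ ⊤ := by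
  rw [B.fieldMeasure_univ hΩ]
  exact (B.continuous_azimuthal_section.continuousOn.integrableOn_compact
    hΩ.isCompact_closedSection).lintegral_lt_top.ne

lemma fieldMeasure_univ_ne_zero : fieldMeasure B univ ≠ 0 := by
  obtain ⟨c⟩ := hΩ.nonempty_diskChart
  rw [B.fieldMeasure_univ hΩ]
  intro h
  rw [lintegral_eq_zero_iff B.continuous_azimuthal_section.measurable.ennreal_ofReal] at h
  have h1 := (ae_restrict_iff' hΩ.isCompact_closedSection.measurableSet).1 h
  refine c.volume_pos.ne' (measure_mono_null (fun q hq => ?_) (ae_iff.1 h1))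
  simp only [mem_ofPred_eq, Classical.not_imp]
  exact ⟨hq, by simpa using B.azimuthal_pos hΩ hq 0⟩

end BraidedField

/-! ### Normalization of the Poincaré maps -/

namespace BraidedField

variable {Ω : Set E3}

/-- Diffeomorphisms of the disk which normalize the measures of the fields. -/
lemma exists_normalization (hΩ : IsAxisymmetricToroidalDomain Ω)
    (c : DiskChart (closedSection Ω)) :
    ∃ (a : BraidedField Ω → ℝ) (m n : BraidedField Ω → E2 → E2), (∀ B, 0 < a B) ∧
      (∀ B, ContDiff ℝ ∞ (m B)) ∧ (∀ B, ContDiff ℝ ∞ (n B)) ∧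
      (∀ B, DiskChart.InverseOnDisk (m B) (n B)) ∧
      (∀ B, ∀ x ∈ disk, |(fderiv ℝ c.param (m B x)).det * (fderiv ℝ (m B) x).det| *
        c.param (m B x) 0 =
          |(fderiv ℝ c.param x).det| * (a B * B.azimuthal (0, c.param x))) ∧
      (∀ k, FamilyOn disk k m) ∧ ∀ k, FamilyOn disk k n := by
  have hdet : ContDiff ℝ ∞ fun x => (fderiv ℝ c.param x).det := by
    have h1 : ContDiff ℝ ∞ (fderiv ℝ c.param) := c.contDiff_param.fderiv_right (by simp)
    have h2 : ∀ i j, ContDiff ℝ ∞ fun x => fderiv ℝ c.param x (planeBasis i) j := fun i j =>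
      contDiff_euclidean.1 (h1.clm_apply contDiff_const) j
    simp_rw [plane_det_eq]
    exact ((h2 0 0).mul (h2 1 1)).sub ((h2 1 0).mul (h2 0 1))
  -- The Jacobian of the chart has no zero on the disk, so its absolute value is smooth near the
  -- disk; this avoids fixing the orientation of the chart.
  obtain ⟨δ, hδ, -, hδeq⟩ := exists_contDiff_eventuallyEq (C := disk) (isCompact_closedBall _ _)
    (w := fun x => |(fderiv ℝ c.param x).det|) fun x hx => by
      filter_upwards [hdet.continuous.continuousAt.eventually_ne
        (c.det_fderiv_param_ne_zero hx)] with y hy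
      exact (contDiffAt_abs hy).comp y hdet.contDiffAt
  have hδ' : ∀ x ∈ disk, δ x = |(fderiv ℝ c.param x).det| := fun x hx => (hδeq x hx).self_of_nhds
  have hδpos : ∀ x ∈ disk, 0 < δ x := fun x hx => by
    rw [hδ' x hx]; exact abs_pos.2 (c.det_fderiv_param_ne_zero hx)
  let s : BraidedField Ω → E2 → ℝ := fun B x => δ x * B.azimuthal (0, c.param x)
  let b : E2 → ℝ := fun x => δ x * c.param x 0
  have hs : ∀ B, ContDiff ℝ ∞ (s B) := fun B =>
    hδ.mul (B.contDiff_azimuthal.comp (contDiff_const.prodMk c.contDiff_param))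
  have hb : ContDiff ℝ ∞ b := hδ.mul (contDiff_euclidean.1 c.contDiff_param 0)
  have hspos : ∀ B, ∀ x ∈ disk, 0 < s B x := fun B x hx =>
    mul_pos (hδpos x hx) (B.azimuthal_pos hΩ (c.param_mem x hx) 0)
  have hbpos : ∀ x ∈ disk, 0 < b x := fun x hx => mul_pos (hδpos x hx) (c.param_mem x hx).1
  have Fs : ∀ k, FamilyOn disk k s := fun k => by
    have h1 : FamilyOn disk k fun (B : BraidedField Ω) x => B.azimuthal (0, c.param x) :=
      FamilyOn.comp (L := closedSection Ω)
        (g := fun (B : BraidedField Ω) q => B.azimuthal (0, q)) (f := fun _ => c.param)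
        (familyOn_azimuthal hΩ continuous_id continuous_const k) (familyOn_param c k)
        fun _ x hx => c.param_mem x hx
    exact (FamilyOn.of_smoothNear (fun x _ => hδ.smoothNear x) k).mul h1
  have hbm : 0 < circleMean b := circleMean_pos hb hbpos
  have hsm : ∀ B, 0 < circleMean (s B) := fun B => circleMean_pos (hs B) (hspos B)
  -- This scaling equalizes the circle means, as Moser's theorem requires. It is recognized as a
  -- quotient of total masses only after `Y` has been constructed.
  let a : BraidedField Ω → ℝ := fun B => circleMean b / circleMean (s B)
  have ha : ∀ B, 0 < a B := fun B => div_pos hbm (hsm B)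
  have hac : Continuous a :=
    continuous_const.div (continuous_circleMean hs (Fs 0)) fun B => (hsm B).ne'
  obtain ⟨m, n, hm, hn, hmn, Fm, Fn⟩ := exists_moser (a := fun B x => a B * s B x)
    (b := fun _ => b) (fun B => contDiff_const.mul (hs B)) (fun _ => hb)
    (fun k => (FamilyOn.of_continuous hac k).mul (Fs k))
    (fun k => FamilyOn.of_smoothNear (fun x _ => hb.smoothNear x) k)
    (fun B x hx => mul_pos (ha B) (hspos B x hx)) (fun _ => hbpos) (fun B => by
      rw [circleMean_const_mul]
      exact div_mul_cancel₀ _ (hsm B).ne')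
  refine ⟨a, m, n, ha, hm, hn, fun B x hx => ?_, fun B x hx => ?_, Fm, Fn⟩
  · obtain ⟨h1, h2, h3, h4, -⟩ := hmn B x hx
    exact ⟨h1, h2, h3, h4⟩
  · obtain ⟨h1, -, -, -, h5⟩ := hmn B x hx
    -- The transport identity between two positive densities forces a positive Jacobian.
    have h6 : 0 < (fderiv ℝ (m B) x).det :=
      pos_of_mul_pos_left (h5.symm ▸ mul_pos (ha B) (hspos B x hx)) (hbpos _ h1).le
    rw [abs_mul, abs_of_pos h6, ← hδ' _ h1, ← hδ' _ hx]
    simp only [b, s] at h5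
    linarith

/-- The flows of the fields on the disk, in the time `θ`. -/
lemma exists_flow_on_disk (hΩ : IsAxisymmetricToroidalDomain Ω)
    (c : DiskChart (closedSection Ω)) :
    ∃ φ ψ : BraidedField Ω → ℝ × E2 → E2, (∀ B, ContDiff ℝ ∞ (φ B)) ∧
      (∀ B, ContDiff ℝ ∞ (ψ B)) ∧ (∀ B x, φ B (0, x) = x) ∧
      (∀ B, ∀ t ∈ Icc 0 (2 * Real.pi),
        DiskChart.InverseOnDisk (fun x => φ B (t, x)) fun x => ψ B (t, x)) ∧
      (∀ B, ∀ t ∈ Icc 0 (2 * Real.pi), ∀ x ∈ disk,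
        HasDerivAt (fun s => φ B (s, x)) (B.diskField c (t, φ B (t, x))) t) ∧
      ∀ k, FamilyOn disk k fun B x => φ B (2 * Real.pi, x) := by
  have hπ : 2 * Real.pi ∈ Icc 0 (2 * Real.pi) := ⟨by positivity, le_rfl⟩
  obtain ⟨φ, ψ, hφ, hψ, h0, h, Fφ, -⟩ := exists_disk_flow hπ.1
    (W := fun B : BraidedField Ω => B.diskField c)
    (fun B z hz => B.smoothNear_diskField hΩ c z.1 hz.2)
    (fun k => familyOn_diskField hΩ c continuous_fst
      (continuous_subtype_val.comp continuous_snd) k)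
    fun B t _ x hx => B.inner_diskField hΩ c t hx
  refine ⟨φ, ψ, hφ, hψ, h0, fun B t ht x hx => ?_, fun B t ht x hx => (h B t ht x hx).2.2.2.2,
    fun k => (Fφ k).reparam (by fun_prop :
      Continuous fun B : BraidedField Ω => (B, (⟨2 * Real.pi, hπ⟩ : Icc 0 (2 * Real.pi))))⟩
  obtain ⟨h1, h2, h3, h4, -⟩ := h B t ht x hx
  exact ⟨h1, h2, h3, h4⟩

end BraidedField

lemma DiskChart.InverseOnDisk.conj {m n f g : E2 → E2} (h : DiskChart.InverseOnDisk m n)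
    (hf : DiskChart.InverseOnDisk f g) :
    DiskChart.InverseOnDisk (fun x => m (f (n x))) fun x => m (g (n x)) := by
  intro x hx
  obtain ⟨-, h1, -, h2⟩ := h x hx
  obtain ⟨h3, h4, h5, h6⟩ := hf _ h1
  exact ⟨(h _ h3).1, (h _ h4).1, by simp only; rw [(h _ h3).2.2.1, h5, h2],
    by simp only; rw [(h _ h4).2.2.1, h6, h2]⟩

/-- Stopping the flow at time `T * t` gives the isotopy; at `t = 0` it is the conjugate of the
identity. -/
lemma DiskChart.isIsotopicToId {S : Set E2} (c : DiskChart S) {T : ℝ} (hT : 0 ≤ T)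
    {m n : E2 → E2} {φ ψ : ℝ × E2 → E2} (hm : ContDiff ℝ ∞ m) (hn : ContDiff ℝ ∞ n)
    (hφ : ContDiff ℝ ∞ φ) (hψ : ContDiff ℝ ∞ ψ) (h : DiskChart.InverseOnDisk m n)
    (hφψ : ∀ t ∈ Icc 0 T, DiskChart.InverseOnDisk (fun x => φ (t, x)) fun x => ψ (t, x))
    (h0 : ∀ x, φ (0, x) = x) (Φ : SmoothDiffeo S S)
    (hΦ : ∀ q : S, (Φ.toEquiv q : E2) = c.conj (fun x => m (φ (T, n x))) q) :
    IsIsotopicToId Φ := by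
  have hmem : ∀ t : Icc (0 : ℝ) 1, T * t ∈ Icc 0 T := fun t =>
    ⟨mul_nonneg hT t.2.1, mul_le_of_le_one_right hT t.2.2⟩
  have hs : ∀ f : ℝ × E2 → E2, ContDiff ℝ ∞ f → ∀ t : ℝ,
      ContDiff ℝ ∞ fun x => m (f (t, n x)) := fun f hf t =>
    hm.comp (hf.comp (contDiff_const.prodMk hn))
  have hinv : ∀ t ∈ Icc 0 T,
      DiskChart.InverseOnDisk (fun x => m (φ (t, n x))) fun x => m (ψ (t, n x)) := fun t ht =>
    DiskChart.InverseOnDisk.conj (f := fun x => φ (t, x)) (g := fun x => ψ (t, x)) h (hφψ t ht)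
  let H : Icc (0 : ℝ) 1 → SmoothDiffeo S S := fun t =>
    c.diffeo (fun x => m (φ (T * t, n x))) (fun x => m (ψ (T * t, n x))) (hs φ hφ (T * t))
      (hs ψ hψ (T * t)) (hinv _ (hmem t))
  refine ⟨H, ⟨fun z => c.param (m (φ (T * z.1, n (c.coord z.2)))), ?_, fun t q => rfl⟩,
    fun q => Subtype.ext ?_, fun q => Subtype.ext ?_⟩
  · have h1 : ContDiff ℝ ∞ fun z : ℝ × E2 => (T * z.1, n (c.coord z.2)) :=
      (contDiff_const.mul contDiff_fst).prodMk (hn.comp (c.contDiff_coord.comp contDiff_snd))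
    exact c.contDiff_param.comp (hm.comp (hφ.comp h1))
  · simp only [H]
    rw [c.diffeo_apply, DiskChart.conj]
    simp only [Icc.coe_zero, mul_zero, h0]
    rw [(h _ (c.coord_mem q q.2)).2.2.2, c.param_coord q q.2]
  · simp only [H]
    rw [hΦ, c.diffeo_apply]
    simp only [Icc.coe_one, mul_one]

theorem lemma2p2 (Ω : Set E3) (hΩ : IsAxisymmetricToroidalDomain Ω) :
    ∃ (J : BraidedField Ω → AreaPreservingDiffeo Ω)
      (Y : BraidedField Ω → SmoothDiffeo (closedSection Ω) (closedSection Ω)),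
      Continuous J ∧ Continuous Y ∧
      ∀ B : BraidedField Ω,
        (∃ P : closedSection Ω → closedSection Ω, IsPoincareMap B P ∧
          ∀ x, (J B).1.toEquiv x = (Y B).toEquiv (P ((Y B).toEquiv.symm x))) ∧
        MeasurePreserving (Y B).toEquiv
          ((areaMeasure Ω univ / fieldMeasure B univ) • fieldMeasure B) (areaMeasure Ω) := by
  obtain ⟨c⟩ := hΩ.nonempty_diskChart
  obtain ⟨a, m, n, ha, hm, hn, hmn, hdet, Fm, Fn⟩ := BraidedField.exists_normalization hΩ c
  obtain ⟨φ, ψ, hφ, hψ, h0, hφψ, hder, Fφ⟩ := BraidedField.exists_flow_on_disk hΩ c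
  have hπ : 2 * Real.pi ∈ Icc 0 (2 * Real.pi) := ⟨by positivity, le_rfl⟩
  have hφs : ∀ B, ContDiff ℝ ∞ fun x => φ B (2 * Real.pi, x) := fun B =>
    (hφ B).comp (contDiff_const.prodMk contDiff_id)
  have hψs : ∀ B, ContDiff ℝ ∞ fun x => ψ B (2 * Real.pi, x) := fun B =>
    (hψ B).comp (contDiff_const.prodMk contDiff_id)
  have hφs' : ∀ B, ContDiff ℝ ∞ fun x => m B (φ B (2 * Real.pi, n B x)) := fun B =>
    (hm B).comp ((hφs B).comp (hn B))
  have hψs' : ∀ B, ContDiff ℝ ∞ fun x => m B (ψ B (2 * Real.pi, n B x)) := fun B =>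
    (hm B).comp ((hψs B).comp (hn B))
  have hinv : ∀ B, DiskChart.InverseOnDisk (fun x => m B (φ B (2 * Real.pi, n B x)))
      fun x => m B (ψ B (2 * Real.pi, n B x)) := fun B =>
    DiskChart.InverseOnDisk.conj (f := fun x => φ B (2 * Real.pi, x))
      (g := fun x => ψ B (2 * Real.pi, x)) (hmn B) (hφψ B _ hπ)
  let Y : BraidedField Ω → SmoothDiffeo (closedSection Ω) (closedSection Ω) := fun B =>
    c.diffeo (m B) (n B) (hm B) (hn B) (hmn B)
  let R : BraidedField Ω → SmoothDiffeo (closedSection Ω) (closedSection Ω) := fun B =>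
    c.diffeo (fun x => φ B (2 * Real.pi, x)) (fun x => ψ B (2 * Real.pi, x)) (hφs B)
      (hψs B) (hφψ B _ hπ)
  let Φ : BraidedField Ω → SmoothDiffeo (closedSection Ω) (closedSection Ω) := fun B =>
    c.diffeo (fun x => m B (φ B (2 * Real.pi, n B x))) (fun x => m B (ψ B (2 * Real.pi, n B x)))
      (hφs' B) (hψs' B) (hinv B)
  have hΦ : ∀ B x, (Φ B).toEquiv x = (Y B).toEquiv ((R B).toEquiv ((Y B).toEquiv.symm x)) := by
    intro B q
    refine Subtype.ext ?_
    have hx := c.coord_mem q q.2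
    have h1 := (hmn B _ hx).2.1
    have h2 := (hφψ B _ hπ _ h1).1
    simp only [Φ, Y, R, c.diffeo_apply, c.diffeo_symm_apply, DiskChart.conj]
    rw [c.coord_param _ h1, c.coord_param _ h2]
  have hY : ∀ B, MeasurePreserving (Y B).toEquiv (ENNReal.ofReal (a B) • fieldMeasure B)
      (areaMeasure Ω) := fun B => by
    rw [B.smul_fieldMeasure hΩ (ha B).le]
    exact c.measurePreserving_diffeo (α := fun q => a B * B.azimuthal (0, q))
      (β := fun q => q 0) (hm B) (hn B) (hmn B) (hdet B)
  have hR : ∀ B, MeasurePreserving (R B).toEquiv (fieldMeasure B) (fieldMeasure B) := fun B => by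
    rw [B.fieldMeasure_eq hΩ]
    refine c.measurePreserving_diffeo (α := fun q => B.azimuthal (0, q))
      (β := fun q => B.azimuthal (0, q)) (hφs B) (hψs B) (hφψ B _ hπ) fun x hx => ?_
    have h1 := B.det_fderiv_flow hΩ c (hφ B) (h0 B) (fun t ht x hx => (hφψ B t ht x hx).1)
      (hder B) hx
    have h2 := B.azimuthal_pos hΩ (c.param_mem x hx) 0
    have h3 := B.azimuthal_pos hΩ (c.param_mem _ (hφψ B _ hπ x hx).1) 0
    have h4 := congrArg abs h1
    rwa [abs_mul, abs_mul (ContinuousLinearMap.det _) (B.azimuthal _), abs_of_pos h2,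
      abs_of_pos h3] at h4
  -- The area measure is the image under `Y B` of a multiple of the field measure, which `R B`
  -- preserves, and `Φ B` after `Y B` is `Y B` after `R B`.
  have hΦμ : ∀ B, MeasurePreserving (Φ B).toEquiv (areaMeasure Ω) (areaMeasure Ω) := fun B => by
    have h1 := (hR B).smul_measure (ENNReal.ofReal (a B))
    have h2 : MeasurePreserving ((Φ B).toEquiv ∘ (Y B).toEquiv)
        (ENNReal.ofReal (a B) • fieldMeasure B) (areaMeasure Ω) := by
      have h3 : (Φ B).toEquiv ∘ (Y B).toEquiv = (Y B).toEquiv ∘ (R B).toEquiv :=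
        funext fun q => by simp [hΦ]
      rw [h3]
      exact (hY B).comp h1
    have hc : Continuous (Φ B).toEquiv :=
      ((c.contDiff_conj (hφs' B)).continuous.comp continuous_subtype_val).subtype_mk _
    refine ⟨hc.measurable, ?_⟩
    conv_lhs => rw [← (hY B).map_eq]
    rw [Measure.map_map hc.measurable (hY B).measurable, h2.map_eq]
  have hiso : ∀ B, IsIsotopicToId (Φ B) := fun B =>
    c.isIsotopicToId hπ.1 (hm B) (hn B) (hφ B) (hψ B) (hmn B) (hφψ B) (h0 B) _ fun _ => rfl
  have hΦc : Continuous Φ := by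
    refine c.continuous_diffeo hφs' hψs' hinv fun k => ?_
    have h1 : FamilyOn disk k fun B x => φ B (2 * Real.pi, n B x) :=
      FamilyOn.comp (L := disk) (g := fun B x => φ B (2 * Real.pi, x)) (Fφ k) (Fn k)
        fun B x hx => (hmn B x hx).2.1
    exact FamilyOn.comp (L := disk) (g := m) (Fm k) h1
      fun B x hx => (hφψ B _ hπ _ (hmn B x hx).2.1).1
  refine ⟨fun B => ⟨Φ B, hΦμ B, hiso B⟩, Y, hΦc.subtype_mk _,
    c.continuous_diffeo hm hn hmn Fm, fun B => ⟨⟨(R B).toEquiv, fun q => ?_, hΦ B⟩, ?_⟩⟩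
  · have hx := c.coord_mem q q.2
    refine B.isFirstReturn hΩ (y := fun t => c.param (φ B (t, c.coord q)))
      (fun t ht => c.param_mem _ (hφψ B t ht _ hx).1) (fun t ht => ?_) ?_ rfl
    · rw [← B.fderiv_param_diskField c t (hφψ B t ht _ hx).1]
      exact HasFDerivAt.comp_hasDerivAt (f := fun s => φ B (s, c.coord q)) t
        (c.hasFDerivAt_param _) (hder B t ht _ hx)
    · simp only [h0]
      exact c.param_coord q q.2
  -- Comparing total masses in `hY` identifies the constant `a B`, defined by circle means, with the
  -- required quotient.
  · have h1 : areaMeasure Ω univ = ENNReal.ofReal (a B) * fieldMeasure B univ := by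
      rw [← (hY B).measure_preimage MeasurableSet.univ.nullMeasurableSet]
      simp
    rw [h1, ENNReal.mul_div_cancel_right (B.fieldMeasure_univ_ne_zero hΩ)
      (B.fieldMeasure_univ_ne_top hΩ)]
    exact hY B
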